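/- **Model.** A dynamic network has $n\ge 2$ nodes with distinct identifiers from $\{1,\dots,U\}$, where $U\le n^{A}$ for a constant $A$ (identifiers of $O(\log n)$ bits). All nodes know $U$, the parameters $b$ and $T$, and an estimate $N$ with $n/2\le N\le 2n$. Time proceeds in synchronous rounds $t=0,1,2,\dots$. In each round an adaptive adversary first chooses a connected graph on the nodes, depending on everything that happened (including all random choices) in the previous rounds. Then each node, using fresh independent randomness and not knowing its neighbours, chooses a message, and receives the messages of its neighbours. The network is $T$-stable ($T\ge 1$) if the graph changes only every $T$ rounds, i.e. it is constant on each block of rounds $mT,\dots,(m+1)T-1$. Let $b$ be an integer with $b\ge\log n$. In the $k$-indexed-broadcast problem there are $k$ tokens with indices $1,\dots,k$; each token is initially held (with its index) by at least one node, the tokens and their distribution being arbitrary; every node has to output all tokens with their indices. **Algorithm.** The patch-sharing network coding algorithm treats the $k=bT$ tokens $t_i$ of $bT$ bits as vectors over $\mathbb F_2$. A node that initially holds $t_i$ has initially received the vector $(e_i,t_i)\in\mathbb F_2^{2bT}$. Put $\ell=\lfloor\log_2 N\rfloor+2$ and $D=\lfloor T/(2(2\kappa\ell+5))\rfloor$ with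 a constant $\kappa$. Each block of $T$ rounds is a meta round that consists of the following steps. 1. *Patches.* Compute an independent set (the leaders) in the $D$-th power of the graph by $\kappa\ell$ iterations of Luby's algorithm. In each iteration every active node draws a random priority of $4\ell$ bits (ties are broken by identifier), the highest priorities are flooded for $D$ rounds, each active node that heard no higher priority than its own becomes a leader, and a deactivation message is flooded from the new leaders for $D$ rounds. Then in $D$ rounds grow breadth-first trees from all leaders simultaneously, each node choosing as parent the sender of lowest identifier among those from which it first hears. The trees are the patches; a node reached by no tree is in no patch in this meta round. If $D=0$, every node is a leader and a patch by itself. 2. *Share.* Every node of a patch forms a uniformly random linear combination of the vectors it has received. These are summed up the tree to the leader, and the sum is sent down the tree to all nodes of the patch, which add it to their received vectors; both transmissions are pipelined, with vectors cut into $S$ pieces of $O(b)$ bits ($S=\lfloor T/10\rfloor$ if $D\ge1$, $S=T$ if $D=0$). If $D=0$ this step is local and takes no rounds. 3. *Pass.* Every node of a patch broadcasts the sum of its patch to its neighbours in $S$ pieces, and the neighbours add it to their received vectors. 4. *Share.* Step 2 is repeated with the new received vectors (if $D=0$, this is vacuous and omitted). A node outputs as token $i$ the vector $y$ such that $(e_i,y)$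 lies in the span of its received vectors, if there is such a $y$. **Statement.** There is a constant $\kappa$ such that for every $A$ there is a constant $B$ such that for every $c$ there is a constant $C$ with the following property. For all $n\ge2$, $N$, $b\ge\log n$, $T\ge1$ and $U$ as above, the messages of the patch-sharing network coding algorithm have at most $Bb$ bits, and for every $T$-stable adaptive adversary, every assignment of identifiers, all $bT$ tokens of $bT$ bits and every initial distribution of them, and every number of rounds $R\ge C\,(n+bT^2)\log n$, with probability at least $1-n^{-c}$ all nodes output all $bT$ tokens with the correct indices after $R$ rounds. That is, with high probability the algorithm solves $bT$-indexed-broadcast with tokens of size $bT$ in a $T$-stable dynamic network in $O((n+bT^2)\log n)$ rounds with messages of $O(b)$ bits. -/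

import Mathlib

/-! ### Randomized protocols in the dynamic network model -/

/-- A randomized distributed protocol for anonymous broadcast. Every node runs the same code. It
starts from its own identifier and its own input. In round `t` (counted from `0`) it draws a fresh
uniform seed, chooses a message from its state and the seed (without knowing its neighbours), and
then updates its state on receiving the multiset of the messages of its neighbours. Local
computation is unrestricted. -/
structure Protocol (Uid Inp Out : Type) where
  Msg : Type
  State : Type
  Seed : Type
  seedFintype : Fintype Seed
  seedNonempty : Nonempty Seed
  init : Uid → Inp → State
  send : ℕ → State → Seed → Msg
  recv : ℕ → State → Seed → Multiset Msg → State
  out : State → Out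

namespace Protocol

variable {Uid Inp Out : Type}

/-- Messages can be encoded by bit strings of length `m`. -/
def MessageBits (P : Protocol Uid Inp Out) (m : ℕ) : Prop :=
  Finite P.Msg ∧ Nat.card P.Msg ≤ 2 ^ m

/-- The random choices of all nodes in the past rounds, the latest round first. -/
abbrev History (P : Protocol Uid Inp Out) (n : ℕ) : Type := List (Fin n → P.Seed)

/-- An adaptive adversary picks the graph of the current round from all random choices of the past
rounds (which, with the inputs, determine all past messages and all current states), before the
nodes draw the seeds of the current round. -/
abbrev Adversary (P : Protocol Uid Inp Out) (n : ℕ) : Type := P.History n → SimpleGraph (Fin n)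

/-- In every round the graph is connected. -/
def Adversary.AlwaysConnected {P : Protocol Uid Inp Out} {n : ℕ} (adv : P.Adversary n) : Prop :=
  ∀ h, (adv h).Connected

/-- The graph changes only every `T` rounds: the graph of round `t + 1` can differ from the graph of
round `t` only if `T` divides `t + 1`. -/
def Adversary.Stable {P : Protocol Uid Inp Out} {n : ℕ} (adv : P.Adversary n) (T : ℕ) : Prop :=
  ∀ (h : P.History n) (s : Fin n → P.Seed), ¬ T ∣ h.length + 1 → adv (s :: h) = adv h

open Classical in
/-- The states of all nodes after the rounds recorded in a history. -/
noncomputable def run (P : Protocol Uid Inp Out) {n : ℕ} (uid : Fin n → Uid) (inp : Fin n → Inp)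
    (adv : P.Adversary n) : P.History n → Fin n → P.State
  | [] => fun v => P.init (uid v) (inp v)
  | s :: h => fun v =>
      P.recv h.length (P.run uid inp adv h v) (s v)
        ((Finset.univ.filter fun u => (adv h).Adj v u).val.map
          fun u => P.send h.length (P.run uid inp adv h u) (s u))

open Classical in
/-- The law of the random choices of `R` rounds: the seeds of distinct rounds and of distinct nodes
are independent and uniform. -/
noncomputable def historyLaw (P : Protocol Uid Inp Out) (n : ℕ) : ℕ → PMF (P.History n)
  | 0 => PMF.pure []
  | R + 1 =>
      haveI := P.seedFintype
      haveI := P.seedNonempty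
      (P.historyLaw n R).bind fun h =>
        (PMF.uniformOfFintype (Fin n → P.Seed)).map fun s => s :: h

/-- The probability that after `R` rounds the outputs of the nodes satisfy `E`. -/
noncomputable def outputProb (P : Protocol Uid Inp Out) {n : ℕ} (uid : Fin n → Uid)
    (inp : Fin n → Inp) (adv : P.Adversary n) (R : ℕ) (E : (Fin n → Out) → Prop) : ℝ :=
  ((P.historyLaw n R).toOuterMeasure {h | E fun v => P.out (P.run uid inp adv h v)}).toReal

end Protocol

/-! ### Indexed broadcast -/

/-- Tokens of `d` bits. -/
abbrev Token (d : ℕ) : Type := Fin d → ZMod 2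

/-- A node knows the tokens of an index set. -/
abbrev TokenTable (k d : ℕ) : Type := Fin k → Option (Token d)

/-- The input of a node that initially holds the tokens with indices in `H`. -/
def initialTable {k d : ℕ} (tok : Fin k → Token d) (H : Finset (Fin k)) : TokenTable k d :=
  fun i => if i ∈ H then some (tok i) else none

/-- For every assignment of identifiers, all tokens `t_1, …, t_k` of `d` bits, every initial
distribution of the tokens in which each token is held by some node, and every adaptive adversary
that keeps the network connected and `T`-stable, after `R` rounds all nodes output all tokens (with
the right indices) with probability at least `p`. -/
def SolvesIndexedBroadcast {U k d : ℕ} (P : Protocol (Fin U) (TokenTable k d) (TokenTable k d))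
    (n T R : ℕ) (p : ℝ) : Prop :=
  ∀ (uid : Fin n → Fin U), Function.Injective uid →
  ∀ (tok : Fin k → Token d) (H : Fin n → Finset (Fin k)), (∀ i, ∃ v, i ∈ H v) →
  ∀ adv : P.Adversary n, adv.AlwaysConnected → adv.Stable T →
    p ≤ P.outputProb uid (fun v => initialTable tok (H v)) adv R
      (fun o => ∀ v i, o v i = some (tok i))

/-! ### The patch-sharing network coding algorithm -/

namespace PatchSharing

/-- What the nodes know in advance: a constant `κ` that tunes the number of iterations of the
independent set computation, an estimate `N` of the number of nodes, the message size parameter `b`,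
the stability `T`, and the size `U` of the space of identifiers. -/
structure Params where
  κ : ℕ
  N : ℕ
  b : ℕ
  T : ℕ
  U : ℕ

namespace Params

variable (p : Params)

/-- Number of tokens, and number of bits of a token. -/
def k : ℕ := p.b * p.T

/-- About `log n`. -/
def ell : ℕ := Nat.log 2 p.N + 2

/-- Number of iterations of the maximal independent set computation. -/
def iters : ℕ := p.κ * p.ell

/-- The patch radius `D = Θ(T / log n)`. If it is `0`, the patches are the single nodes. -/
def D : ℕ := p.T / (2 * (2 * p.iters + 5))

/-- Number of pieces into which a vector is cut for transmission. -/
def S : ℕ := if p.D = 0 then p.T else p.T / 10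

/-- Length of a piece. -/
def w : ℕ := 2 * p.k / p.S + 1

/-- Number of rounds of a pipelined transmission up or down the trees of the patches; nothing has to
be sent if the patches are single nodes. -/
def E : ℕ := if p.D = 0 then 0 else p.S + p.D

/-- Size of the range of the random priorities. -/
def prioRange : ℕ := 2 ^ (4 * p.ell)

/-! A meta round consists of `T` rounds. The following are the first rounds of its phases. -/

def treeStart : ℕ := 2 * p.D * p.iters
def up₁ : ℕ := p.treeStart + p.D
def down₁ : ℕ := p.up₁ + p.E
def passStart : ℕ := p.down₁ + p.E
def up₂ : ℕ := p.passStart + p.S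
def down₂ : ℕ := p.up₂ + p.E
def idleStart : ℕ := p.down₂ + p.E

end Params

/-- Coded vectors over `𝔽₂`: a coefficient vector followed by a payload. -/
abbrev Vec (p : Params) : Type := Fin (p.k + p.k) → ZMod 2

/-- Pieces of coded vectors. -/
abbrev Piece (p : Params) : Type := Fin p.w → ZMod 2

/-- Priorities, with ties broken by the identifier; `⊥` stands for no priority. -/
abbrev Prio (p : Params) : Type := WithBot (Fin p.prioRange ×ₗ Fin p.U)

/-- The vector of a token: the basis vector of its index, followed by the token. -/
def codeword {p : Params} (i : Fin p.k) (y : Token p.k) : Vec p := Fin.append (Pi.single i 1) y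

/-- The `i`-th piece of a vector, padded with zeros. -/
def piece {p : Params} (i : ℕ) (x : Vec p) : Piece p :=
  fun j => if h : i * p.w + j < p.k + p.k then x ⟨i * p.w + j, h⟩ else 0

/-- The vector with given `i`-th piece and zeros elsewhere. -/
def unpiece {p : Params} (i : ℕ) (c : Piece p) : Vec p :=
  fun j => if (j : ℕ) / p.w = i then c ⟨(j : ℕ) % p.w, Nat.mod_lt _ (Nat.succ_pos _)⟩ else 0

inductive Msg (p : Params) : Type
  | silent
  /-- the highest priority heard -/
  | prio (x : Prio p)
  /-- there is a new leader nearby -/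
  | deactivate
  /-- the sender has just joined the tree of its patch -/
  | tree (sender : Fin p.U)
  /-- a piece, with the identifier of its addressee (up a tree) or of its sender (otherwise) -/
  | vec (u : Fin p.U) (c : Piece p)

/-- The priority that a message carries. -/
def Msg.getPrio {p : Params} : Msg p → Prio p
  | .prio x => x
  | _ => ⊥

/-- The sender of a tree message. -/
def Msg.getTree {p : Params} : Msg p → Option (Fin p.U)
  | .tree u => some u
  | _ => none

/-- The identifier in a message that carries a piece. -/
def Msg.getId {p : Params} : Msg p → Option (Fin p.U)
  | .vec u _ => some u
  | _ => none

/-- The vector whose `i`-th piece is carried by the message with label `u`, else zero. -/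
def Msg.getVec {p : Params} (i : ℕ) (u : Fin p.U) : Msg p → Vec p
  | .vec u' c => if u' = u then unpiece i c else 0
  | _ => 0

structure State (p : Params) : Type where
  uid : Fin p.U
  /-- all vectors received so far -/
  known : Finset (Vec p)
  /-- still takes part in the independent set computation of this meta round -/
  active : Bool
  /-- is in the independent set -/
  leader : Bool
  /-- own priority in the current iteration -/
  mine : Prio p
  /-- highest priority heard in the current iteration -/
  best : Prio p
  /-- knows of a new leader nearby in the current iteration -/
  flag : Bool
  /-- depth in the tree of the patch, if the node is in a patch -/
  depth : Option ℕ
  /-- parent in the tree of the patch -/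
  parent : Option (Fin p.U)
  /-- cumulative sum of the random sums of the descendants -/
  acc : Vec p
  /-- the random sum of the patch -/
  sum : Vec p
  /-- vectors assembled from the pieces passed by neighbours, by identifier of the neighbour -/
  inbox : Fin p.U → Vec p
  /-- the neighbours that passed something -/
  heard : Finset (Fin p.U)

/-- Per round, a random priority and a random coefficient for each vector. -/
abbrev Seed (p : Params) : Type := Fin p.prioRange × (Vec p → ZMod 2)

/-- The linear combination of the known vectors with the given coefficients. -/
def combination {p : Params} (K : Finset (Vec p)) (r : Vec p → ZMod 2) : Vec p := ∑ x ∈ K, r x • x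

/-- At the beginning each node has received the vectors of its tokens. -/
def init (p : Params) (u : Fin p.U) (inp : TokenTable p.k p.k) : State p where
  uid := u
  known := Finset.univ.biUnion fun i => ((inp i).map (codeword i)).toFinset
  active := false
  leader := false
  mine := ⊥
  best := ⊥
  flag := false
  depth := none
  parent := none
  acc := 0
  sum := 0
  inbox := 0
  heard := ∅

/-! Local computations at the beginning of a phase. -/

/-- New meta round. In the graph power `G⁰` all nodes are in the maximal independent set. -/
def State.reset {p : Params} (st : State p) : State p :=
  { st with
    active := true
    leader := decide (p.D = 0)
    inbox := 0
    heard := ∅ }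

/-- New iteration of the independent set computation: active nodes draw a priority. -/
def State.draw {p : Params} (st : State p) (r : Fin p.prioRange) : State p :=
  let x : Prio p := if st.active then ((toLex (r, st.uid) : Fin p.prioRange ×ₗ Fin p.U) : Prio p) else ⊥
  { st with mine := x, best := x, flag := false }

/-- An active node that heard no higher priority joins the independent set. -/
def State.decideLeader {p : Params} (st : State p) : State p :=
  if st.active = true ∧ st.best = st.mine then
    { st with leader := true, active := false, flag := true }
  else st

/-- The leaders become the roots of the trees. -/
def State.plant {p : Params} (st : State p) : State p :=
  { st with depth := if st.leader then some 0 else none, parent := none }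

/-- A share step begins with a random sum of the own vectors. -/
def State.startUp {p : Params} (st : State p) (r : Vec p → ZMod 2) : State p :=
  { st with acc := combination st.known r }

/-- The root has the sum for the whole patch, which is then distributed. -/
def State.startDown {p : Params} (st : State p) : State p :=
  { st with sum := if st.leader then st.acc else 0 }

/-- The local computations at the beginning of round `s` of a meta round. -/
def prepare (p : Params) (s : ℕ) (r : Seed p) (st : State p) : State p :=
  let st := if s = 0 then st.reset else st
  let st := if s < p.treeStart ∧ s % (2 * p.D) = 0 then st.draw r.1 else st
  let st := if s < p.treeStart ∧ s % (2 * p.D) = p.D then st.decideLeader else st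
  let st := if s = p.treeStart then st.plant else st
  let st := if s = p.up₁ ∨ s = p.up₂ then st.startUp r.2 else st
  if s = p.down₁ ∨ s = p.down₂ then st.startDown else st

/-- What is done in a round; the argument is the number of the round in its phase. -/
inductive Phase : Type
  | prio
  | deactivate
  | tree (j : ℕ)
  | up (j : ℕ)
  | down (j : ℕ)
  | pass (j : ℕ)
  | idle

/-- The schedule of a meta round: in each iteration of the independent set computation `D` rounds for
the priorities and `D` rounds for the deactivation; `D` rounds to build the trees; share (up and
down); pass; share (up and down). -/
def phase (p : Params) (s : ℕ) : Phase :=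
  if s < p.treeStart then if s % (2 * p.D) < p.D then .prio else .deactivate
  else if s < p.up₁ then .tree (s - p.treeStart)
  else if s < p.down₁ then .up (s - p.up₁)
  else if s < p.passStart then .down (s - p.down₁)
  else if s < p.up₂ then .pass (s - p.passStart)
  else if s < p.down₂ then .up (s - p.up₂)
  else if s < p.idleStart then .down (s - p.down₂)
  else .idle

/-- The message of a (prepared) node. Up the tree, a node of depth `δ` sends its `i`-th piece in
round `i + (D - δ)` of the phase; down the tree, in round `i + δ`. -/
def message {p : Params} (st : State p) : Phase → Msg p
  | .prio => .prio st.best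
  | .deactivate => if st.flag then .deactivate else .silent
  | .tree j => if st.depth = some j then .tree st.uid else .silent
  | .up j =>
      match st.depth, st.parent with
      | some δ, some u =>
          if p.D ≤ j + δ ∧ j + δ - p.D < p.S then .vec u (piece (j + δ - p.D) st.acc) else .silent
      | _, _ => .silent
  | .down j =>
      match st.depth with
      | some δ => if δ ≤ j ∧ j - δ < p.S then .vec st.uid (piece (j - δ) st.sum) else .silent
      | none => .silent
  | .pass j => if st.depth.isSome then .vec st.uid (piece j st.sum) else .silent
  | .idle => .silent

open Classical in
/-- The update of a (prepared) node on receiving messages. -/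
noncomputable def update {p : Params} (st : State p) (ms : Multiset (Msg p)) : Phase → State p
  | .prio => { st with best := st.best ⊔ (ms.map Msg.getPrio).sup }
  | .deactivate =>
      if Msg.deactivate ∈ ms then { st with flag := true, active := false } else st
  | .tree j =>
      -- the first tree messages received fix the depth; the parent is the sender of lowest ID
      let senders : Finset (Fin p.U) := (ms.filterMap Msg.getTree).toFinset
      if h : st.depth = none ∧ senders.Nonempty then
        { st with depth := some (j + 1), parent := some (senders.min' h.2) }
      else st
  | .up j =>
      -- the children, of depth `δ + 1`, have sent their pieces with number `j + (δ + 1) - D`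
      match st.depth with
      | some δ =>
          { st with acc := st.acc + (ms.map (Msg.getVec (j + (δ + 1) - p.D) st.uid)).sum }
      | none => st
  | .down j =>
      -- the parent, of depth `δ - 1`, has sent its piece with number `j - (δ - 1)`
      let x : Vec p :=
        match st.depth, st.parent with
        | some δ, some u => st.sum + (ms.map (Msg.getVec (j + 1 - δ) u)).sum
        | _, _ => st.sum
      { st with
        sum := x
        known := if j + 1 = p.E ∧ st.depth.isSome then insert x st.known else st.known }
  | .pass j =>
      let inb : Fin p.U → Vec p := fun u => st.inbox u + (ms.map (Msg.getVec j u)).sum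
      let hd : Finset (Fin p.U) := st.heard ∪ (ms.filterMap Msg.getId).toFinset
      { st with
        inbox := inb
        heard := hd
        known := if j + 1 = p.S then st.known ∪ hd.image inb else st.known }
  | .idle => st

open Classical in
/-- Decoding by linear algebra: token `i` is read off a vector in the span of the received vectors
whose coefficient vector is the `i`-th basis vector. -/
noncomputable def decode {p : Params} (st : State p) : TokenTable p.k p.k := fun i =>
  if h : ∃ y : Token p.k, codeword i y ∈ Submodule.span (ZMod 2) (st.known : Set (Vec p)) then
    some h.choose
  else none

end PatchSharing

/-- The patch-sharing network coding algorithm. Every block of `T` rounds is a meta round, in which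
the nodes compute patches, then share, pass, and share again. -/
noncomputable def patchSharing (p : PatchSharing.Params) :
    Protocol (Fin p.U) (TokenTable p.k p.k) (TokenTable p.k p.k) where
  Msg := PatchSharing.Msg p
  State := PatchSharing.State p
  Seed := PatchSharing.Seed p
  seedFintype := inferInstance
  seedNonempty := ⟨(⟨0, Nat.pow_pos Nat.two_pos⟩, 0)⟩
  init := PatchSharing.init p
  send t st r :=
    PatchSharing.message (PatchSharing.prepare p (t % p.T) r st) (PatchSharing.phase p (t % p.T))
  recv t st r ms :=
    PatchSharing.update (PatchSharing.prepare p (t % p.T) r st) ms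
      (PatchSharing.phase p (t % p.T))
  out := PatchSharing.decode

open scoped BigOperators

/-! ### Expectations along the rounds of a protocol -/

/-! Two things must hold at the end: every received vector is a true combination of the codewords
(`codeSpace`), and every node has enough of them. By duality (`decode_eq`), enough means that for
each nonzero μ in 𝔽₂^k the node has received a vector whose coefficients pair to 1 with μ; it then
senses μ. For a single μ, sensing spreads like a rumour, and the failure probability only has to
beat a union bound over 2^k functionals.

Fix μ. A random sum over a set of nodes, one of which senses μ, lies outside the kernel with
probability 1/2 (`expect_randomSum_eq_zero`). Let x be the number of nodes that do not sense μ and d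
= ⌊D/2⌋ + 1. The potential is x·2^⌊x/d⌋ (`weight`). Suppose that D > 0 and every node is in a patch.
If every patch contains a sensing node, the second share step reaches each ignorant node with
probability 1/2, so the factor x halves in expectation. Otherwise connectivity yields an edge from a
patch with a sensing node to a patch without one. With probability 1/4 the sequence share, pass,
share carries a witness across this edge, and the whole second patch learns μ at once. It has at
least d nodes (`card_patch_ge`), so the exponent drops by at least one and the potential at least
halves. In both cases the expected potential shrinks by a factor 7/8 (`expect_weight_le`). If D = 0,
then d = 1 and a single boundary edge gives 3/4.

Every node is in a patch as soon as Luby's algorithm has deactivated all nodes. The expected number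
of pairs of active nodes within distance D shrinks by 3/4 per iteration
(`expect_conflicts_luby_le`), so this fails with probability at most 1/2. A failure costs nothing,
because knowledge never shrinks. Hence each meta round contracts the expected potential by 15/16
(`blockE_weight_le`).

Adaptivity does no harm: the contraction holds conditionally on every history and for every
connected graph, and stability freezes the graph during a meta round. The initial potential is at
most n·2^⌊n/d⌋, so about 16(k + n/d + (c+1) log₂ n) meta rounds push it below 2^(-k) n^(-c). Since T
= O(d log n) and k = bT, this amounts to O((n + bT²) log n) rounds.

The rest of the work is to compute what the message passing of each phase does to the states, so
that a meta round becomes an explicit random map on the received vectors (`blockE_of_treeStart`,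
`blockE_of_D_eq_zero`). -/

theorem PMF.tsum_bind_mul {α β : Type} (q : PMF α) (g : α → PMF β) (F : β → ENNReal) :
    ∑' b, q.bind g b * F b = ∑' a, q a * ∑' b, g a b * F b := by
  simp_rw [PMF.bind_apply, ← ENNReal.tsum_mul_right, ← ENNReal.tsum_mul_left]
  rw [ENNReal.tsum_comm]
  simp_rw [mul_assoc]

theorem PMF.tsum_pure_mul {α : Type} (a : α) (F : α → ENNReal) :
    ∑' b, PMF.pure a b * F b = F a := by
  rw [tsum_eq_single a]
  · simp
  · intro b hb
    simp [PMF.pure_apply, hb]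

theorem PMF.tsum_uniform_map_mul {α β : Type} [Fintype α] [Nonempty α] (f : α → β) (F : β → ℝ)
    (hF : ∀ b, 0 ≤ F b) :
    ∑' b, (PMF.uniformOfFintype α).map f b * ENNReal.ofReal (F b)
      = ENNReal.ofReal (𝔼 a, F (f a)) := by
  have hc : (0 : ℝ) < Fintype.card α := by exact_mod_cast Fintype.card_pos
  rw [PMF.map, PMF.tsum_bind_mul]
  simp only [Function.comp_apply, PMF.tsum_pure_mul, PMF.uniformOfFintype_apply]
  rw [tsum_fintype, ← Finset.mul_sum, ← ENNReal.ofReal_sum_of_nonneg fun a _ => hF _,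
    Fintype.expect_eq_sum_div_card, div_eq_inv_mul, ENNReal.ofReal_mul (by positivity),
    ENNReal.ofReal_inv_of_pos hc, ENNReal.ofReal_natCast]

namespace Protocol

variable {Uid Inp Out : Type}

attribute [instance] Protocol.seedFintype Protocol.seedNonempty

/-- The conditional expectation of `F` one round ahead. -/
noncomputable def stepE (P : Protocol Uid Inp Out) {n : ℕ} (F : P.History n → ℝ)
    (h : P.History n) : ℝ :=
  𝔼 s : Fin n → P.Seed, F (s :: h)

variable (P : Protocol Uid Inp Out) {n : ℕ}

theorem stepE_mono {F G : P.History n → ℝ} (h : ∀ x, F x ≤ G x) (x : P.History n) :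
    P.stepE F x ≤ P.stepE G x :=
  Finset.expect_le_expect fun _ _ => h _

theorem iterate_stepE_mono {F G : P.History n → ℝ} (h : ∀ x, F x ≤ G x) (R : ℕ)
    (x : P.History n) : P.stepE^[R] F x ≤ P.stepE^[R] G x := by
  induction R generalizing F G with
  | zero => exact h x
  | succ R ih => exact ih (P.stepE_mono h)

theorem iterate_stepE_nonneg {F : P.History n → ℝ} (h : ∀ x, 0 ≤ F x) (R : ℕ)
    (x : P.History n) : 0 ≤ P.stepE^[R] F x := by
  induction R generalizing F with
  | zero => exact h x
  | succ R ih => exact ih fun _ => Finset.expect_nonneg fun _ _ => h _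

theorem iterate_stepE_sum {ι : Type} (t : Finset ι) (F : ι → P.History n → ℝ) (R : ℕ)
    (x : P.History n) :
    P.stepE^[R] (fun y => ∑ i ∈ t, F i y) x = ∑ i ∈ t, P.stepE^[R] (F i) x := by
  induction R generalizing F with
  | zero => rfl
  | succ R ih =>
    simp only [Function.iterate_succ_apply]
    rw [← ih]
    refine congrArg (fun f => P.stepE^[R] f x) (funext fun y => ?_)
    exact Finset.expect_sum_comm _ _ _

theorem iterate_stepE_mul_left (a : ℝ) (F : P.History n → ℝ) (R : ℕ) (x : P.History n) :
    P.stepE^[R] (fun y => a * F y) x = a * P.stepE^[R] F x := by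
  induction R generalizing F with
  | zero => rfl
  | succ R ih =>
    simp only [Function.iterate_succ_apply]
    rw [← ih]
    refine congrArg (fun f => P.stepE^[R] f x) (funext fun y => ?_)
    exact (Finset.mul_expect _ _ _).symm

theorem iterate_stepE_const (a : ℝ) (R : ℕ) (x : P.History n) :
    P.stepE^[R] (fun _ => a) x = a := by
  induction R with
  | zero => rfl
  | succ R ih =>
    rw [Function.iterate_succ_apply]
    rw [show P.stepE (fun _ : P.History n => a) = fun _ => a from
      funext fun _ => Fintype.expect_const a]
    exact ih

theorem iterate_stepE_add (F G : P.History n → ℝ) (R : ℕ) (x : P.History n) :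
    P.stepE^[R] (fun y => F y + G y) x = P.stepE^[R] F x + P.stepE^[R] G x := by
  have := P.iterate_stepE_sum (Finset.univ : Finset Bool) (fun i => cond i F G) R x
  simpa using this

/-- A function that never increases does not increase in expectation. -/
theorem iterate_stepE_le_self {F : P.History n → ℝ} (h : ∀ s x, F (s :: x) ≤ F x) (R : ℕ)
    (x : P.History n) : P.stepE^[R] F x ≤ F x := by
  induction R with
  | zero => exact le_rfl
  | succ R ih =>
    rw [Function.iterate_succ_apply]
    exact (P.iterate_stepE_mono
      (fun y => Finset.expect_le Finset.univ_nonempty fun s _ => h s y) R x).trans ih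

theorem le_iterate_stepE_self {F : P.History n → ℝ} (h : ∀ s x, F x ≤ F (s :: x)) (R : ℕ)
    (x : P.History n) : F x ≤ P.stepE^[R] F x := by
  induction R with
  | zero => exact le_rfl
  | succ R ih =>
    rw [Function.iterate_succ_apply]
    exact ih.trans (P.iterate_stepE_mono
      (fun y => Finset.le_expect Finset.univ_nonempty fun s _ => h s y) R x)

/-- The law of a history adds its latest round last, so peeling off that round turns the infinite
sum into one more finite average. From here on all probabilities are iterated finite averages of
real functions. -/
theorem tsum_historyLaw_mul (R : ℕ) (F : P.History n → ℝ) (hF : ∀ h, 0 ≤ F h) :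
    ∑' h, P.historyLaw n R h * ENNReal.ofReal (F h) = ENNReal.ofReal (P.stepE^[R] F []) := by
  induction R generalizing F with
  | zero => exact PMF.tsum_pure_mul _ _
  | succ R ih =>
    rw [Function.iterate_succ_apply, ← ih (P.stepE F) fun h => Finset.expect_nonneg fun _ _ => hF _]
    rw [historyLaw, PMF.tsum_bind_mul]
    congr 1
    funext h
    congr 1
    convert PMF.tsum_uniform_map_mul (fun s : Fin n → P.Seed => s :: h) F hF using 1
    simp only [stepE]

open Classical in
theorem outputProb_eq (uid : Fin n → Uid) (inp : Fin n → Inp) (adv : P.Adversary n) (R : ℕ)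
    (E : (Fin n → Out) → Prop) :
    P.outputProb uid inp adv R E
      = P.stepE^[R] (fun h => if E fun v => P.out (P.run uid inp adv h v) then 1 else 0) [] := by
  have h0 : ∀ h : P.History n,
      (0 : ℝ) ≤ if E fun v => P.out (P.run uid inp adv h v) then 1 else 0 := by
    intro h; split_ifs <;> norm_num
  rw [outputProb, PMF.toOuterMeasure_apply]
  have := P.tsum_historyLaw_mul R _ h0
  rw [← ENNReal.toReal_ofReal (P.iterate_stepE_nonneg h0 R []), ← this]
  congr 2
  funext h
  by_cases hE : E fun v => P.out (P.run uid inp adv h v) <;> simp [Set.indicator, hE]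

end Protocol

/-! ### The dynamics of a meta round -/

namespace PatchSharing

variable {p : Params} {n : ℕ}

/-- The local computations of all nodes at the beginning of round `s` of a meta round. -/
def prep (s : ℕ) (r : Fin n → Seed p) (σ : Fin n → State p) : Fin n → State p :=
  fun v => prepare p s (r v) (σ v)

open Classical in
/-- The effect of one round of communication on all (prepared) nodes. -/
noncomputable def comm (G : SimpleGraph (Fin n)) (ph : Phase) (σ : Fin n → State p) :
    Fin n → State p :=
  fun v => update (σ v) ((Finset.univ.filter fun u => G.Adj v u).val.map
    fun u => message (σ u) ph) ph

/-- The effect of `j` rounds of communication without local computations in between. -/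
noncomputable def commSeq (G : SimpleGraph (Fin n)) (ph : ℕ → Phase) (σ : Fin n → State p) :
    ℕ → Fin n → State p
  | 0 => σ
  | j + 1 => comm G (ph j) (commSeq G ph σ j)

theorem commSeq_succ' (G : SimpleGraph (Fin n)) (ph : ℕ → Phase) (σ : Fin n → State p) (j : ℕ) :
    commSeq G ph σ (j + 1) = commSeq G (fun i => ph (i + 1)) (comm G (ph 0) σ) j := by
  induction j with
  | zero => rfl
  | succ j ih => rw [commSeq, ih, commSeq]

/-- The expectation of `F` after the rounds `s, …, s + j - 1` of a meta round with graph `G`. -/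
noncomputable def blockE (G : SimpleGraph (Fin n)) : ℕ → ℕ → ((Fin n → State p) → ℝ) →
    (Fin n → State p) → ℝ
  | _, 0, F, σ => F σ
  | s, j + 1, F, σ =>
      𝔼 r : Fin n → Seed p, blockE G (s + 1) j F (comm G (phase p s) (prep s r σ))

theorem blockE_add (G : SimpleGraph (Fin n)) (s i j : ℕ) (F : (Fin n → State p) → ℝ)
    (σ : Fin n → State p) :
    blockE G s (i + j) F σ = blockE G s i (blockE G (s + i) j F) σ := by
  induction i generalizing s σ with
  | zero => simp [blockE]
  | succ i ih =>
    rw [show i + 1 + j = i + j + 1 by ring, blockE, blockE]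
    refine Finset.expect_congr rfl fun r _ => ?_
    rw [ih, show s + 1 + i = s + (i + 1) by ring]

instance : Nonempty (Seed p) := ⟨(⟨0, Nat.pow_pos Nat.two_pos⟩, 0)⟩

/-- Seeds are read only by `prepare`. Where it does nothing, the average is over a constant and the
rounds are deterministic. -/
theorem blockE_quiet (G : SimpleGraph (Fin n)) (s j : ℕ) (ph : ℕ → Phase)
    (hph : ∀ i < j, phase p (s + i) = ph i)
    (hq : ∀ i < j, ∀ r (st : State p), prepare p (s + i) r st = st)
    (F : (Fin n → State p) → ℝ) (σ : Fin n → State p) :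
    blockE G s j F σ = F (commSeq G ph σ j) := by
  induction j generalizing s ph σ with
  | zero => rfl
  | succ j ih =>
    have h0 : ∀ r : Fin n → Seed p, prep s r σ = σ := fun r => funext fun v =>
      hq 0 (Nat.succ_pos _) (r v) (σ v)
    simp only [blockE, h0]
    rw [Fintype.expect_const, ih (s + 1) (fun i => ph (i + 1)), commSeq_succ',
      ← hph 0 (Nat.succ_pos _)]
    · rfl
    · intro i hi
      rw [← hph (i + 1) (by omega)]
      congr 1
      ring
    · intro i hi r st
      have := hq (i + 1) (by omega) r st
      rwa [show s + 1 + i = s + (i + 1) by ring]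

/-- A stage of a meta round in which local computations take place only at the beginning. -/
theorem blockE_stage (G : SimpleGraph (Fin n)) (s j : ℕ) (ph : ℕ → Phase) (hj : 0 < j)
    (hph : ∀ i < j, phase p (s + i) = ph i)
    (hq : ∀ i, 0 < i → i < j → ∀ r (st : State p), prepare p (s + i) r st = st)
    (F : (Fin n → State p) → ℝ) (σ : Fin n → State p) :
    blockE G s j F σ = 𝔼 r : Fin n → Seed p, F (commSeq G ph (prep s r σ) j) := by
  obtain ⟨j, rfl⟩ : ∃ i, j = i + 1 := ⟨j - 1, by omega⟩
  refine Finset.expect_congr rfl fun r _ => ?_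
  rw [blockE_quiet G (s + 1) j (fun i => ph (i + 1)), commSeq_succ', ← hph 0 (Nat.succ_pos _)]
  · rfl
  · intro i hi
    rw [← hph (i + 1) (by omega)]
    congr 1
    ring
  · intro i hi r st
    have := hq (i + 1) (by omega) (by omega) r st
    rwa [show s + 1 + i = s + (i + 1) by ring]

/-- A stage of a meta round that begins with a deterministic local computation. -/
theorem blockE_stage_det (G : SimpleGraph (Fin n)) (s j : ℕ) (ph : ℕ → Phase) (hj : 0 < j)
    (hph : ∀ i < j, phase p (s + i) = ph i)
    (hq : ∀ i, 0 < i → i < j → ∀ r (st : State p), prepare p (s + i) r st = st)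
    (f : State p → State p) (hf : ∀ r st, prepare p s r st = f st)
    (F : (Fin n → State p) → ℝ) (σ : Fin n → State p) :
    blockE G s j F σ = F (commSeq G ph (fun v => f (σ v)) j) := by
  rw [blockE_stage G s j ph hj hph hq]
  have h0 : ∀ r : Fin n → Seed p, prep s r σ = fun v => f (σ v) := fun r => funext fun v =>
    hf (r v) (σ v)
  simp only [h0]
  exact Fintype.expect_const _

/-- The states of all nodes after the rounds recorded in a history. -/
noncomputable def states (uid : Fin n → Fin p.U) (inp : Fin n → TokenTable p.k p.k)
    (adv : (patchSharing p).Adversary n) (h : (patchSharing p).History n) : Fin n → State p :=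
  (patchSharing p).run uid inp adv h

theorem states_cons (uid : Fin n → Fin p.U) (inp : Fin n → TokenTable p.k p.k)
    (adv : (patchSharing p).Adversary n) (s : Fin n → (patchSharing p).Seed)
    (h : (patchSharing p).History n) :
    states uid inp adv (s :: h)
      = comm (adv h) (phase p (h.length % p.T))
          (prep (h.length % p.T) s (states uid inp adv h)) :=
  rfl

/-- Stability enters here: until the end of the block the adversary must keep the graph it has at
history `h`, so it disappears from the conditional expectation, which depends on the current states
alone. -/
theorem iterate_stepE_eq_blockE (hT : 0 < p.T) (uid : Fin n → Fin p.U)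
    (inp : Fin n → TokenTable p.k p.k) (adv : (patchSharing p).Adversary n) (hadv : adv.Stable p.T)
    (F : (Fin n → State p) → ℝ) (j : ℕ) (h : (patchSharing p).History n)
    (hj : h.length % p.T + j ≤ p.T) :
    (patchSharing p).stepE^[j] (fun h => F (states uid inp adv h)) h
      = blockE (adv h) (h.length % p.T) j F (states uid inp adv h) := by
  induction j generalizing h with
  | zero => rfl
  | succ j ih =>
    rw [Function.iterate_succ_apply']
    refine Finset.expect_congr rfl fun s _ => ?_
    rw [← states_cons]
    rcases Nat.eq_zero_or_pos j with rfl | hj0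
    · rfl
    · have hlt : h.length % p.T + 1 < p.T := by omega
      have hm : (h.length + 1) % p.T = h.length % p.T + 1 := by
        rw [Nat.add_mod, Nat.mod_eq_of_lt (show 1 < p.T by omega), Nat.mod_eq_of_lt hlt]
      rw [ih (s :: h) (by rw [List.length_cons, hm]; omega), List.length_cons, hm, hadv h s]
      intro hd
      rw [Nat.dvd_iff_mod_eq_zero, hm] at hd
      omega

end PatchSharing

/-- One more round of flooding enlarges the ball by one layer; the inductions over flooding and tree
growth step with this. -/
theorem SimpleGraph.Connected.dist_le_succ_iff {V : Type} {G : SimpleGraph V} (hG : G.Connected)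
    (v w : V) (j : ℕ) : G.dist v w ≤ j + 1 ↔ G.dist v w ≤ j ∨ ∃ u, G.Adj v u ∧ G.dist u w ≤ j := by
  constructor
  · intro h
    obtain ⟨q, hq⟩ := hG.exists_walk_length_eq_dist v w
    cases q with
    | nil => left; simp
    | cons hadj q =>
      right
      refine ⟨_, hadj, (SimpleGraph.dist_le q).trans ?_⟩
      rw [SimpleGraph.Walk.length_cons] at hq
      omega
  · rintro (h | ⟨u, hu, h⟩)
    · omega
    · have h1 := hG.dist_triangle (u := v) (v := u) (w := w)
      rw [SimpleGraph.dist_eq_one_iff_adj.2 hu] at h1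
      omega

namespace PatchSharing

variable {p : Params} {n : ℕ}

/-! ### The independent set computation -/

open Classical in
theorem comm_prio (G : SimpleGraph (Fin n)) (σ : Fin n → State p) :
    comm G .prio σ = fun v => { σ v with
      best := (σ v).best ⊔ (Finset.univ.filter fun u => G.Adj v u).sup fun u => (σ u).best } := by
  funext v
  simp only [comm, update, message, Multiset.map_map]
  rfl

open Classical in
theorem comm_deactivate (G : SimpleGraph (Fin n)) (σ : Fin n → State p) :
    comm G .deactivate σ = fun v => if ∃ u, G.Adj v u ∧ (σ u).flag = true then
      { σ v with flag := true, active := false } else σ v := by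
  funext v
  have : (Msg.deactivate ∈ (Finset.univ.filter fun u => G.Adj v u).val.map
      fun u => message (σ u) .deactivate) ↔ ∃ u, G.Adj v u ∧ (σ u).flag = true := by
    simp only [Multiset.mem_map, Finset.mem_val, Finset.mem_filter, Finset.mem_univ, true_and,
      message]
    refine exists_congr fun u => and_congr_right fun _ => ?_
    cases (σ u).flag <;> simp
  simp only [comm, update, this]

open Classical in
theorem commSeq_prio {G : SimpleGraph (Fin n)} (hG : G.Connected) (σ : Fin n → State p) (j : ℕ) :
    commSeq G (fun _ => .prio) σ j = fun v => { σ v with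
      best := (Finset.univ.filter fun u => G.dist v u ≤ j).sup fun u => (σ u).best } := by
  induction j with
  | zero =>
    funext v
    have : (Finset.univ.filter fun u => G.dist v u ≤ 0) = {v} := by
      ext u
      simp [hG.dist_eq_zero_iff, eq_comm]
    simp only [commSeq, this, Finset.sup_singleton]
  | succ j ih =>
    rw [commSeq, ih, comm_prio]
    funext v
    suffices key : ((Finset.univ.filter fun u => G.dist v u ≤ j).sup fun u => (σ u).best) ⊔
        ((Finset.univ.filter fun u => G.Adj v u).sup fun u =>
          (Finset.univ.filter fun w => G.dist u w ≤ j).sup fun w => (σ w).best)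
        = (Finset.univ.filter fun u => G.dist v u ≤ j + 1).sup fun u => (σ u).best by
      simp only [key]
    apply le_antisymm
    · refine sup_le (Finset.sup_mono ?_) (Finset.sup_le fun u hu => Finset.sup_mono ?_)
      · intro w; simp only [Finset.mem_filter, Finset.mem_univ, true_and]; omega
      · intro w
        simp only [Finset.mem_filter, Finset.mem_univ, true_and] at hu ⊢
        exact fun hw => (hG.dist_le_succ_iff v w j).2 (Or.inr ⟨u, hu, hw⟩)
    · refine Finset.sup_le fun w hw => ?_
      simp only [Finset.mem_filter, Finset.mem_univ, true_and] at hw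
      rcases (hG.dist_le_succ_iff v w j).1 hw with h | ⟨u, hu, h⟩
      · exact le_sup_of_le_left (Finset.le_sup (f := fun u => (σ u).best) (by simpa using h))
      · refine le_sup_of_le_right (le_trans ?_ (Finset.le_sup
          (f := fun u => (Finset.univ.filter fun w => G.dist u w ≤ j).sup fun w => (σ w).best)
          (show u ∈ Finset.univ.filter fun u => G.Adj v u by simpa using hu)))
        exact Finset.le_sup (f := fun u => (σ u).best) (by simpa using h)

open Classical in
-- `hσ` makes the closed form for `active` correct at j = 0: a node that starts flagged must already
-- be inactive, as `decideLeader` ensures.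
theorem commSeq_deactivate {G : SimpleGraph (Fin n)} (hG : G.Connected) (σ : Fin n → State p)
    (hσ : ∀ v, (σ v).flag = true → (σ v).active = false) (j : ℕ) :
    commSeq G (fun _ => .deactivate) σ j = fun v => { σ v with
      flag := decide (∃ u, G.dist v u ≤ j ∧ (σ u).flag = true)
      active := (σ v).active && !decide (∃ u, G.dist v u ≤ j ∧ (σ u).flag = true) } := by
  induction j with
  | zero =>
    funext v
    have : (∃ u, G.dist v u ≤ 0 ∧ (σ u).flag = true) ↔ (σ v).flag = true := by
      simp [hG.dist_eq_zero_iff]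
    have h2 := hσ v
    simp only [commSeq, this]
    rcases hv : σ v with ⟨⟩
    simp only [hv] at h2
    simp
    intro h3
    by_contra h
    simp_all
  | succ j ih =>
    rw [commSeq, ih, comm_deactivate]
    funext v
    have key : (∃ w, G.dist v w ≤ j + 1 ∧ (σ w).flag = true) ↔
        (∃ w, G.dist v w ≤ j ∧ (σ w).flag = true) ∨
          ∃ u, G.Adj v u ∧ ∃ w, G.dist u w ≤ j ∧ (σ w).flag = true := by
      constructor
      · rintro ⟨w, hw, hf⟩
        rcases (hG.dist_le_succ_iff v w j).1 hw with h | ⟨u, hu, h⟩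
        · exact Or.inl ⟨w, h, hf⟩
        · exact Or.inr ⟨u, hu, w, h, hf⟩
      · rintro (⟨w, h, hf⟩ | ⟨u, hu, w, h, hf⟩)
        · exact ⟨w, by omega, hf⟩
        · exact ⟨w, (hG.dist_le_succ_iff v w j).2 (Or.inr ⟨u, hu, h⟩), hf⟩
    simp only [key, decide_eq_true_eq]
    split_ifs with h
    · simp [h]
    · simp [h]

/-- One iteration of the independent set computation. -/
noncomputable def luby (G : SimpleGraph (Fin n)) (σ : Fin n → State p) (r : Fin n → Seed p) :
    Fin n → State p :=
  commSeq G (fun _ => .deactivate) (fun v =>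
    (commSeq G (fun _ => .prio) (fun v => (σ v).draw (r v).1) p.D v).decideLeader) p.D

/-- The priority that a node draws. -/
def drawn (σ : Fin n → State p) (r : Fin n → Seed p) (v : Fin n) : Prio p :=
  if (σ v).active then ((toLex ((r v).1, (σ v).uid) : Fin p.prioRange ×ₗ Fin p.U) : Prio p) else ⊥

/-- A node becomes a leader if it is active and its priority is the highest within distance `D`. -/
def NewLeader (G : SimpleGraph (Fin n)) (σ : Fin n → State p) (r : Fin n → Seed p)
    (v : Fin n) : Prop :=
  (σ v).active = true ∧ ∀ u, G.dist v u ≤ p.D → drawn σ r u ≤ drawn σ r v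

open Classical in
-- Only `leader` and `active` matter afterwards, so the scratch fields are left existential.
theorem luby_spec {G : SimpleGraph (Fin n)} (hG : G.Connected) (σ : Fin n → State p)
    (r : Fin n → Seed p) :
    ∃ (m b : Fin n → Prio p) (f : Fin n → Bool), luby G σ r = fun v => { σ v with
      mine := m v
      best := b v
      flag := f v
      leader := (σ v).leader || decide (NewLeader G σ r v)
      active := (σ v).active && !decide (∃ u, G.dist v u ≤ p.D ∧ NewLeader G σ r u) } := by
  -- A node lies in its own ball, so the flooded maximum equals its own priority exactly when
  -- nothing in the ball exceeds it.
  have h1 : ∀ v, (Finset.univ.filter fun u => G.dist v u ≤ p.D).sup (drawn σ r) = drawn σ r v ↔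
      ∀ u, G.dist v u ≤ p.D → drawn σ r u ≤ drawn σ r v := by
    intro v
    constructor
    · intro h u hu
      rw [← h]
      exact Finset.le_sup (by simpa using hu)
    · intro h
      refine le_antisymm (Finset.sup_le fun u hu => h u (by simpa using hu)) ?_
      exact Finset.le_sup (by simp)
  have h2 : (fun v => (commSeq G (fun _ => .prio) (fun v => (σ v).draw (r v).1) p.D
      v).decideLeader) = fun v => { σ v with
        mine := drawn σ r v
        best := (Finset.univ.filter fun u => G.dist v u ≤ p.D).sup (drawn σ r)
        flag := decide (NewLeader G σ r v)
        leader := (σ v).leader || decide (NewLeader G σ r v)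
        active := (σ v).active && !decide (NewLeader G σ r v) } := by
    funext v
    rw [commSeq_prio hG]
    simp only [State.decideLeader, State.draw]
    change (if (σ v).active = true ∧
      (Finset.univ.filter fun u => G.dist v u ≤ p.D).sup (drawn σ r) = drawn σ r v then _ else _) = _
    by_cases h : NewLeader G σ r v
    · rw [if_pos ⟨h.1, (h1 v).2 h.2⟩]
      simp only [h, decide_true, Bool.or_true, Bool.not_true, Bool.and_false]
      rfl
    · rw [if_neg fun h' => h ⟨h'.1, (h1 v).1 h'.2⟩]
      simp only [h, decide_false, Bool.or_false, Bool.not_false, Bool.and_true]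
      rfl
  rw [luby, h2, commSeq_deactivate hG]
  · simp only [decide_eq_true_eq]
    refine ⟨drawn σ r, fun v => (Finset.univ.filter fun u => G.dist v u ≤ p.D).sup (drawn σ r),
      fun v => decide (∃ u, G.dist v u ≤ p.D ∧ NewLeader G σ r u), funext fun v => ?_⟩
    by_cases h : ∃ u, G.dist v u ≤ p.D ∧ NewLeader G σ r u
    · simp [h]
    · have : ¬ NewLeader G σ r v := fun hv => h ⟨v, by simp, hv⟩
      simp [h, this]
  · intro v h
    simp only [decide_eq_true_eq] at h
    simp [h]

end PatchSharing

namespace PatchSharing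

variable {p : Params} {n : ℕ}

/-! ### The trees of the patches -/

/-- What holds after `j` rounds of growing the trees. -/
structure TreeInv (G : SimpleGraph (Fin n)) (uid : Fin n → Fin p.U) (ldr : Fin n → Bool)
    (dep : Fin n → Option ℕ) (prt : Fin n → Option (Fin p.U)) (j : ℕ) : Prop where
  zero_iff : ∀ v, dep v = some 0 ↔ ldr v = true
  parent_root : ∀ v, dep v = some 0 → prt v = none
  succ : ∀ v δ, dep v = some (δ + 1) →
    ∃ u, G.Adj v u ∧ dep u = some δ ∧ prt v = some (uid u)
  le : ∀ v δ, dep v = some δ → δ ≤ j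
  cover : ∀ v x, ldr x = true → G.dist v x ≤ j → ∃ δ, dep v = some δ ∧ δ ≤ G.dist v x

theorem TreeInv.exists_leader {G : SimpleGraph (Fin n)} (hG : G.Connected)
    {uid : Fin n → Fin p.U} {ldr : Fin n → Bool} {dep : Fin n → Option ℕ}
    {prt : Fin n → Option (Fin p.U)} {j : ℕ} (h : TreeInv G uid ldr dep prt j) (δ : ℕ) (v : Fin n)
    (hv : dep v = some δ) : ∃ x, ldr x = true ∧ G.dist v x ≤ δ := by
  induction δ generalizing v with
  | zero => exact ⟨v, (h.zero_iff v).1 hv, by simp⟩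
  | succ δ ih =>
    obtain ⟨u, hu, hd, -⟩ := h.succ v δ hv
    obtain ⟨x, hx, hux⟩ := ih u hd
    exact ⟨x, hx, (hG.dist_le_succ_iff v x δ).2 (Or.inr ⟨u, hu, hux⟩)⟩

open Classical in
-- Of the choice of the parent only this is kept: it is an adjacent node that joined at depth j. The
-- tie-breaking by lowest identifier plays no further role.
theorem comm_tree (G : SimpleGraph (Fin n)) (σ : Fin n → State p) (j : ℕ) :
    ∃ (dep : Fin n → Option ℕ) (prt : Fin n → Option (Fin p.U)), comm G (.tree j) σ = (fun v => { σ v with depth := dep v, parent := prt v }) ∧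
      ∀ v, if (σ v).depth = none ∧ ∃ u, G.Adj v u ∧ (σ u).depth = some j then
        dep v = some (j + 1) ∧
          ∃ u, G.Adj v u ∧ (σ u).depth = some j ∧ prt v = some (σ u).uid
      else dep v = (σ v).depth ∧ prt v = (σ v).parent := by
  have hs : ∀ v x, x ∈ (((Finset.univ.filter fun u => G.Adj v u).val.map
      fun u => message (σ u) (.tree j)).filterMap Msg.getTree).toFinset ↔
      ∃ u, G.Adj v u ∧ (σ u).depth = some j ∧ (σ u).uid = x := by
    intro v x
    simp only [Multiset.mem_toFinset, Multiset.mem_filterMap, Multiset.mem_map, Finset.mem_val,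
      Finset.mem_filter, Finset.mem_univ, true_and, message]
    constructor
    · rintro ⟨m, ⟨u, hu, rfl⟩, hm⟩
      split_ifs at hm with h
      · exact ⟨u, hu, h, by simpa [Msg.getTree] using hm⟩
      · simp [Msg.getTree] at hm
    · rintro ⟨u, hu, h, rfl⟩
      exact ⟨_, ⟨u, hu, rfl⟩, by simp [h, Msg.getTree]⟩
  refine ⟨fun v => (comm G (.tree j) σ v).depth, fun v => (comm G (.tree j) σ v).parent, ?_, ?_⟩
  · funext v
    simp only [comm, update]
    split_ifs <;> rfl
  · intro v
    have hne : (((Finset.univ.filter fun u => G.Adj v u).val.map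
        fun u => message (σ u) (.tree j)).filterMap Msg.getTree).toFinset.Nonempty ↔
        ∃ u, G.Adj v u ∧ (σ u).depth = some j := by
      constructor
      · rintro ⟨x, hx⟩
        obtain ⟨u, h1, h2, -⟩ := (hs v x).1 hx
        exact ⟨u, h1, h2⟩
      · rintro ⟨u, h1, h2⟩
        exact ⟨_, (hs v _).2 ⟨u, h1, h2, rfl⟩⟩
    split_ifs with h
    · have h' := (and_congr_right fun _ => hne).2 h
      simp only [comm, update]
      rw [dif_pos h']
      refine ⟨rfl, ?_⟩
      obtain ⟨u, h1, h2, h3⟩ := (hs v _).1 (Finset.min'_mem _ h'.2)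
      exact ⟨u, h1, h2, congrArg some h3.symm⟩
    · have h' := mt (and_congr_right fun _ => hne).1 h
      simp only [comm, update]
      rw [dif_neg h']
      exact ⟨rfl, rfl⟩

theorem commSeq_tree {G : SimpleGraph (Fin n)} (hG : G.Connected) (σ : Fin n → State p) (j : ℕ) :
    ∃ (dep : Fin n → Option ℕ) (prt : Fin n → Option (Fin p.U)), commSeq G .tree (fun v => (σ v).plant) j
        = (fun v => { σ v with depth := dep v, parent := prt v }) ∧
      TreeInv G (fun v => (σ v).uid) (fun v => (σ v).leader) dep prt j := by
  induction j with
  | zero =>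
    refine ⟨fun v => if (σ v).leader then some 0 else none, fun _ => none, rfl, ?_⟩
    constructor
    · intro v; simp
    · intro v _; rfl
    · intro v δ h
      split_ifs at h
      simp at h
    · intro v δ h
      split_ifs at h
      simp at h
      omega
    · intro v x hx hd
      have : v = x := hG.dist_eq_zero_iff.1 (Nat.le_zero.1 hd)
      subst this
      exact ⟨0, by simp [hx], Nat.zero_le _⟩
  | succ j ih =>
    obtain ⟨dep, prt, heq, hI⟩ := ih
    rw [commSeq, heq]
    obtain ⟨dep', prt', heq', h⟩ := comm_tree G
      (fun v => { σ v with depth := dep v, parent := prt v }) j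
    refine ⟨dep', prt', heq', ?_⟩
    simp only at h
    have hold : ∀ v δ, dep v = some δ → dep' v = some δ ∧ prt' v = prt v := by
      intro v δ hv
      have := h v
      rw [if_neg (by simp [hv])] at this
      exact ⟨this.1.trans hv, this.2⟩
    have hcase : ∀ v δ, dep' v = some δ → dep v = some δ ∨
        (δ = j + 1 ∧ ∃ u, G.Adj v u ∧ dep u = some j ∧ prt' v = some (σ u).uid) := by
      intro v δ hv
      have := h v
      split_ifs at this with hc
      · rw [hv] at this
        exact Or.inr ⟨Option.some.inj this.1, this.2⟩
      · exact Or.inl (this.1 ▸ hv)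
    constructor
    · intro v
      rw [← hI.zero_iff v]
      refine ⟨fun hv => ?_, fun hv => (hold v 0 hv).1⟩
      rcases hcase v 0 hv with h0 | ⟨h0, -⟩
      · exact h0
      · omega
    · intro v hv
      rcases hcase v 0 hv with h0 | ⟨h0, -⟩
      · exact (hold v 0 h0).2.trans (hI.parent_root v h0)
      · omega
    · intro v δ hv
      rcases hcase v _ hv with h0 | ⟨h0, u, hu, hd, hp⟩
      · obtain ⟨u, hu, hd, hp⟩ := hI.succ v δ h0
        exact ⟨u, hu, (hold u δ hd).1, (hold v _ h0).2.trans hp⟩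
      · have : δ = j := by omega
        subst this
        exact ⟨u, hu, (hold u _ hd).1, hp⟩
    · intro v δ hv
      rcases hcase v _ hv with h0 | ⟨h0, -⟩
      · have := hI.le v δ h0
        omega
      · omega
    · intro v x hx hd
      rcases Nat.lt_or_ge j (G.dist v x) with hlt | hle
      · rcases hv : dep v with _ | δ
        · obtain hd' | ⟨u, hu, hux⟩ := (hG.dist_le_succ_iff v x j).1 hd
          · omega
          · obtain ⟨δ, hδ, hle⟩ := hI.cover u x hx hux
            -- If the neighbour `u` had joined before depth j, its leader would be within distance j
            -- of `v`, and `v` would already have a depth. So `u` joined at depth exactly j and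
            -- announces itself in this very round.
            have hjδ : δ = j := by
              by_contra hne
              obtain ⟨y, hy, huy⟩ := hI.exists_leader hG δ u hδ
              have hvy : G.dist v y ≤ j :=
                ((hG.dist_le_succ_iff v y δ).2 (Or.inr ⟨u, hu, huy⟩)).trans (by omega)
              obtain ⟨δ', h', -⟩ := hI.cover v y hy hvy
              rw [hv] at h'
              simp at h'
            subst hjδ
            have := h v
            rw [if_pos ⟨hv, u, hu, hδ⟩] at this
            exact ⟨_, this.1, by omega⟩
        · exact ⟨δ, (hold v δ hv).1, by have := hI.le v δ hv; omega⟩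
      · obtain ⟨δ, hδ, hl⟩ := hI.cover v x hx hle
        exact ⟨δ, (hold v δ hδ).1, hl⟩

/-- The tree structure that the transmissions of a meta round use. -/
structure Forest (D : ℕ) (G : SimpleGraph (Fin n)) (uid : Fin n → Fin p.U) (ldr : Fin n → Bool)
    (dep : Fin n → Option ℕ) (prt : Fin n → Option (Fin p.U)) (par : Fin n → Fin n) : Prop where
  uid_inj : Function.Injective uid
  zero_iff : ∀ v, dep v = some 0 ↔ ldr v = true
  parent_root : ∀ v, dep v = some 0 → prt v = none
  succ : ∀ v δ, dep v = some (δ + 1) →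
    G.Adj v (par v) ∧ dep (par v) = some δ ∧ prt v = some (uid (par v))
  le : ∀ v δ, dep v = some δ → δ ≤ D

/-- States store the parent's identifier. Choosing the node behind it gives a function `par` that
can be iterated to the root and summed over. -/
theorem TreeInv.exists_forest {G : SimpleGraph (Fin n)} {uid : Fin n → Fin p.U}
    {ldr : Fin n → Bool} {dep : Fin n → Option ℕ} {prt : Fin n → Option (Fin p.U)} {D : ℕ}
    (h : TreeInv G uid ldr dep prt D) (huid : Function.Injective uid) :
    ∃ par, Forest D G uid ldr dep prt par := by
  have : ∀ v, ∃ u, ∀ δ, dep v = some (δ + 1) →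
      G.Adj v u ∧ dep u = some δ ∧ prt v = some (uid u) := by
    intro v
    by_cases hv : ∃ δ, dep v = some (δ + 1)
    · obtain ⟨δ, hδ⟩ := hv
      obtain ⟨u, hu⟩ := h.succ v δ hδ
      refine ⟨u, fun δ' h' => ?_⟩
      rw [hδ] at h'
      simp only [Option.some.injEq, Nat.add_right_cancel_iff] at h'
      exact h' ▸ hu
    · exact ⟨v, fun δ hδ => (hv ⟨δ, hδ⟩).elim⟩
  choose par hpar using this
  exact ⟨par, huid, h.zero_iff, h.parent_root, hpar, h.le⟩

/-- The root of the tree of a node. -/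
def root (dep : Fin n → Option ℕ) (par : Fin n → Fin n) (v : Fin n) : Fin n :=
  par^[(dep v).getD 0] v

theorem root_zero {dep : Fin n → Option ℕ} {par : Fin n → Fin n} {v : Fin n}
    (h : dep v = some 0) : root dep par v = v := by
  simp [root, h]

theorem Forest.root_succ {D : ℕ} {G : SimpleGraph (Fin n)} {uid : Fin n → Fin p.U}
    {ldr : Fin n → Bool} {dep : Fin n → Option ℕ} {prt : Fin n → Option (Fin p.U)}
    {par : Fin n → Fin n} (hF : Forest D G uid ldr dep prt par) {v : Fin n} {δ : ℕ}
    (h : dep v = some (δ + 1)) : root dep par v = root dep par (par v) := by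
  simp [root, h, (hF.succ v δ h).2.1]

theorem Forest.root_spec {D : ℕ} {G : SimpleGraph (Fin n)} (hG : G.Connected)
    {uid : Fin n → Fin p.U}
    {ldr : Fin n → Bool} {dep : Fin n → Option ℕ} {prt : Fin n → Option (Fin p.U)}
    {par : Fin n → Fin n} (hF : Forest D G uid ldr dep prt par) (δ : ℕ) (v : Fin n)
    (h : dep v = some δ) :
    dep (root dep par v) = some 0 ∧ G.dist v (root dep par v) ≤ δ := by
  induction δ generalizing v with
  | zero => rw [root_zero h]; exact ⟨h, by simp⟩
  | succ δ ih =>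
    have h1 := hF.succ v δ h
    rw [hF.root_succ h]
    obtain ⟨h2, h3⟩ := ih _ h1.2.1
    exact ⟨h2, (hG.dist_le_succ_iff _ _ _).2 (Or.inr ⟨_, h1.1, h3⟩)⟩

/-- The set of nodes of the tree with root `x`. -/
def patch (dep : Fin n → Option ℕ) (par : Fin n → Fin n) (x : Fin n) : Finset (Fin n) :=
  Finset.univ.filter fun u => (dep u).isSome ∧ root dep par u = x

/-- The children of a node. -/
def children (dep : Fin n → Option ℕ) (par : Fin n → Fin n) (v : Fin n) : Finset (Fin n) :=
  Finset.univ.filter fun u => 0 < (dep u).getD 0 ∧ par u = v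

theorem Forest.dep_of_mem_children {D : ℕ} {G : SimpleGraph (Fin n)} {uid : Fin n → Fin p.U}
    {ldr : Fin n → Bool} {dep : Fin n → Option ℕ} {prt : Fin n → Option (Fin p.U)}
    {par : Fin n → Fin n} (hF : Forest D G uid ldr dep prt par) {u v : Fin n}
    (h : u ∈ children dep par v) :
    ∃ δ, dep v = some δ ∧ dep u = some (δ + 1) ∧ par u = v ∧ G.Adj u v ∧
      prt u = some (uid v) := by
  simp only [children, Finset.mem_filter, Finset.mem_univ, true_and] at h
  obtain ⟨h1, rfl⟩ := h
  rcases hu : dep u with _ | _ | δ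
  · simp [hu] at h1
  · simp [hu] at h1
  · obtain ⟨h2, h3, h4⟩ := hF.succ u δ hu
    exact ⟨δ, h3, rfl, rfl, h2, h4⟩

/-- The sum over the first `m` generations of the descendants. -/
def generationSum (dep : Fin n → Option ℕ) (par : Fin n → Fin n) (c : Fin n → Vec p) :
    ℕ → Fin n → Vec p
  | 0, v => c v
  | m + 1, v => c v + ∑ u ∈ children dep par v, generationSum dep par c m u

/-- The sum over all descendants, in a forest of height at most `D`. -/
def subtreeSum (D : ℕ) (dep : Fin n → Option ℕ) (par : Fin n → Fin n) (c : Fin n → Vec p)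
    (v : Fin n) : Vec p :=
  generationSum dep par c (D - (dep v).getD 0) v

/-- The truncation of the generations at D − depth loses nothing, as a node of depth D has no
children. -/
theorem Forest.subtreeSum_eq {D : ℕ} {G : SimpleGraph (Fin n)} {uid : Fin n → Fin p.U}
    {ldr : Fin n → Bool} {dep : Fin n → Option ℕ} {prt : Fin n → Option (Fin p.U)}
    {par : Fin n → Fin n} (hF : Forest D G uid ldr dep prt par) (c : Fin n → Vec p)
    {v : Fin n} {δ : ℕ} (hv : dep v = some δ) :
    subtreeSum D dep par c v
      = c v + ∑ u ∈ children dep par v, subtreeSum D dep par c u := by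
  rcases (hF.le v δ hv).lt_or_eq with hlt | rfl
  · rw [subtreeSum, hv, Option.getD_some, show D - δ = D - (δ + 1) + 1 by omega, generationSum]
    congr 1
    refine Finset.sum_congr rfl fun u hu => ?_
    obtain ⟨δ', h1, h2, -⟩ := hF.dep_of_mem_children hu
    obtain rfl : δ = δ' := by simpa [hv] using h1
    rw [subtreeSum, h2, Option.getD_some]
  · have : children dep par v = ∅ := by
      refine Finset.eq_empty_of_forall_notMem fun u hu => ?_
      obtain ⟨δ', h1, h2, -⟩ := hF.dep_of_mem_children hu
      obtain rfl : δ = δ' := by simpa [hv] using h1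
      have := hF.le u _ h2
      omega
    rw [this, Finset.sum_empty, subtreeSum, hv, Option.getD_some, Nat.sub_self, generationSum,
      add_zero]

theorem Forest.subtreeSum_root {D : ℕ} {G : SimpleGraph (Fin n)} {uid : Fin n → Fin p.U}
    {ldr : Fin n → Bool} {dep : Fin n → Option ℕ} {prt : Fin n → Option (Fin p.U)}
    {par : Fin n → Fin n} (hF : Forest D G uid ldr dep prt par) (c : Fin n → Vec p)
    {x : Fin n} (hx : dep x = some 0) :
    subtreeSum D dep par c x = ∑ u ∈ patch dep par x, c u := by
  -- A front moving down the tree: nodes above depth m contribute their own value, nodes at depth m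
  -- their whole subtree. At m = 0 the front is the root alone; at m = D + 1 it is empty.
  have key : ∀ m, subtreeSum D dep par c x
      = ∑ u ∈ (patch dep par x).filter (fun u => (dep u).getD 0 < m), c u
        + ∑ u ∈ (patch dep par x).filter (fun u => (dep u).getD 0 = m),
            subtreeSum D dep par c u := by
    intro m
    induction m with
    | zero =>
      have : (patch dep par x).filter (fun u => (dep u).getD 0 = 0) = {x} := by
        ext u
        simp only [patch, Finset.mem_filter, Finset.mem_univ, true_and, Finset.mem_singleton]
        constructor
        · rintro ⟨⟨h1, h2⟩, h3⟩
          rw [root, h3] at h2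
          exact h2
        · rintro rfl
          exact ⟨⟨by simp [hx], root_zero hx⟩, by simp [hx]⟩
      simp [this]
    | succ m ih =>
      rw [ih]
      have h1 : ∑ u ∈ (patch dep par x).filter (fun u => (dep u).getD 0 = m),
            subtreeSum D dep par c u
          = ∑ u ∈ (patch dep par x).filter (fun u => (dep u).getD 0 = m), c u
            + ∑ u ∈ (patch dep par x).filter (fun u => (dep u).getD 0 = m),
              ∑ w ∈ children dep par u, subtreeSum D dep par c w := by
        rw [← Finset.sum_add_distrib]
        refine Finset.sum_congr rfl fun u hu => ?_
        simp only [patch, Finset.mem_filter, Finset.mem_univ, true_and] at hu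
        obtain ⟨δ, hδ⟩ := Option.isSome_iff_exists.1 hu.1.1
        exact hF.subtreeSum_eq c hδ
      have h2 : ∑ u ∈ (patch dep par x).filter (fun u => (dep u).getD 0 = m),
              ∑ w ∈ children dep par u, subtreeSum D dep par c w
          = ∑ w ∈ (patch dep par x).filter (fun u => (dep u).getD 0 = m + 1),
              ∑ _u ∈ {par w}, subtreeSum D dep par c w := by
        refine Finset.sum_comm' fun u w => ?_
        constructor
        · rintro ⟨hu, hw⟩
          obtain ⟨δ, h3, h4, h5, -⟩ := hF.dep_of_mem_children hw
          simp only [patch, Finset.mem_filter, Finset.mem_univ, true_and,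
            Finset.mem_singleton] at hu ⊢
          rw [h3, Option.getD_some] at hu
          rw [hF.root_succ h4, h5, h4, hu.1.2, hu.2]
          simp
        · simp only [patch, children, Finset.mem_filter, Finset.mem_univ, true_and,
            Finset.mem_singleton]
          rintro ⟨rfl, ⟨h3, h4⟩, h5⟩
          obtain ⟨δ, hδ⟩ := Option.isSome_iff_exists.1 h3
          rw [hδ, Option.getD_some] at h5
          subst h5
          rw [hF.root_succ hδ] at h4
          rw [(hF.succ w m hδ).2.1, hδ, h4]
          simp
      have h3 : (patch dep par x).filter (fun u => (dep u).getD 0 < m + 1)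
          = (patch dep par x).filter (fun u => (dep u).getD 0 < m) ∪
            (patch dep par x).filter (fun u => (dep u).getD 0 = m) := by
        rw [← Finset.filter_or]
        refine Finset.filter_congr fun u _ => ?_
        omega
      rw [h1, h2, h3, Finset.sum_union, add_assoc]
      · simp only [Finset.sum_singleton]
      · rw [Finset.disjoint_filter]
        intro u _ h4 h5
        omega
  rw [key (D + 1)]
  have hle : ∀ u, (dep u).getD 0 < D + 1 := by
    intro u
    rcases hu : dep u with _ | δ
    · simp
    · have := hF.le u δ hu
      simpa using Nat.lt_succ_of_le this
  rw [Finset.filter_true_of_mem fun u _ => hle u, Finset.filter_false_of_mem fun u _ => (hle u).ne]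
  simp

end PatchSharing

namespace PatchSharing

variable {p : Params} {n : ℕ}

/-! ### Pipelined transmissions -/

theorem Params.w_pos (p : Params) : 0 < p.w := Nat.succ_pos _

theorem unpiece_piece (i : ℕ) (x : Vec p) (q : Fin (p.k + p.k)) :
    unpiece i (piece i x) q = if (q : ℕ) / p.w = i then x q else 0 := by
  rw [unpiece]
  split_ifs with h
  · have h1 : i * p.w + (q : ℕ) % p.w = q := by
      rw [← h, mul_comm]; exact Nat.div_add_mod _ _
    simp only [piece, h1, q.2, dif_pos]
  · rfl

/-- The `+ 1` in the length of a piece makes S pieces cover all 2k coordinates. -/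
theorem div_w_lt (hS : 0 < p.S) (q : Fin (p.k + p.k)) : (q : ℕ) / p.w < p.S := by
  rw [Nat.div_lt_iff_lt_mul p.w_pos]
  refine q.2.trans ?_
  have := Nat.lt_mul_div_succ (2 * p.k) hS
  rw [← two_mul]
  exact this

open Classical in
-- The address in a message singles out the children: a neighbour that is not a child is silent or
-- names another node, since identifiers are distinct.
theorem comm_up (G : SimpleGraph (Fin n)) (σ : Fin n → State p) (par : Fin n → Fin n)
    (hF : Forest p.D G (fun v => (σ v).uid) (fun v => (σ v).leader) (fun v => (σ v).depth)
      (fun v => (σ v).parent) par) (hS : 0 < p.S) (j : ℕ) :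
    comm G (.up j) σ = fun v => { σ v with
      acc := fun q => if (σ v).depth.isSome ∧ (q : ℕ) / p.w + p.D = j + ((σ v).depth.getD 0 + 1)
        then (σ v).acc q + ∑ u ∈ children (fun v => (σ v).depth) par v, (σ u).acc q
        else (σ v).acc q } := by
  funext v
  rcases hv : (σ v).depth with _ | δ
  · simp only [comm, update, hv, Option.isSome_none, Bool.false_eq_true, false_and, if_false]
    rw [← hv]
  · have key : (((Finset.univ.filter fun u => G.Adj v u).val.map
        fun u => message (σ u) (.up j)).map (Msg.getVec (j + (δ + 1) - p.D) (σ v).uid)).sum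
        = ∑ u ∈ children (fun v => (σ v).depth) par v,
          if p.D ≤ j + (δ + 1) ∧ j + (δ + 1) - p.D < p.S then
            unpiece (j + (δ + 1) - p.D) (piece (j + (δ + 1) - p.D) (σ u).acc) else 0 := by
      rw [Multiset.map_map]
      change ∑ u ∈ Finset.univ.filter (fun u => G.Adj v u), _ = _
      symm
      have hsub : children (fun v => (σ v).depth) par v
          ⊆ Finset.univ.filter fun u => G.Adj v u := by
        intro u hu
        obtain ⟨δ', -, -, -, h, -⟩ := hF.dep_of_mem_children hu
        simpa using h.symm
      refine Finset.sum_subset_zero_on_sdiff hsub ?_ ?_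
      · intro u hu
        simp only [Finset.mem_sdiff, Finset.mem_filter, Finset.mem_univ, true_and] at hu
        obtain ⟨hadj, hch⟩ := hu
        simp only [Function.comp_apply, message]
        rcases hu : (σ u).depth with _ | _ | δ'
        · rfl
        · have := hF.parent_root u hu
          rw [this]
          rfl
        · have := (hF.succ u δ' hu).2.2
          simp only [this]
          have hne : (σ (par u)).uid ≠ (σ v).uid := by
            intro he
            have := hF.uid_inj he
            apply hch
            simp [children, hu, this]
          split_ifs
          · simp only [Msg.getVec, if_neg hne]
          · rfl
      · intro u hu
        obtain ⟨δ', h1, h2, h3, h4, h5⟩ := hF.dep_of_mem_children hu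
        rw [hv] at h1
        obtain rfl : δ = δ' := by simpa using h1
        simp only [Function.comp_apply, message, h2, h5]
        split_ifs
        · simp [Msg.getVec]
        · rfl
    simp only [comm, update, hv]
    rw [key]
    congr 1
    funext q
    simp only [Option.isSome_some, Option.getD_some, true_and, Pi.add_apply, Finset.sum_apply]
    have hq := div_w_lt hS q
    have hq0 := Nat.zero_le ((q : ℕ) / p.w)
    by_cases h : (q : ℕ) / p.w + p.D = j + (δ + 1)
    · rw [if_pos h]
      congr 1
      refine Finset.sum_congr rfl fun u _ => ?_
      rw [if_pos (by omega), unpiece_piece, if_pos (by omega)]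
    · rw [if_neg h, Finset.sum_eq_zero, add_zero]
      intro u _
      split_ifs with h2
      · rw [unpiece_piece, if_neg (by omega)]
      · rfl

open Classical in
-- Pipelining invariant: after j rounds a node of depth δ holds the full subtree sum in piece i once
-- i + D ≤ j + δ. Children are one level deeper, hence one round ahead, so a piece is complete at
-- the moment they send it. Leaves at depth D are complete from the start.
theorem commSeq_up (G : SimpleGraph (Fin n)) (σ : Fin n → State p) (par : Fin n → Fin n)
    (hF : Forest p.D G (fun v => (σ v).uid) (fun v => (σ v).leader) (fun v => (σ v).depth)
      (fun v => (σ v).parent) par) (hS : 0 < p.S) (j : ℕ) :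
    commSeq G .up σ j = fun v => { σ v with
      acc := fun q => if (σ v).depth.isSome ∧ (q : ℕ) / p.w + p.D ≤ j + (σ v).depth.getD 0
        then subtreeSum p.D (fun v => (σ v).depth) par (fun v => (σ v).acc) v q
        else (σ v).acc q } := by
  induction j with
  | zero =>
    funext v
    rw [commSeq]
    have : (fun q : Fin (p.k + p.k) => if (σ v).depth.isSome ∧ (q : ℕ) / p.w + p.D ≤ 0 + (σ v).depth.getD 0
        then subtreeSum p.D (fun v => (σ v).depth) par (fun v => (σ v).acc) v q
        else (σ v).acc q) = (σ v).acc := by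
      funext q
      split_ifs with h
      · obtain ⟨h1, h2⟩ := h
        obtain ⟨δ, hδ⟩ := Option.isSome_iff_exists.1 h1
        rw [hδ, Option.getD_some] at h2
        simp only [subtreeSum]
        have hD : p.D ≤ δ := (Nat.le_add_left _ _).trans (h2.trans (Nat.zero_add δ).le)
        rw [hδ, Option.getD_some, Nat.sub_eq_zero_of_le hD, generationSum]
      · rfl
    rw [this]
  | succ j ih =>
    rw [commSeq, ih]
    refine (comm_up G (fun v => { σ v with
      acc := fun q => if (σ v).depth.isSome ∧ (q : ℕ) / p.w + p.D ≤ j + (σ v).depth.getD 0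
        then subtreeSum p.D (fun v => (σ v).depth) par (fun v => (σ v).acc) v q
        else (σ v).acc q }) par hF hS j).trans ?_
    funext v
    dsimp only
    congr 1
    funext q
    rcases hv : (σ v).depth with _ | δ
    · simp
    · simp only [Option.isSome_some, Option.getD_some, true_and]
      by_cases h : (q : ℕ) / p.w + p.D = j + (δ + 1)
      · rw [if_pos h, if_neg (by omega), if_pos (by omega), hF.subtreeSum_eq _ hv, Pi.add_apply,
          Finset.sum_apply]
        congr 1
        refine Finset.sum_congr rfl fun u hu => ?_
        obtain ⟨δ', h1, h2, -⟩ := hF.dep_of_mem_children hu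
        rw [hv] at h1
        obtain rfl : δ = δ' := by simpa using h1
        rw [if_pos]
        simp only [h2, Option.isSome_some, Option.getD_some, true_and]
        omega
      · rw [if_neg h]
        by_cases h' : (q : ℕ) / p.w + p.D ≤ j + δ
        · rw [if_pos h', if_pos (by omega)]
        · rw [if_neg h', if_neg (by omega)]

open Classical in
theorem comm_down (G : SimpleGraph (Fin n)) (σ : Fin n → State p) (par : Fin n → Fin n)
    (hF : Forest p.D G (fun v => (σ v).uid) (fun v => (σ v).leader) (fun v => (σ v).depth)
      (fun v => (σ v).parent) par) (hS : 0 < p.S) (j : ℕ) :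
    ∃ y : Fin n → Vec p, comm G (.down j) σ = (fun v => { σ v with
      sum := y v
      known := if j + 1 = p.E ∧ (σ v).depth.isSome then insert (y v) (σ v).known
        else (σ v).known }) ∧
      ∀ v q, y v q = if 0 < (σ v).depth.getD 0 ∧ (q : ℕ) / p.w + (σ v).depth.getD 0 = j + 1
        then (σ v).sum q + (σ (par v)).sum q else (σ v).sum q := by
  refine ⟨fun v => (comm G (.down j) σ v).sum, ?_, ?_⟩
  · funext v
    simp only [comm, update]
  · intro v q
    simp only [comm, update]
    rcases hv : (σ v).depth with _ | _ | δ
    · simp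
    · have := hF.parent_root v hv
      simp [this]
    · obtain ⟨hadj, hd, hp⟩ := hF.succ v δ hv
      simp only [hp, Option.getD_some, Nat.succ_pos, true_and]
      have key : (((Finset.univ.filter fun u => G.Adj v u).val.map
          fun u => message (σ u) (.down j)).map
            (Msg.getVec (j + 1 - (δ + 1)) (σ (par v)).uid)).sum
          = if δ ≤ j ∧ j - δ < p.S then unpiece (j - δ) (piece (j - δ) (σ (par v)).sum)
            else 0 := by
        rw [Multiset.map_map]
        change ∑ u ∈ Finset.univ.filter (fun u => G.Adj v u), _ = _
        rw [Finset.sum_eq_single (par v)]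
        · simp only [Function.comp_apply, message, hd]
          rw [Nat.add_sub_add_right]
          split_ifs
          · simp [Msg.getVec]
          · rfl
        · intro u _ hne
          have hne' : (σ u).uid ≠ (σ (par v)).uid := fun he => hne (hF.uid_inj he)
          simp only [Function.comp_apply, message]
          rcases hu : (σ u).depth with _ | δ'
          · rfl
          · simp only
            split_ifs
            · simp only [Msg.getVec, if_neg hne']
            · rfl
        · intro h
          exact (h (by simpa using hadj)).elim
      rw [key, Pi.add_apply]
      have hq := div_w_lt hS q
      have hq0 := Nat.zero_le ((q : ℕ) / p.w)
      by_cases h : (q : ℕ) / p.w + (δ + 1) = j + 1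
      · rw [if_pos h, if_pos (by omega), unpiece_piece, if_pos (by omega)]
      · rw [if_neg h]
        split_ifs with h2
        · rw [unpiece_piece, if_neg (by omega), add_zero]
        · simp

open Classical in
-- Piece i of the root's sum has arrived at depth δ after i + δ rounds, and S + D rounds are enough
-- because i < S and δ ≤ D. Nothing enters `known` before the last round, when the vector is whole,
-- so no partial vector is ever recorded.
theorem commSeq_down (G : SimpleGraph (Fin n)) (σ : Fin n → State p) (par : Fin n → Fin n)
    (hF : Forest p.D G (fun v => (σ v).uid) (fun v => (σ v).leader) (fun v => (σ v).depth)
      (fun v => (σ v).parent) par) (hS : 0 < p.S) (hE : p.E = p.S + p.D) (t : Fin n → Vec p)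
    (ht : ∀ v, (σ v).sum = if (σ v).depth = some 0 then t v else 0) :
    ∃ y : Fin n → Vec p, commSeq G .down σ p.E = (fun v => { σ v with
      sum := y v
      known := if (σ v).depth.isSome then
        insert (t (root (fun v => (σ v).depth) par v)) (σ v).known else (σ v).known }) ∧
      ∀ v, (σ v).depth.isSome → y v = t (root (fun v => (σ v).depth) par v) := by
  have key : ∀ j ≤ p.E, ∃ y : Fin n → Vec p, commSeq G .down σ j = (fun v => { σ v with
      sum := y v
      known := if j = p.E ∧ (σ v).depth.isSome then
        insert (y v) (σ v).known else (σ v).known }) ∧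
      ∀ v q, y v q = if (σ v).depth.isSome ∧
          ((σ v).depth.getD 0 = 0 ∨ (q : ℕ) / p.w + (σ v).depth.getD 0 ≤ j)
        then t (root (fun v => (σ v).depth) par v) q else 0 := by
    intro j
    induction j with
    | zero =>
      intro _
      refine ⟨fun v => (σ v).sum, ?_, ?_⟩
      · funext v
        rw [commSeq, if_neg (by omega)]
      · intro v q
        simp only
        rw [ht v]
        rcases hv : (σ v).depth with _ | _ | δ
        · simp
        · simp only [if_true, Option.isSome_some, Option.getD_some, true_or, and_self]
          rw [root_zero hv]
        · simp
    | succ j ih =>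
      intro hj
      obtain ⟨y, h1, h2⟩ := ih (by omega)
      rw [commSeq, h1]
      obtain ⟨y', h3, h4⟩ := comm_down G (fun v => { σ v with
        sum := y v
        known := if j = p.E ∧ (σ v).depth.isSome then
          insert (y v) (σ v).known else (σ v).known }) par hF hS j
      refine ⟨y', ?_, ?_⟩
      · rw [h3]
        funext v
        simp only
        rw [if_neg (show ¬ (j = p.E ∧ (σ v).depth.isSome = true) from fun h => by omega)]
      · intro v q
        rw [h4 v q]
        simp only
        rw [h2 v q, h2 (par v) q]
        rcases hv : (σ v).depth with _ | _ | δ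
        · simp
        · simp
        · have hd : (σ (par v)).depth = some δ := (hF.succ v δ hv).2.1
          have hr : root (fun v => (σ v).depth) par v = root (fun v => (σ v).depth) par (par v) :=
            hF.root_succ hv
          simp only [hd, Option.isSome_some, Option.getD_some, true_and, Nat.succ_pos, hr,
            Nat.succ_ne_zero, false_or]
          by_cases h : (q : ℕ) / p.w + (δ + 1) = j + 1
          · rw [if_pos h, if_neg (by omega), if_pos (by omega), if_pos (by omega), zero_add]
          · rw [if_neg h]
            by_cases h' : (q : ℕ) / p.w + (δ + 1) ≤ j
            · rw [if_pos h', if_pos (by omega)]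
            · rw [if_neg h', if_neg (by omega)]
  obtain ⟨y, h1, h2⟩ := key p.E le_rfl
  have h3 : ∀ v, (σ v).depth.isSome → y v = t (root (fun v => (σ v).depth) par v) := by
    intro v hv
    funext q
    rw [h2, if_pos]
    refine ⟨hv, Or.inr ?_⟩
    obtain ⟨δ, hδ⟩ := Option.isSome_iff_exists.1 hv
    have := hF.le v δ hδ
    have hq := div_w_lt hS q
    rw [hδ, Option.getD_some]
    omega
  refine ⟨y, ?_, h3⟩
  rw [h1]
  funext v
  by_cases hv : (σ v).depth.isSome
  · simp [hv, h3 v hv]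
  · simp [hv]

open Classical in
-- Round j fills exactly the coordinates of piece j, and the identifiers keep the neighbours apart.
-- The assembly adds to `inbox`, which is why it has to start empty.
theorem commSeq_pass (G : SimpleGraph (Fin n)) (σ : Fin n → State p)
    (huid : Function.Injective fun v => (σ v).uid) (hS : 0 < p.S)
    (hin : ∀ v, (σ v).inbox = 0) (hh : ∀ v, (σ v).heard = ∅) :
    ∃ (inb : Fin n → Fin p.U → Vec p) (hd : Fin n → Finset (Fin p.U)),
      commSeq G .pass σ p.S = fun v => { σ v with
        inbox := inb v
        heard := hd v
        known := (σ v).known ∪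
          (Finset.univ.filter fun u => G.Adj v u ∧ (σ u).depth.isSome).image
            fun u => (σ u).sum } := by
  have key : ∀ j ≤ p.S, ∃ (inb : Fin n → Fin p.U → Vec p) (hd : Fin n → Finset (Fin p.U)),
      commSeq G .pass σ j = (fun v => { σ v with
        inbox := inb v
        heard := hd v
        known := if j = p.S then (σ v).known ∪ (hd v).image (inb v) else (σ v).known }) ∧
      (∀ v u q, G.Adj v u → (σ u).depth.isSome →
        inb v (σ u).uid q = if (q : ℕ) / p.w < j then (σ u).sum q else 0) ∧
      ∀ v, hd v = if j = 0 then ∅ else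
        (Finset.univ.filter fun u => G.Adj v u ∧ (σ u).depth.isSome).image
          fun u => (σ u).uid := by
    intro j
    induction j with
    | zero =>
      intro _
      refine ⟨fun v => (σ v).inbox, fun v => (σ v).heard, ?_, ?_, ?_⟩
      · funext v
        rw [commSeq, if_neg (by omega)]
      · intro v u q _ _
        simp [hin]
      · intro v
        simp [hh]
    | succ j ih =>
      intro hj
      obtain ⟨inb, hd, h1, h2, h3⟩ := ih (by omega)
      rw [commSeq, h1]
      set σ' : Fin n → State p := fun v => { σ v with
        inbox := inb v
        heard := hd v
        known := if j = p.S then (σ v).known ∪ (hd v).image (inb v) else (σ v).known } with hσ'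
      refine ⟨fun v => (comm G (.pass j) σ' v).inbox, fun v => (comm G (.pass j) σ' v).heard,
        ?_, ?_, ?_⟩
      · funext v
        simp only [comm, update, hσ', if_neg (show j ≠ p.S by omega)]
      · intro v u q hvu hu
        simp only [comm, update, Pi.add_apply]
        have hkey : (((Finset.univ.filter fun u => G.Adj v u).val.map
            fun u => message (σ' u) (.pass j)).map (Msg.getVec j (σ u).uid)).sum
            = unpiece j (piece j (σ u).sum) := by
          rw [Multiset.map_map]
          change ∑ u ∈ Finset.univ.filter (fun u => G.Adj v u), _ = _
          rw [Finset.sum_eq_single u]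
          · simp [message, hσ', hu, Msg.getVec]
          · intro w _ hne
            have hne' : (σ w).uid ≠ (σ u).uid := fun he => hne (huid he)
            simp only [Function.comp_apply, message, hσ']
            split_ifs
            · simp only [Msg.getVec, if_neg hne']
            · rfl
          · intro h
            exact (h (by simpa using hvu)).elim
        rw [hkey, unpiece_piece]
        change inb v (σ u).uid q + _ = _
        rw [h2 v u q hvu hu]
        by_cases h : (q : ℕ) / p.w = j
        · rw [if_pos h, if_neg (by omega), if_pos (by omega), zero_add]
        · rw [if_neg h, add_zero]
          by_cases h' : (q : ℕ) / p.w < j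
          · rw [if_pos h', if_pos (by omega)]
          · rw [if_neg h', if_neg (by omega)]
      · intro v
        rw [if_neg (by omega)]
        simp only [comm, update]
        change hd v ∪ _ = _
        have hrec : (((Finset.univ.filter fun u => G.Adj v u).val.map
            fun u => message (σ' u) (.pass j)).filterMap Msg.getId).toFinset
            = (Finset.univ.filter fun u => G.Adj v u ∧ (σ u).depth.isSome).image
              fun u => (σ u).uid := by
          ext x
          simp only [Multiset.mem_toFinset, Multiset.mem_filterMap, Multiset.mem_map,
            Finset.mem_val, Finset.mem_filter, Finset.mem_univ, true_and, Finset.mem_image,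
            message, hσ']
          constructor
          · rintro ⟨m, ⟨u, hu, rfl⟩, hm⟩
            split_ifs at hm with h
            · exact ⟨u, ⟨hu, h⟩, by simpa [Msg.getId] using hm⟩
            · simp [Msg.getId] at hm
          · rintro ⟨u, ⟨hu, h⟩, rfl⟩
            exact ⟨_, ⟨u, hu, rfl⟩, by simp [h, Msg.getId]⟩
        rw [hrec, h3]
        split_ifs <;> simp
  obtain ⟨inb, hd, h1, h2, h3⟩ := key p.S le_rfl
  refine ⟨inb, hd, ?_⟩
  rw [h1]
  funext v
  have : (hd v).image (inb v) = (Finset.univ.filter fun u => G.Adj v u ∧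
      (σ u).depth.isSome).image fun u => (σ u).sum := by
    rw [h3, if_neg (by omega), Finset.image_image]
    refine Finset.image_congr ?_
    intro u hu
    simp only [Finset.coe_filter, Finset.mem_univ, true_and, Set.mem_ofPred_eq] at hu
    funext q
    simp only [Function.comp_apply]
    rw [h2 v u q hu.1 hu.2, if_pos (div_w_lt hS q)]
  simp [this]

end PatchSharing

namespace PatchSharing

variable {p : Params} {n : ℕ}

/-! ### The stages of a meta round -/

theorem Params.S_pos (hD : 0 < p.D) : 0 < p.S := by
  rw [Params.S, if_neg hD.ne']
  have h1 := Nat.div_mul_le_self p.T (2 * (2 * p.iters + 5))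
  have h2 : 1 * (2 * (2 * p.iters + 5)) ≤ p.D * (2 * (2 * p.iters + 5)) :=
    Nat.mul_le_mul_right _ hD
  have h3 : p.D * (2 * (2 * p.iters + 5)) ≤ p.T := h1
  omega

theorem Params.E_eq (hD : 0 < p.D) : p.E = p.S + p.D := if_neg hD.ne'

/-- The schedule takes `treeStart` + 5D + 5S rounds: one D for the trees, four transmissions of S +
D rounds, and S rounds for passing. The definition of D bounds `treeStart` + 5D by T/2, and S =
⌊T/10⌋ bounds 5S by T/2. -/
theorem Params.idleStart_le (hD : 0 < p.D) : p.idleStart ≤ p.T := by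
  have h1 : p.D * (2 * (2 * p.iters + 5)) ≤ p.T :=
    Nat.div_mul_le_self p.T (2 * (2 * p.iters + 5))
  have h2 : p.S * 10 ≤ p.T := by
    rw [Params.S, if_neg hD.ne']
    exact Nat.div_mul_le_self p.T 10
  have h3 : p.D * (2 * (2 * p.iters + 5)) = 2 * p.treeStart + 10 * p.D := by
    rw [Params.treeStart]; ring
  simp only [Params.idleStart, Params.down₂, Params.up₂, Params.passStart, Params.down₁,
    Params.up₁, Params.E_eq hD]
  omega

theorem prepare_of_le {s : ℕ} (h0 : 0 < s) (h : p.treeStart ≤ s) (r : Seed p) (st : State p) :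
    prepare p s r st =
      (fun st : State p => if s = p.down₁ ∨ s = p.down₂ then st.startDown else st)
      ((fun st : State p => if s = p.up₁ ∨ s = p.up₂ then st.startUp r.2 else st)
        (if s = p.treeStart then st.plant else st)) := by
  have h2 : ¬ s < p.treeStart := by omega
  simp only [prepare, h0.ne', h2, false_and, if_false]

/-- Each half of an iteration is a stage whose local computation happens only in its first round:
the random draw, then the deterministic decision. The reset falls into the first iteration. -/
theorem blockE_luby (hD : 0 < p.D) (G : SimpleGraph (Fin n)) {i : ℕ} (hi : i < p.iters)
    (F : (Fin n → State p) → ℝ) (σ : Fin n → State p) :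
    blockE G (2 * p.D * i) (2 * p.D) F σ
      = 𝔼 r : Fin n → Seed p, F (luby G (fun v => if i = 0 then (σ v).reset else σ v) r) := by
  have hle : 2 * p.D * i + 2 * p.D ≤ p.treeStart := by
    rw [Params.treeStart, ← Nat.mul_succ]
    exact Nat.mul_le_mul_left _ hi
  have hmod : ∀ j < 2 * p.D, (2 * p.D * i + j) % (2 * p.D) = j := fun j hj => by
    rw [Nat.mul_add_mod, Nat.mod_eq_of_lt hj]
  have hup₁ : p.up₁ = p.treeStart + p.D := rfl
  have hdown₁ : p.down₁ = p.up₁ + p.E := rfl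
  have hpass : p.passStart = p.down₁ + p.E := rfl
  have hup₂ : p.up₂ = p.passStart + p.S := rfl
  have hdown₂ : p.down₂ = p.up₂ + p.E := rfl
  have hph : ∀ j < 2 * p.D, phase p (2 * p.D * i + j) = if j < p.D then .prio else .deactivate := by
    intro j hj
    rw [phase, if_pos (by omega), hmod j hj]
  have hprep : ∀ j < 2 * p.D, ∀ (r : Seed p) (st : State p),
      prepare p (2 * p.D * i + j) r st =
        (fun st : State p => if j = p.D then st.decideLeader else st)
        ((fun st : State p => if j = 0 then st.draw r.1 else st)
          (if 2 * p.D * i + j = 0 then st.reset else st)) := by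
    intro j hj r st
    simp only [prepare, hmod j hj]
    rw [if_neg (show ¬ (2 * p.D * i + j = p.down₁ ∨ 2 * p.D * i + j = p.down₂) by omega),
      if_neg (show ¬ (2 * p.D * i + j = p.up₁ ∨ 2 * p.D * i + j = p.up₂) by omega),
      if_neg (show ¬ (2 * p.D * i + j = p.treeStart) by omega)]
    have hlt : 2 * p.D * i + j < p.treeStart := by omega
    simp only [hlt, true_and]
  have h2 : ∀ σ : Fin n → State p, blockE G (2 * p.D * i + p.D) p.D F σ
      = F (commSeq G (fun _ => .deactivate) (fun v => (σ v).decideLeader) p.D) := by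
    intro σ
    refine blockE_stage_det G _ _ (fun _ => .deactivate) hD ?_ ?_ State.decideLeader ?_ F σ
    · intro j hj
      rw [add_assoc, hph _ (by omega), if_neg (by omega)]
    · intro j h0 hj r st
      rw [add_assoc, hprep _ (by omega)]
      simp only
      rw [if_neg (by omega), if_neg (by omega), if_neg (by omega)]
    · intro r st
      rw [hprep _ (by omega)]
      simp only
      rw [if_pos trivial, if_neg (by omega), if_neg (by omega)]
  rw [show blockE G (2 * p.D * i) (2 * p.D) F σ = blockE G (2 * p.D * i) (p.D + p.D) F σ by
    rw [two_mul p.D], blockE_add, show blockE G (2 * p.D * i + p.D) p.D F = _ from funext h2,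
    blockE_stage G _ _ (fun _ => .prio) hD]
  · refine Finset.expect_congr rfl fun r _ => ?_
    have h5 : prep (2 * p.D * i) r σ
        = fun v => (if i = 0 then (σ v).reset else σ v).draw (r v).1 := by
      funext v
      have h3 := hprep 0 (by omega) (r v) (σ v)
      rw [add_zero] at h3
      rw [prep, h3]
      simp only [if_true]
      rw [if_neg hD.ne]
      have h4 : 2 * p.D * i = 0 ↔ i = 0 := by
        rw [mul_eq_zero]; omega
      simp only [h4]
    rw [luby, h5]
  · intro j hj
    rw [hph _ (by omega), if_pos hj]
  · intro j h0 hj r st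
    rw [hprep _ (by omega)]
    simp only
    rw [if_neg (by omega), if_neg (by omega), if_neg (by omega)]

theorem blockE_tree (hD : 0 < p.D) (hi : 0 < p.iters) (G : SimpleGraph (Fin n))
    (F : (Fin n → State p) → ℝ) (σ : Fin n → State p) :
    blockE G p.treeStart p.D F σ = F (commSeq G .tree (fun v => (σ v).plant) p.D) := by
  have hts : 0 < p.treeStart := by rw [Params.treeStart]; positivity
  have hS := Params.S_pos hD
  have hE := Params.E_eq hD
  have hup₁ : p.up₁ = p.treeStart + p.D := rfl
  have hdown₁ : p.down₁ = p.up₁ + p.E := rfl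
  have hpass : p.passStart = p.down₁ + p.E := rfl
  have hup₂ : p.up₂ = p.passStart + p.S := rfl
  have hdown₂ : p.down₂ = p.up₂ + p.E := rfl
  refine blockE_stage_det G _ _ .tree hD ?_ ?_ State.plant ?_ F σ
  · intro j hj
    rw [phase, if_neg (by omega), if_pos (by omega), Nat.add_sub_cancel_left]
  · intro j h0 hj r st
    rw [prepare_of_le (by omega) (by omega)]
    simp only
    rw [if_neg (by omega), if_neg (by omega), if_neg (by omega)]
  · intro r st
    rw [prepare_of_le (by omega) (by omega)]
    simp only
    rw [if_neg (by omega), if_neg (by omega), if_pos trivial]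

theorem blockE_up (hD : 0 < p.D) (G : SimpleGraph (Fin n)) {s : ℕ} (hs : s = p.up₁ ∨ s = p.up₂)
    (F : (Fin n → State p) → ℝ) (σ : Fin n → State p) :
    blockE G s p.E F σ = 𝔼 r : Fin n → Seed p,
      F (commSeq G .up (fun v => (σ v).startUp (r v).2) p.E) := by
  have hS := Params.S_pos hD
  have hE := Params.E_eq hD
  have hup₁ : p.up₁ = p.treeStart + p.D := rfl
  have hdown₁ : p.down₁ = p.up₁ + p.E := rfl
  have hpass : p.passStart = p.down₁ + p.E := rfl
  have hup₂ : p.up₂ = p.passStart + p.S := rfl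
  have hdown₂ : p.down₂ = p.up₂ + p.E := rfl
  rw [blockE_stage G s p.E .up (by omega)]
  · refine Finset.expect_congr rfl fun r _ => ?_
    congr 2
    funext v
    rw [prep, prepare_of_le (by omega) (by omega)]
    simp only
    rw [if_neg (by omega), if_pos hs, if_neg (by omega)]
  · intro j hj
    rcases hs with rfl | rfl
    · rw [phase, if_neg (by omega), if_neg (by omega), if_pos (by omega), Nat.add_sub_cancel_left]
    · rw [phase, if_neg (by omega), if_neg (by omega), if_neg (by omega), if_neg (by omega),
        if_neg (by omega), if_pos (by omega), Nat.add_sub_cancel_left]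
  · intro j h0 hj r st
    rw [prepare_of_le (by omega) (by omega)]
    simp only
    rw [if_neg (by omega), if_neg (by omega), if_neg (by omega)]

theorem blockE_down (hD : 0 < p.D) (G : SimpleGraph (Fin n)) {s : ℕ}
    (hs : s = p.down₁ ∨ s = p.down₂) (F : (Fin n → State p) → ℝ) (σ : Fin n → State p) :
    blockE G s p.E F σ = F (commSeq G .down (fun v => (σ v).startDown) p.E) := by
  have hS := Params.S_pos hD
  have hE := Params.E_eq hD
  have hup₁ : p.up₁ = p.treeStart + p.D := rfl
  have hdown₁ : p.down₁ = p.up₁ + p.E := rfl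
  have hpass : p.passStart = p.down₁ + p.E := rfl
  have hup₂ : p.up₂ = p.passStart + p.S := rfl
  have hdown₂ : p.down₂ = p.up₂ + p.E := rfl
  have hidle : p.idleStart = p.down₂ + p.E := rfl
  refine blockE_stage_det G _ _ .down (by omega) ?_ ?_ State.startDown ?_ F σ
  · intro j hj
    rcases hs with rfl | rfl
    · rw [phase, if_neg (by omega), if_neg (by omega), if_neg (by omega), if_pos (by omega),
        Nat.add_sub_cancel_left]
    · rw [phase, if_neg (by omega), if_neg (by omega), if_neg (by omega), if_neg (by omega),
        if_neg (by omega), if_neg (by omega), if_pos (by omega), Nat.add_sub_cancel_left]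
  · intro j h0 hj r st
    rw [prepare_of_le (by omega) (by omega)]
    simp only
    rw [if_neg (by omega), if_neg (by omega), if_neg (by omega)]
  · intro r st
    rw [prepare_of_le (by omega) (by omega)]
    simp only
    rw [if_pos hs, if_neg (by omega), if_neg (by omega)]

theorem blockE_pass (hD : 0 < p.D) (G : SimpleGraph (Fin n)) (F : (Fin n → State p) → ℝ)
    (σ : Fin n → State p) : blockE G p.passStart p.S F σ = F (commSeq G .pass σ p.S) := by
  have hS := Params.S_pos hD
  have hE := Params.E_eq hD
  have hup₁ : p.up₁ = p.treeStart + p.D := rfl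
  have hdown₁ : p.down₁ = p.up₁ + p.E := rfl
  have hpass : p.passStart = p.down₁ + p.E := rfl
  have hup₂ : p.up₂ = p.passStart + p.S := rfl
  have hdown₂ : p.down₂ = p.up₂ + p.E := rfl
  refine blockE_quiet G _ _ .pass ?_ ?_ F σ
  · intro j hj
    rw [phase, if_neg (by omega), if_neg (by omega), if_neg (by omega), if_neg (by omega),
      if_pos (by omega), Nat.add_sub_cancel_left]
  · intro j hj r st
    rw [prepare_of_le (by omega) (by omega)]
    simp only
    rw [if_neg (by omega), if_neg (by omega), if_neg (by omega)]

theorem commSeq_idle (G : SimpleGraph (Fin n)) (σ : Fin n → State p) (j : ℕ) :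
    commSeq G (fun _ => .idle) σ j = σ := by
  induction j with
  | zero => rfl
  | succ j ih => rw [commSeq, ih]; rfl

theorem blockE_idle (hD : 0 < p.D) (G : SimpleGraph (Fin n)) (j : ℕ) (F : (Fin n → State p) → ℝ)
    (σ : Fin n → State p) : blockE G p.idleStart j F σ = F σ := by
  have hS := Params.S_pos hD
  have hE := Params.E_eq hD
  have hup₁ : p.up₁ = p.treeStart + p.D := rfl
  have hdown₁ : p.down₁ = p.up₁ + p.E := rfl
  have hpass : p.passStart = p.down₁ + p.E := rfl
  have hup₂ : p.up₂ = p.passStart + p.S := rfl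
  have hdown₂ : p.down₂ = p.up₂ + p.E := rfl
  have hidle : p.idleStart = p.down₂ + p.E := rfl
  rw [blockE_quiet G _ _ (fun _ => .idle), commSeq_idle]
  · intro j hj
    rw [phase, if_neg (by omega), if_neg (by omega), if_neg (by omega), if_neg (by omega),
      if_neg (by omega), if_neg (by omega), if_neg (by omega)]
  · intro j hj r st
    rw [prepare_of_le (by omega) (by omega)]
    simp only
    rw [if_neg (by omega), if_neg (by omega), if_neg (by omega)]

/-- A share step, up and down the trees. -/
noncomputable def share (G : SimpleGraph (Fin n)) (σ : Fin n → State p) (r : Fin n → Seed p) :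
    Fin n → State p :=
  commSeq G .down (fun v =>
    (commSeq G .up (fun v => (σ v).startUp (r v).2) p.E v).startDown) p.E

/-- The random sum of the patch with root `x`. -/
def patchSum (σ : Fin n → State p) (par : Fin n → Fin n) (r : Fin n → Seed p) (x : Fin n) :
    Vec p :=
  ∑ u ∈ patch (fun v => (σ v).depth) par x, combination (σ u).known (r u).2

open Classical in
-- After the upward transmission the root's subtree sum is the sum over its patch, and the downward
-- one copies it to every member. `acc` and the values of `sum` outside the patches are irrelevant.
theorem share_spec (hD : 0 < p.D) (G : SimpleGraph (Fin n)) (σ : Fin n → State p)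
    (par : Fin n → Fin n)
    (hF : Forest p.D G (fun v => (σ v).uid) (fun v => (σ v).leader) (fun v => (σ v).depth)
      (fun v => (σ v).parent) par) (r : Fin n → Seed p) :
    ∃ a y : Fin n → Vec p, share G σ r = (fun v => { σ v with
      acc := a v
      sum := y v
      known := if (σ v).depth.isSome then
        insert (patchSum σ par r (root (fun v => (σ v).depth) par v)) (σ v).known
        else (σ v).known }) ∧
      ∀ v, (σ v).depth.isSome → y v = patchSum σ par r (root (fun v => (σ v).depth) par v) := by
  have hS := Params.S_pos hD
  have hE := Params.E_eq hD
  set a : Fin n → Vec p := fun v q =>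
    if (σ v).depth.isSome ∧ (q : ℕ) / p.w + p.D ≤ p.E + (σ v).depth.getD 0
        then subtreeSum p.D (fun v => (σ v).depth) par
          (fun v => combination (σ v).known (r v).2) v q
        else combination (σ v).known (r v).2 q with ha
  have h1 : commSeq G .up (fun v => (σ v).startUp (r v).2) p.E = fun v => { σ v with acc := a v } :=
    commSeq_up G (fun v => (σ v).startUp (r v).2) par hF hS p.E
  have h2 : ∀ v, (σ v).depth = some 0 → a v = patchSum σ par r v := by
    intro v hv
    rw [patchSum, ← hF.subtreeSum_root _ hv]
    funext q
    rw [ha]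
    simp only
    rw [if_pos]
    have hq := div_w_lt hS q
    rw [hv]
    exact ⟨rfl, by rw [hE]; omega⟩
  obtain ⟨y, h3, h4⟩ := commSeq_down G
    (fun v => { σ v with acc := a v, sum := if (σ v).leader then a v else 0 }) par hF hS hE
    (patchSum σ par r) (by
      intro v
      simp only [← hF.zero_iff v]
      split_ifs with h
      · exact h2 v h
      · rfl)
  refine ⟨a, y, ?_, h4⟩
  rw [share, h1]
  exact h3

theorem blockE_share (hD : 0 < p.D) (G : SimpleGraph (Fin n)) {s : ℕ} (hs : s = p.up₁ ∨ s = p.up₂)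
    (F : (Fin n → State p) → ℝ) (σ : Fin n → State p) :
    blockE G s (p.E + p.E) F σ = 𝔼 r : Fin n → Seed p, F (share G σ r) := by
  have hs' : s + p.E = p.down₁ ∨ s + p.E = p.down₂ := by
    rcases hs with rfl | rfl
    · exact Or.inl rfl
    · exact Or.inr rfl
  rw [blockE_add, show blockE G (s + p.E) p.E F = _ from funext (blockE_down hD G hs' F),
    blockE_up hD G hs]
  rfl

end PatchSharing

/-! ### Random priorities -/

section StrictMax

variable {V β : Type} [Fintype V] [DecidableEq V] [Fintype β] [Nonempty β] {m : ℕ} [NeZero m]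

/-- Shifting the priority of `u` cyclically permutes the seeds, so all m events "the two priorities
differ by a" have equal probability; they partition the space. -/
theorem expect_tie_eq {u w : V} (huw : w ≠ u) :
    𝔼 r : V → Fin m × β, (if (r w).1 = (r u).1 then (1 : ℝ) else 0) = 1 / m := by
  have hshift : ∀ a : Fin m, 𝔼 r : V → Fin m × β, (if (r w).1 = (r u).1 then (1 : ℝ) else 0)
      = 𝔼 r : V → Fin m × β, (if (r w).1 = (r u).1 + a then (1 : ℝ) else 0) := by
    intro a
    let e : (V → Fin m × β) ≃ (V → Fin m × β) :=
      { toFun := fun r => Function.update r u ((r u).1 + a, (r u).2)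
        invFun := fun r => Function.update r u ((r u).1 - a, (r u).2)
        left_inv := fun r => by simp
        right_inv := fun r => by simp }
    refine (Fintype.expect_equiv e _ _ fun r => ?_).symm
    simp [e, Function.update_of_ne huw]
  have hm : (0 : ℝ) < m := by exact_mod_cast NeZero.pos m
  rw [eq_div_iff hm.ne', mul_comm]
  calc (m : ℝ) * 𝔼 r : V → Fin m × β, (if (r w).1 = (r u).1 then (1 : ℝ) else 0)
      = ∑ a : Fin m, 𝔼 r : V → Fin m × β, (if (r w).1 = (r u).1 then (1 : ℝ) else 0) := by
        rw [Finset.sum_const, Finset.card_univ, Fintype.card_fin, nsmul_eq_mul]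
    _ = ∑ a : Fin m, 𝔼 r : V → Fin m × β, (if (r w).1 = (r u).1 + a then (1 : ℝ) else 0) :=
        Finset.sum_congr rfl fun a _ => hshift a
    _ = 𝔼 r : V → Fin m × β, ∑ a : Fin m, (if (r w).1 = (r u).1 + a then (1 : ℝ) else 0) :=
        (Finset.expect_sum_comm _ _ _).symm
    _ = 𝔼 _r : V → Fin m × β, (1 : ℝ) := by
        refine Finset.expect_congr rfl fun r _ => ?_
        rw [Finset.sum_eq_single ((r w).1 - (r u).1)]
        · simp
        · intro a _ ha
          rw [if_neg]
          intro h
          apply ha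
          rw [h]
          simp
        · simp
    _ = 1 := Fintype.expect_const 1

/-- Some element of `W` is always a weak maximum, so by symmetry `u` is one with probability at
least 1/|W|. Ties with `u` cost at most |W|/m ≤ 1/(2|W|). Demanding a strict maximum of the random
part makes identifiers irrelevant. -/
theorem expect_strictMax_ge {W : Finset V} {u : V} (hu : u ∈ W) (hW : 2 * W.card ^ 2 ≤ m) :
    1 / (2 * (W.card : ℝ)) ≤ 𝔼 r : V → Fin m × β,
      (if ∀ w ∈ W, w ≠ u → (r w).1 < (r u).1 then (1 : ℝ) else 0) := by
  set Q : V → ℝ := fun u => 𝔼 r : V → Fin m × β,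
    (if ∀ w ∈ W, (r w).1 ≤ (r u).1 then (1 : ℝ) else 0) with hQ
  have hc : (0 : ℝ) < W.card := by exact_mod_cast Finset.card_pos.2 ⟨u, hu⟩
  have hm : (0 : ℝ) < m := by exact_mod_cast NeZero.pos m
  have hsymm : ∀ u' ∈ W, Q u' = Q u := by
    intro u' hu'
    refine Fintype.expect_equiv (Equiv.arrowCongr (Equiv.swap u u') (Equiv.refl _)) _ _
      fun r => ?_
    simp only [Equiv.arrowCongr_apply, Function.comp_apply, Equiv.refl_apply, Equiv.symm_swap,
      Equiv.swap_apply_left]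
    congr 1
    have hmem : ∀ w, w ∈ W → Equiv.swap u u' w ∈ W := by
      intro w hw
      rw [Equiv.swap_apply_def]
      split_ifs <;> assumption
    refine propext ⟨fun h w hw => h _ (hmem w hw), fun h w hw => ?_⟩
    have := h _ (hmem w hw)
    rwa [Equiv.swap_apply_self] at this
  have hsum : 1 ≤ ∑ u' ∈ W, Q u' := by
    rw [hQ, ← Finset.expect_sum_comm]
    refine Finset.le_expect Finset.univ_nonempty fun r _ => ?_
    obtain ⟨x, hx, hmax⟩ := Finset.exists_max_image W (fun w => (r w).1) ⟨u, hu⟩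
    calc (1 : ℝ) = if ∀ w ∈ W, (r w).1 ≤ (r x).1 then (1 : ℝ) else 0 := by rw [if_pos hmax]
      _ ≤ _ := Finset.single_le_sum
        (f := fun x => if ∀ w ∈ W, (r w).1 ≤ (r x).1 then (1 : ℝ) else 0)
        (fun i _ => by split_ifs <;> norm_num) hx
  rw [Finset.sum_congr rfl hsymm, Finset.sum_const, nsmul_eq_mul] at hsum
  have hbound : Q u ≤ 𝔼 r : V → Fin m × β,
      ((if ∀ w ∈ W, w ≠ u → (r w).1 < (r u).1 then (1 : ℝ) else 0)
        + ∑ w ∈ W.erase u, if (r w).1 = (r u).1 then (1 : ℝ) else 0) := by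
    refine Finset.expect_le_expect fun r _ => ?_
    have h0 : ∀ w ∈ W.erase u, (0 : ℝ) ≤ if (r w).1 = (r u).1 then (1 : ℝ) else 0 :=
      fun w _ => by split_ifs <;> norm_num
    have h0' := Finset.sum_nonneg h0
    by_cases h1 : ∀ w ∈ W, (r w).1 ≤ (r u).1
    · rw [if_pos h1]
      by_cases h2 : ∀ w ∈ W, w ≠ u → (r w).1 < (r u).1
      · rw [if_pos h2]; linarith
      · rw [if_neg h2]
        push Not at h2
        obtain ⟨w, hw, hne, hle⟩ := h2
        have hmem : w ∈ W.erase u := Finset.mem_erase.2 ⟨hne, hw⟩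
        have := Finset.single_le_sum h0 hmem
        rw [if_pos (le_antisymm (h1 w hw) hle)] at this
        linarith
    · rw [if_neg h1]
      have : (0 : ℝ) ≤ if ∀ w ∈ W, w ≠ u → (r w).1 < (r u).1 then (1 : ℝ) else 0 := by
        split_ifs <;> norm_num
      linarith
  rw [Finset.expect_add_distrib, Finset.expect_sum_comm,
    Finset.sum_congr rfl fun w hw => expect_tie_eq (Finset.ne_of_mem_erase hw),
    Finset.sum_const, nsmul_eq_mul] at hbound
  have hcard : ((W.erase u).card : ℝ) ≤ W.card := by
    exact_mod_cast Finset.card_le_card (Finset.erase_subset u W)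
  have h1 : 1 / (W.card : ℝ) ≤ Q u := by
    rw [div_le_iff₀ hc]; linarith
  have h2 : ((W.erase u).card : ℝ) * (1 / m) ≤ 1 / (2 * (W.card : ℝ)) := by
    have hW' : 2 * (W.card : ℝ) ^ 2 ≤ m := by exact_mod_cast hW
    rw [mul_one_div, div_le_div_iff₀ hm (by positivity)]
    nlinarith
  have h3 : 1 / (W.card : ℝ) = 1 / (2 * (W.card : ℝ)) + 1 / (2 * (W.card : ℝ)) := by
    field_simp
    norm_num
  linarith

end StrictMax

namespace PatchSharing

variable {p : Params} {n : ℕ}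

/-! ### Convergence of the independent set computation -/

open Classical in
/-- The active nodes within distance `D` of an active node. -/
noncomputable def rivals (G : SimpleGraph (Fin n)) (σ : Fin n → State p) (v : Fin n) :
    Finset (Fin n) :=
  Finset.univ.filter fun u => u ≠ v ∧ G.dist v u ≤ p.D ∧ (σ v).active = true ∧ (σ u).active = true

theorem mem_rivals {G : SimpleGraph (Fin n)} {σ : Fin n → State p} {u v : Fin n} :
    u ∈ rivals G σ v ↔
      u ≠ v ∧ G.dist v u ≤ p.D ∧ (σ v).active = true ∧ (σ u).active = true := by
  simp [rivals]

theorem mem_rivals_comm {G : SimpleGraph (Fin n)} {σ : Fin n → State p} {u v : Fin n} :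
    u ∈ rivals G σ v ↔ v ∈ rivals G σ u := by
  rw [mem_rivals, mem_rivals, G.dist_comm (u := v) (v := u), ne_comm]
  tauto

/-- The number of ordered pairs of active nodes within distance `D`. -/
noncomputable def conflicts (G : SimpleGraph (Fin n)) (σ : Fin n → State p) : ℝ :=
  ∑ v, ((rivals G σ v).card : ℝ)

theorem conflicts_le (G : SimpleGraph (Fin n)) (σ : Fin n → State p) :
    conflicts G σ ≤ (n : ℝ) ^ 2 := by
  calc conflicts G σ ≤ ∑ _v : Fin n, (n : ℝ) := by
        refine Finset.sum_le_sum fun v _ => ?_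
        exact_mod_cast (Finset.card_le_univ _).trans (Fintype.card_fin n).le
    _ = (n : ℝ) ^ 2 := by simp [sq]

/-- The invariants of the independent set computation. -/
structure LubyInv (G : SimpleGraph (Fin n)) (K : Fin n → Finset (Vec p)) (σ : Fin n → State p) :
    Prop where
  known_eq : ∀ v, (σ v).known = K v
  inbox_eq : ∀ v, (σ v).inbox = 0
  heard_eq : ∀ v, (σ v).heard = ∅
  uid_inj : Function.Injective fun v => (σ v).uid
  indep : ∀ x y, (σ x).leader = true → (σ y).leader = true → G.dist x y ≤ p.D → x = y
  far : ∀ v x, (σ v).active = true → (σ x).leader = true → p.D < G.dist v x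
  near : ∀ v, (σ v).active = false → ∃ x, (σ x).leader = true ∧ G.dist v x ≤ p.D

theorem LubyInv.reset (hD : 0 < p.D) (G : SimpleGraph (Fin n)) (σ : Fin n → State p)
    (huid : Function.Injective fun v => (σ v).uid) :
    LubyInv G (fun v => (σ v).known) fun v => (σ v).reset where
  known_eq _ := rfl
  inbox_eq _ := rfl
  heard_eq _ := rfl
  uid_inj := huid
  indep x y hx := by simp [State.reset, hD.ne'] at hx
  far v x _ hx := by simp [State.reset, hD.ne'] at hx
  near v hv := by simp [State.reset] at hv

theorem drawn_eq_iff {σ : Fin n → State p} {r : Fin n → Seed p} {x y : Fin n}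
    (huid : Function.Injective fun v => (σ v).uid) (hx : (σ x).active = true)
    (hy : (σ y).active = true) (h : drawn σ r x = drawn σ r y) : x = y := by
  rw [drawn, drawn, if_pos hx, if_pos hy, WithBot.coe_inj] at h
  exact huid (congrArg (fun z => (ofLex z).2) h)

/-- New leaders were active, hence far from all old ones. Two new leaders within distance D would
both hold the highest priority there, and identifiers make priorities of active nodes distinct. -/
theorem LubyInv.luby {G : SimpleGraph (Fin n)} (hG : G.Connected) {K : Fin n → Finset (Vec p)}
    {σ : Fin n → State p} (h : LubyInv G K σ) (r : Fin n → Seed p) :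
    LubyInv G K (luby G σ r) := by
  classical
  obtain ⟨m, b, f, heq⟩ := luby_spec hG σ r
  have hnew : ∀ x y, NewLeader G σ r x → (σ y).leader = true → G.dist x y ≤ p.D → False :=
    fun x y hx hy hd => absurd (h.far x y hx.1 hy) (by omega)
  rw [heq]
  constructor
  · exact h.known_eq
  · exact h.inbox_eq
  · exact h.heard_eq
  · exact h.uid_inj
  · intro x y hx hy hd
    simp only [Bool.or_eq_true, decide_eq_true_eq] at hx hy
    rcases hx with hx | hx <;> rcases hy with hy | hy
    · exact h.indep x y hx hy hd
    · exact (hnew y x hy hx (by rwa [G.dist_comm])).elim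
    · exact (hnew x y hx hy hd).elim
    · exact drawn_eq_iff h.uid_inj hx.1 hy.1
        (le_antisymm (hy.2 x (by rwa [G.dist_comm])) (hx.2 y hd))
  · intro v x hv hx
    simp only [Bool.or_eq_true, Bool.and_eq_true, Bool.not_eq_true', decide_eq_true_eq,
      decide_eq_false_iff_not] at hv hx
    rcases hx with hx | hx
    · exact h.far v x hv.1 hx
    · by_contra hlt
      exact hv.2 ⟨x, by omega, hx⟩
  · intro v hv
    simp only [Bool.or_eq_true, decide_eq_true_eq]
    by_cases hn : ∃ u, G.dist v u ≤ p.D ∧ NewLeader G σ r u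
    · obtain ⟨u, h1, h2⟩ := hn
      exact ⟨u, Or.inr h2, h1⟩
    · simp only [hn, decide_false, Bool.not_false, Bool.and_true] at hv
      obtain ⟨x, h1, h2⟩ := h.near v hv
      exact ⟨x, Or.inl h1, h2⟩

theorem luby_active {G : SimpleGraph (Fin n)} (hG : G.Connected)
    (σ : Fin n → State p) (r : Fin n → Seed p) (v : Fin n) :
    (luby G σ r v).active = true ↔
      (σ v).active = true ∧ ∀ u, G.dist v u ≤ p.D → ¬ NewLeader G σ r u := by
  classical
  obtain ⟨m, b, f, heq⟩ := luby_spec hG σ r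
  rw [heq]
  simp

/-- Without conflicts, all nodes become inactive. -/
theorem luby_inactive_of_conflicts_eq_zero {G : SimpleGraph (Fin n)} (hG : G.Connected)
    (σ : Fin n → State p) (r : Fin n → Seed p) (h : conflicts G σ = 0) (v : Fin n) :
    (luby G σ r v).active = false := by
  rw [← Bool.not_eq_true, luby_active hG]
  rintro ⟨hv, hn⟩
  refine hn v (by simp) ⟨hv, fun u hu => ?_⟩
  by_cases huv : u = v
  · rw [huv]
  · have h1 := (Finset.sum_eq_zero_iff_of_nonneg fun _ _ => Nat.cast_nonneg _).1 h v
      (Finset.mem_univ v)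
    have h2 : rivals G σ v = ∅ := by exact_mod_cast Finset.card_eq_zero.1 (by exact_mod_cast h1)
    have h3 : (σ u).active = false := by
      by_contra h3
      have : u ∈ rivals G σ v := mem_rivals.2 ⟨huv, hu, hv, by simpa using h3⟩
      rw [h2] at this
      simp at this
    rw [drawn, h3]
    exact bot_le

/-- Node `u` beats all rivals of `u` and of `v`. -/
def Beats (G : SimpleGraph (Fin n)) (σ : Fin n → State p) (r : Fin n → Seed p) (u v : Fin n) :
    Prop :=
  ∀ w ∈ rivals G σ u ∪ rivals G σ v, w ≠ u → (r w).1 < (r u).1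

theorem newLeader_of_beats {G : SimpleGraph (Fin n)} {σ : Fin n → State p} {r : Fin n → Seed p}
    {u v : Fin n} (hu : (σ u).active = true) (h : Beats G σ r u v) : NewLeader G σ r u := by
  refine ⟨hu, fun w hw => ?_⟩
  by_cases hwu : w = u
  · rw [hwu]
  by_cases hact : (σ w).active = true
  · have h1 := h w (Finset.mem_union_left _ (mem_rivals.2 ⟨hwu, hw, hu, hact⟩)) hwu
    rw [drawn, drawn, if_pos hu, if_pos hact, WithBot.coe_le_coe]
    exact (Prod.Lex.toLex_le_toLex).2 (Or.inl h1)
  · rw [drawn, if_neg hact]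
    exact bot_le

open Classical in
-- Two rivals of `v` cannot both beat all rivals of `v`, so the inner sum is 0 or 1. If it is 1, the
-- winner becomes a leader and deactivates `v`, which thereby loses all its rivals.
theorem conflicts_luby_le {G : SimpleGraph (Fin n)} (hG : G.Connected)
    (σ : Fin n → State p) (r : Fin n → Seed p) :
    conflicts G (luby G σ r) ≤ ∑ v, ((rivals G σ v).card : ℝ) *
      (1 - ∑ u ∈ rivals G σ v, if Beats G σ r u v then (1 : ℝ) else 0) := by
  refine Finset.sum_le_sum fun v _ => ?_
  have hunique : ∀ u ∈ rivals G σ v, ∀ u' ∈ rivals G σ v, Beats G σ r u v → Beats G σ r u' v →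
      u = u' := by
    intro u hu u' hu' h h'
    by_contra hne
    exact lt_asymm (h u' (Finset.mem_union_right _ hu') (Ne.symm hne))
      (h' u (Finset.mem_union_right _ hu) hne)
  by_cases hb : ∃ u ∈ rivals G σ v, Beats G σ r u v
  · obtain ⟨u, hu, hbu⟩ := hb
    have h1 : (∑ u ∈ rivals G σ v, if Beats G σ r u v then (1 : ℝ) else 0) = 1 := by
      rw [Finset.sum_eq_single u, if_pos hbu]
      · intro u' hu' hne
        rw [if_neg]
        exact fun h => hne (hunique u' hu' u hu h hbu)
      · exact fun h => (h hu).elim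
    rw [h1, sub_self, mul_zero]
    have hact : (luby G σ r v).active = false := by
      rw [← Bool.not_eq_true, luby_active hG]
      rintro ⟨-, hn⟩
      exact hn u (mem_rivals.1 hu).2.1 (newLeader_of_beats (mem_rivals.1 hu).2.2.2 hbu)
    have : rivals G (luby G σ r) v = ∅ := by
      refine Finset.eq_empty_of_forall_notMem fun w hw => ?_
      rw [mem_rivals, hact] at hw
      simp at hw
    rw [this]
    simp
  · have h1 : (∑ u ∈ rivals G σ v, if Beats G σ r u v then (1 : ℝ) else 0) = 0 := by
      refine Finset.sum_eq_zero fun u hu => if_neg fun h => hb ⟨u, hu, h⟩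
    rw [h1, sub_zero, mul_one]
    refine Nat.cast_le.2 (Finset.card_le_card fun w hw => ?_)
    rw [mem_rivals, luby_active hG, luby_active hG] at hw
    exact mem_rivals.2 ⟨hw.1, hw.2.1, hw.2.2.1.1, hw.2.2.2.1⟩

/-- A rival u of v beats the at most d u + d v rivals of the two nodes with probability at least
1/(2(d u + d v)), and then d v ordered pairs vanish. The expected loss is thus at least half the sum
of d v/(d u + d v) over ordered pairs, which is a quarter of all pairs. -/
theorem expect_conflicts_luby_le {G : SimpleGraph (Fin n)} (hG : G.Connected)
    (σ : Fin n → State p) (hn : 2 * n ^ 2 ≤ p.prioRange) :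
    𝔼 r : Fin n → Seed p, conflicts G (luby G σ r) ≤ 3 / 4 * conflicts G σ := by
  classical
  set d : Fin n → ℝ := fun v => ((rivals G σ v).card : ℝ) with hd
  have hd0 : ∀ v, 0 ≤ d v := fun v => Nat.cast_nonneg _
  have hdpos : ∀ u v, u ∈ rivals G σ v → 0 < d v := fun u v h => by
    simp only [hd]
    exact_mod_cast Finset.card_pos.2 ⟨u, h⟩
  have hprob : ∀ v, ∀ u ∈ rivals G σ v, 1 / (2 * (d u + d v)) ≤
      𝔼 r : Fin n → Seed p, if Beats G σ r u v then (1 : ℝ) else 0 := by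
    intro v u hu
    have : NeZero p.prioRange := ⟨(Nat.pow_pos Nat.two_pos).ne'⟩
    have hmem : u ∈ rivals G σ u ∪ rivals G σ v := Finset.mem_union_right _ hu
    have hcard : (rivals G σ u ∪ rivals G σ v).card ≤ n :=
      (Finset.card_le_univ _).trans (Fintype.card_fin n).le
    have := expect_strictMax_ge (β := Vec p → ZMod 2) (m := p.prioRange) hmem
      (le_trans (Nat.mul_le_mul_left 2 (Nat.pow_le_pow_left hcard 2)) hn)
    refine le_trans ?_ (this.trans (Finset.expect_congr rfl fun r _ => by
      unfold Beats
      congr).le)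
    have h1 : ((rivals G σ u ∪ rivals G σ v).card : ℝ) ≤ d u + d v := by
      simp only [hd]
      exact_mod_cast Finset.card_union_le _ _
    have h2 : (0 : ℝ) < (rivals G σ u ∪ rivals G σ v).card := by
      exact_mod_cast Finset.card_pos.2 ⟨u, hmem⟩
    exact one_div_le_one_div_of_le (by positivity) (by linarith)
  -- Exchanging u and v does not change the sum, and the two versions of a summand add up to 1.
  have hpairs : ∑ v, ∑ u ∈ rivals G σ v, d v / (d u + d v) = 1 / 2 * conflicts G σ := by
    have hswap : ∑ v, ∑ u ∈ rivals G σ v, d v / (d u + d v)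
        = ∑ v, ∑ u ∈ rivals G σ v, d u / (d u + d v) := by
      rw [Finset.sum_comm' (s' := fun u => rivals G σ u) (t' := Finset.univ)]
      · refine Finset.sum_congr rfl fun v _ => Finset.sum_congr rfl fun u _ => ?_
        rw [add_comm]
      · intro u v
        simp [mem_rivals_comm (u := u)]
    have hadd : ∑ v, ∑ u ∈ rivals G σ v, d v / (d u + d v)
        + ∑ v, ∑ u ∈ rivals G σ v, d u / (d u + d v) = conflicts G σ := by
      rw [← Finset.sum_add_distrib]
      refine Finset.sum_congr rfl fun v _ => ?_
      rw [← Finset.sum_add_distrib, Finset.card_eq_sum_ones, Nat.cast_sum]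
      refine Finset.sum_congr rfl fun u hu => ?_
      have := hdpos u v hu
      have := hd0 u
      rw [← add_div, add_comm (d v), div_self (by positivity), Nat.cast_one]
    linarith
  calc 𝔼 r : Fin n → Seed p, conflicts G (luby G σ r)
      ≤ 𝔼 r : Fin n → Seed p, ∑ v, d v *
        (1 - ∑ u ∈ rivals G σ v, if Beats G σ r u v then (1 : ℝ) else 0) :=
        Finset.expect_le_expect fun r _ => conflicts_luby_le hG σ r
    _ = ∑ v, d v * (1 - ∑ u ∈ rivals G σ v,
          𝔼 r : Fin n → Seed p, if Beats G σ r u v then (1 : ℝ) else 0) := by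
        rw [Finset.expect_sum_comm]
        refine Finset.sum_congr rfl fun v _ => ?_
        rw [← Finset.mul_expect, Finset.expect_sub_distrib, Fintype.expect_const,
          Finset.expect_sum_comm]
    _ ≤ ∑ v, d v * (1 - ∑ u ∈ rivals G σ v, 1 / (2 * (d u + d v))) := by
        refine Finset.sum_le_sum fun v _ => mul_le_mul_of_nonneg_left ?_ (hd0 v)
        exact sub_le_sub_left (Finset.sum_le_sum fun u hu => hprob v u hu) _
    _ = ∑ v, (d v - 1 / 2 * ∑ u ∈ rivals G σ v, d v / (d u + d v)) := by
        refine Finset.sum_congr rfl fun v _ => ?_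
        rw [mul_sub, mul_one, Finset.mul_sum, Finset.mul_sum]
        congr 1
        refine Finset.sum_congr rfl fun u _ => ?_
        rw [one_div, mul_inv]
        ring
    _ = 3 / 4 * conflicts G σ := by
        rw [Finset.sum_sub_distrib, ← Finset.mul_sum, hpairs]
        change conflicts G σ - _ = _
        ring

/-- The expectation of `F` after `j` iterations of the independent set computation. -/
noncomputable def lubyE (G : SimpleGraph (Fin n)) (F : (Fin n → State p) → ℝ) :
    ℕ → (Fin n → State p) → ℝ
  | 0, σ => F σ
  | j + 1, σ => 𝔼 r : Fin n → Seed p, lubyE G F j (luby G σ r)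

theorem blockE_eq_lubyE (hD : 0 < p.D) (G : SimpleGraph (Fin n)) (F : (Fin n → State p) → ℝ)
    (j i : ℕ) (hij : i + (j + 1) = p.iters) (σ : Fin n → State p) :
    blockE G (2 * p.D * i) (2 * p.D * (j + 1)) F σ
      = lubyE G F (j + 1) fun v => if i = 0 then (σ v).reset else σ v := by
  induction j generalizing i σ with
  | zero =>
    rw [zero_add, mul_one, blockE_luby hD G (by omega)]
    rfl
  | succ j ih =>
    rw [show 2 * p.D * (j + 1 + 1) = 2 * p.D + 2 * p.D * (j + 1) by ring, blockE_add,
      blockE_luby hD G (by omega), lubyE]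
    refine Finset.expect_congr rfl fun r _ => ?_
    rw [show 2 * p.D * i + 2 * p.D = 2 * p.D * (i + 1) by ring, ih (i + 1) (by omega)]
    simp

/-- Markov's inequality: the conflicts left after j iterations bound the probability that there are
any. The last iteration contributes no factor 3/4, since it is spent on deactivating the nodes that
have become free of conflicts. -/
theorem lubyE_le {G : SimpleGraph (Fin n)} (hG : G.Connected) {F : (Fin n → State p) → ℝ}
    (hn : 2 * n ^ 2 ≤ p.prioRange) {K : Fin n → Finset (Vec p)} {M θ : ℝ} (hM : 0 ≤ M)
    (hθ : θ ≤ 1) (hF : ∀ σ, LubyInv G K σ → F σ ≤ M)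
    (hF' : ∀ σ, LubyInv G K σ → (∀ v, (σ v).active = false) → F σ ≤ θ * M) (j : ℕ)
    (σ : Fin n → State p) (hσ : LubyInv G K σ) :
    lubyE G F (j + 1) σ ≤ θ * M + (1 - θ) * M * ((3 / 4) ^ j * conflicts G σ) := by
  have hc : 0 ≤ (1 - θ) * M := mul_nonneg (by linarith) hM
  induction j generalizing σ with
  | zero =>
    rw [pow_zero, one_mul]
    refine Finset.expect_le Finset.univ_nonempty fun r _ => ?_
    change F (luby G σ r) ≤ _
    by_cases h0 : conflicts G σ = 0
    · rw [h0, mul_zero, add_zero]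
      exact hF' _ (hσ.luby hG r) (luby_inactive_of_conflicts_eq_zero hG σ r h0)
    · have h1 : 1 ≤ conflicts G σ := by
        have h2 : conflicts G σ = ((∑ v, (rivals G σ v).card : ℕ) : ℝ) := by
          rw [conflicts, Nat.cast_sum]
        rw [h2] at h0 ⊢
        have : (∑ v, (rivals G σ v).card) ≠ 0 := by exact_mod_cast h0
        exact_mod_cast Nat.one_le_iff_ne_zero.2 this
      have := hF _ (hσ.luby hG r)
      nlinarith [mul_le_mul_of_nonneg_left h1 hc]
  | succ j ih =>
    rw [lubyE]
    calc _ ≤ 𝔼 r : Fin n → Seed p,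
          (θ * M + (1 - θ) * M * ((3 / 4) ^ j * conflicts G (luby G σ r))) :=
          Finset.expect_le_expect fun r _ => ih _ (hσ.luby hG r)
      _ = θ * M + (1 - θ) * M * ((3 / 4) ^ j *
            𝔼 r : Fin n → Seed p, conflicts G (luby G σ r)) := by
          rw [Finset.expect_add_distrib, Fintype.expect_const, ← Finset.mul_expect,
            ← Finset.mul_expect]
      _ ≤ θ * M + (1 - θ) * M * ((3 / 4) ^ j * (3 / 4 * conflicts G σ)) := by
          gcongr
          exact expect_conflicts_luby_le hG σ hn
      _ = _ := by rw [pow_succ]; ring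

end PatchSharing

/-- A geodesic to x meets every distance level on the way. -/
theorem SimpleGraph.Connected.exists_dist_eq {V : Type} {G : SimpleGraph V} (hG : G.Connected)
    (x : V) (d : ℕ) (v : V) (hv : G.dist v x = d) (i : ℕ) (hi : i ≤ d) : ∃ w, G.dist w x = i := by
  induction d generalizing v with
  | zero => exact ⟨v, by omega⟩
  | succ d ih =>
    rcases hi.lt_or_eq with hlt | rfl
    · rcases (hG.dist_le_succ_iff v x d).1 hv.le with h | ⟨u, hu, h⟩
      · omega
      · refine ih u ?_ (by omega)
        by_contra hne
        have : G.dist v x ≤ d := by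
          obtain ⟨d, rfl⟩ : ∃ e, d = e + 1 := ⟨d - 1, by omega⟩
          exact (hG.dist_le_succ_iff v x d).2 (Or.inr ⟨u, hu, by omega⟩)
        omega
    · exact ⟨v, hv⟩

namespace PatchSharing

variable {p : Params} {n : ℕ}

/-! ### The effect of a meta round on the received vectors -/

/-- The random sum of a set of nodes that have received the vectors `K`. -/
def randomSum (K : Fin n → Finset (Vec p)) (A : Finset (Fin n)) (r : Fin n → Seed p) : Vec p :=
  ∑ u ∈ A, combination (K u) (r u).2

open Classical in
/-- The received vectors after a share step. -/
noncomputable def shareKnown (dep : Fin n → Option ℕ) (par : Fin n → Fin n)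
    (K : Fin n → Finset (Vec p)) (r : Fin n → Seed p) (v : Fin n) : Finset (Vec p) :=
  if (dep v).isSome then insert (randomSum K (patch dep par (root dep par v)) r) (K v) else K v

open Classical in
/-- The received vectors after a share step and a pass step. -/
noncomputable def passKnown (G : SimpleGraph (Fin n)) (dep : Fin n → Option ℕ)
    (par : Fin n → Fin n) (K : Fin n → Finset (Vec p)) (r : Fin n → Seed p) (v : Fin n) :
    Finset (Vec p) :=
  shareKnown dep par K r v ∪ (Finset.univ.filter fun u => G.Adj v u ∧ (dep u).isSome).image
    fun u => randomSum K (patch dep par (root dep par u)) r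

theorem subset_shareKnown (dep : Fin n → Option ℕ) (par : Fin n → Fin n)
    (K : Fin n → Finset (Vec p)) (r : Fin n → Seed p) (v : Fin n) :
    K v ⊆ shareKnown dep par K r v := by
  rw [shareKnown]
  split_ifs
  · exact Finset.subset_insert _ _
  · exact subset_rfl

theorem subset_passKnown (G : SimpleGraph (Fin n)) (dep : Fin n → Option ℕ) (par : Fin n → Fin n)
    (K : Fin n → Finset (Vec p)) (r : Fin n → Seed p) (v : Fin n) :
    K v ⊆ passKnown G dep par K r v := by
  classical
  exact (subset_shareKnown dep par K r v).trans Finset.subset_union_left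

/-- The part of a meta round after the independent set computation. -/
theorem blockE_of_treeStart (hD : 0 < p.D) (hi : 0 < p.iters) {G : SimpleGraph (Fin n)}
    (hG : G.Connected) {K : Fin n → Finset (Vec p)} {σ : Fin n → State p} (hσ : LubyInv G K σ) :
    ∃ (dep : Fin n → Option ℕ) (prt : Fin n → Option (Fin p.U)) (par : Fin n → Fin n),
      TreeInv G (fun v => (σ v).uid) (fun v => (σ v).leader) dep prt p.D ∧
      Forest p.D G (fun v => (σ v).uid) (fun v => (σ v).leader) dep prt par ∧
      ∀ f : (Fin n → Finset (Vec p)) → ℝ,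
        blockE G p.treeStart (p.T - p.treeStart) (fun σ => f fun v => (σ v).known) σ
          = 𝔼 r : Fin n → Seed p, 𝔼 r' : Fin n → Seed p,
            f (shareKnown dep par (passKnown G dep par K r) r') := by
  classical
  obtain rfl : K = fun v => (σ v).known := funext fun v => (hσ.known_eq v).symm
  obtain ⟨dep, prt, htree, hI⟩ := commSeq_tree hG σ p.D
  obtain ⟨par, hF⟩ := hI.exists_forest hσ.uid_inj
  refine ⟨dep, prt, par, hI, hF, fun f => ?_⟩
  have hS := Params.S_pos hD
  have hE := Params.E_eq hD
  have hle := Params.idleStart_le hD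
  have hup₁ : p.up₁ = p.treeStart + p.D := rfl
  have hdown₁ : p.down₁ = p.up₁ + p.E := rfl
  have hpass : p.passStart = p.down₁ + p.E := rfl
  have hup₂ : p.up₂ = p.passStart + p.S := rfl
  have hdown₂ : p.down₂ = p.up₂ + p.E := rfl
  have hidle : p.idleStart = p.down₂ + p.E := rfl
  rw [show p.T - p.treeStart = p.D + ((p.E + p.E) + (p.S + ((p.E + p.E) + (p.T - p.idleStart))))
    by omega]
  rw [blockE_add, blockE_tree hD hi, htree, ← hup₁, blockE_add, blockE_share hD G (Or.inl rfl)]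
  refine Finset.expect_congr rfl fun r _ => ?_
  obtain ⟨a, y, h1, h2⟩ := share_spec hD G
    (fun v => { σ v with depth := dep v, parent := prt v }) par hF r
  have h1' : share G (fun v => { σ v with depth := dep v, parent := prt v }) r
      = fun v => { σ v with
        depth := dep v
        parent := prt v
        acc := a v
        sum := y v
        known := shareKnown dep par (fun v => (σ v).known) r v } := h1
  rw [h1', show p.up₁ + (p.E + p.E) = p.passStart by omega, blockE_add, blockE_pass hD,
    show p.passStart + p.S = p.up₂ from rfl, blockE_add]
  obtain ⟨inb, hd, h3⟩ := commSeq_pass G (fun v => { σ v with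
      depth := dep v
      parent := prt v
      acc := a v
      sum := y v
      known := shareKnown dep par (fun v => (σ v).known) r v }) hσ.uid_inj hS hσ.inbox_eq hσ.heard_eq
  have himg : ∀ v, (Finset.univ.filter fun u => G.Adj v u ∧ (dep u).isSome).image y
      = (Finset.univ.filter fun u => G.Adj v u ∧ (dep u).isSome).image
        fun u => randomSum (fun v => (σ v).known) (patch dep par (root dep par u)) r := by
    intro v
    refine Finset.image_congr fun u hu => ?_
    simp only [Finset.coe_filter, Finset.mem_univ, true_and, Set.mem_ofPred_eq] at hu
    exact h2 u hu.2
  have h3' : commSeq G .pass (fun v => { σ v with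
      depth := dep v
      parent := prt v
      acc := a v
      sum := y v
      known := shareKnown dep par (fun v => (σ v).known) r v }) p.S = fun v => { σ v with
      depth := dep v
      parent := prt v
      acc := a v
      sum := y v
      inbox := inb v
      heard := hd v
      known := passKnown G dep par (fun v => (σ v).known) r v } := by
    rw [h3]
    funext v
    simp only [passKnown, ← himg v]
  have h4 := blockE_share hD G (Or.inr rfl : p.up₂ = p.up₁ ∨ p.up₂ = p.up₂)
    (blockE G (p.up₂ + (p.E + p.E)) (p.T - p.idleStart) fun σ => f fun v => (σ v).known)
    (fun v => { σ v with
      depth := dep v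
      parent := prt v
      acc := a v
      sum := y v
      inbox := inb v
      heard := hd v
      known := passKnown G dep par (fun v => (σ v).known) r v })
  refine Eq.trans (congrArg _ h3') (h4.trans ?_)
  refine Finset.expect_congr rfl fun r' _ => ?_
  rw [show p.up₂ + (p.E + p.E) = p.idleStart by omega, blockE_idle hD]
  congr 1
  obtain ⟨a', y', h5, -⟩ := share_spec hD G (fun v => { σ v with
      depth := dep v
      parent := prt v
      acc := a v
      sum := y v
      inbox := inb v
      heard := hd v
      known := passKnown G dep par (fun v => (σ v).known) r v }) par hF r'
  rw [h5]
  rfl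

/-! ### Sensing -/

/-- A random sum over nodes of which one has received a vector outside the kernel of `φ` is outside
the kernel with probability one half. -/
theorem expect_randomSum_eq_zero (φ : Vec p →ₗ[ZMod 2] ZMod 2) (K : Fin n → Finset (Vec p))
    (A : Finset (Fin n)) {u : Fin n} (hu : u ∈ A) {x : Vec p} (hx : x ∈ K u) (hφ : φ x ≠ 0) :
    𝔼 r : Fin n → Seed p, (if φ (randomSum K A r) = 0 then (1 : ℝ) else 0) = 1 / 2 := by
  classical
  -- Toggling the coefficient of `x` at node `u` is an involution of the seeds that adds `x` to the
  -- random sum and so flips φ of it. Zero and nonzero are therefore equally likely.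
  set δ : Fin n → Vec p → ZMod 2 := fun w => if w = u then Pi.single x 1 else 0 with hδ
  have hinv : ∀ a : Vec p → ZMod 2, ∀ w, a + δ w + δ w = a := by
    intro a w
    rw [add_assoc]
    funext y
    simp [CharTwo.add_self_eq_zero]
  let e : (Fin n → Seed p) ≃ (Fin n → Seed p) :=
    { toFun := fun r w => ((r w).1, (r w).2 + δ w)
      invFun := fun r w => ((r w).1, (r w).2 + δ w)
      left_inv := fun r => by
        funext w
        exact Prod.ext rfl (hinv _ w)
      right_inv := fun r => by
        funext w
        exact Prod.ext rfl (hinv _ w) }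
  have hsum : ∀ r, randomSum K A (e r) = randomSum K A r + x := by
    intro r
    have h1 : ∀ w, combination (K w) (e r w).2
        = combination (K w) (r w).2 + if w = u then x else 0 := by
      intro w
      have h0 : (e r w).2 = (r w).2 + δ w := rfl
      rw [h0]
      simp only [combination, Pi.add_apply, add_smul, Finset.sum_add_distrib]
      congr 1
      simp only [hδ]
      split_ifs with h
      · subst h
        rw [Finset.sum_eq_single x]
        · simp
        · intro y _ hy
          simp [hy]
        · exact fun h => (h hx).elim
      · simp
    simp only [randomSum, h1, Finset.sum_add_distrib]
    rw [Finset.sum_ite_eq', if_pos hu]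
  have h2 : 𝔼 r : Fin n → Seed p, (if φ (randomSum K A r) = 0 then (1 : ℝ) else 0)
      = 𝔼 r : Fin n → Seed p, (if φ (randomSum K A (e r)) = 0 then (1 : ℝ) else 0) :=
    (Fintype.expect_equiv e _ _ fun r => rfl).symm
  have h3 : 𝔼 r : Fin n → Seed p, (if φ (randomSum K A r) = 0 then (1 : ℝ) else 0)
      + 𝔼 r : Fin n → Seed p, (if φ (randomSum K A (e r)) = 0 then (1 : ℝ) else 0) = 1 := by
    rw [← Finset.expect_add_distrib]
    refine Eq.trans (Finset.expect_congr rfl fun r _ => ?_) (Fintype.expect_const (1 : ℝ))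
    rw [hsum, map_add]
    generalize φ (randomSum K A r) = α at *
    generalize φ x = β at *
    have : ∀ α β : ZMod 2, β ≠ 0 → ((α = 0 ∧ α + β ≠ 0) ∨ (α ≠ 0 ∧ α + β = 0)) := by decide
    rcases this α β hφ with ⟨h, h'⟩ | ⟨h, h'⟩
    · rw [if_pos h, if_neg h', add_zero]
    · rw [if_neg h, if_pos h', zero_add]
  linarith

/-- A node with received vectors `K` senses `φ` if one of the vectors is outside the kernel. -/
def Senses (φ : Vec p →ₗ[ZMod 2] ZMod 2) (K : Finset (Vec p)) : Prop := ∃ x ∈ K, φ x ≠ 0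

theorem Senses.mono {φ : Vec p →ₗ[ZMod 2] ZMod 2} {K K' : Finset (Vec p)} (h : Senses φ K)
    (hK : K ⊆ K') : Senses φ K' := by
  obtain ⟨x, hx, h⟩ := h
  exact ⟨x, hK hx, h⟩

open Classical in
/-- The nodes that do not sense `φ`. -/
noncomputable def ignorant (φ : Vec p →ₗ[ZMod 2] ZMod 2) (K : Fin n → Finset (Vec p)) :
    Finset (Fin n) :=
  Finset.univ.filter fun v => ¬ Senses φ (K v)

theorem mem_ignorant {φ : Vec p →ₗ[ZMod 2] ZMod 2} {K : Fin n → Finset (Vec p)} {v : Fin n} :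
    v ∈ ignorant φ K ↔ ¬ Senses φ (K v) := by
  simp [ignorant]

theorem ignorant_anti {φ : Vec p →ₗ[ZMod 2] ZMod 2} {K K' : Fin n → Finset (Vec p)}
    (h : ∀ v, K v ⊆ K' v) : ignorant φ K' ⊆ ignorant φ K := by
  intro v
  rw [mem_ignorant, mem_ignorant]
  exact mt fun hv => hv.mono (h v)

/-- The weight of `x` nodes that do not sense a functional, for patches of at least `d` nodes. -/
noncomputable def weight (d x : ℕ) : ℝ := x * 2 ^ (x / d)

theorem weight_nonneg (d x : ℕ) : 0 ≤ weight d x := by rw [weight]; positivity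

theorem weight_mono (d : ℕ) {x y : ℕ} (h : x ≤ y) : weight d x ≤ weight d y := by
  rw [weight, weight]
  gcongr
  norm_num

theorem one_le_weight (d : ℕ) {x : ℕ} (h : 0 < x) : 1 ≤ weight d x := by
  have h1 : (1 : ℝ) ≤ x := by exact_mod_cast h
  have h2 : (1 : ℝ) ≤ 2 ^ (x / d) := one_le_pow₀ (by norm_num)
  rw [weight]
  nlinarith

/-- Losing d nodes lowers the exponent ⌊·/d⌋ by at least one. -/
theorem weight_le_half {d x y : ℕ} (hd : 0 < d) (h : x + d ≤ y) :
    weight d x ≤ weight d y / 2 := by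
  have h1 : x / d + 1 ≤ y / d := by
    rw [← Nat.add_div_right x hd]
    exact Nat.div_le_div_right h
  have h2 : (2 : ℝ) ^ (x / d) * 2 ≤ 2 ^ (y / d) := by
    rw [← pow_succ]
    exact pow_le_pow_right₀ (by norm_num) h1
  have h3 : (x : ℝ) ≤ y := by exact_mod_cast (by omega : x ≤ y)
  have h4 : (0 : ℝ) ≤ x := Nat.cast_nonneg x
  have h5 : (0 : ℝ) ≤ 2 ^ (x / d) := by positivity
  rw [weight, weight, le_div_iff₀ (by norm_num), mul_assoc]
  exact mul_le_mul h3 h2 (by positivity) (by linarith)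

/-- The lower bound for the number of nodes of a patch. -/
def Params.minPatch (p : Params) : ℕ := p.D / 2 + 1

/-- A geodesic from a second leader to x has a node at each distance i ≤ D/2 from x. Such a node has
depth at most D/2, so its root is within distance D of x and must be x by independence. -/
theorem card_patch_ge {G : SimpleGraph (Fin n)} (hG : G.Connected)
    {uid : Fin n → Fin p.U} {ldr : Fin n → Bool} {dep : Fin n → Option ℕ}
    {prt : Fin n → Option (Fin p.U)} {par : Fin n → Fin n}
    (hI : TreeInv G uid ldr dep prt p.D) (hF : Forest p.D G uid ldr dep prt par)
    (hindep : ∀ x y, ldr x = true → ldr y = true → G.dist x y ≤ p.D → x = y)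
    {x y : Fin n} (hx : ldr x = true) (hy : ldr y = true) (hxy : y ≠ x) :
    p.minPatch ≤ (patch dep par x).card := by
  have hd : p.D < G.dist y x := by
    by_contra h
    exact hxy (hindep y x hy hx (by omega))
  have hsub : Finset.range p.minPatch ⊆ (patch dep par x).image fun w => G.dist w x := by
    intro i hi
    have hi' : i < p.D / 2 + 1 := Finset.mem_range.1 hi
    obtain ⟨w, hw⟩ := hG.exists_dist_eq x _ y rfl i (by omega)
    refine Finset.mem_image.2 ⟨w, ?_, hw⟩
    obtain ⟨δ, hδ, hle⟩ := hI.cover w x hx (by omega)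
    obtain ⟨h1, h2⟩ := hF.root_spec hG δ w hδ
    have h3 := hG.dist_triangle (u := root dep par w) (v := w) (w := x)
    rw [G.dist_comm (u := root dep par w) (v := w)] at h3
    have := hindep _ x ((hF.zero_iff _).1 h1) hx (by omega)
    simp [patch, hδ, this]
  calc p.minPatch = (Finset.range p.minPatch).card := (Finset.card_range _).symm
    _ ≤ _ := Finset.card_le_card hsub
    _ ≤ _ := Finset.card_image_le

theorem senses_shareKnown {φ : Vec p →ₗ[ZMod 2] ZMod 2} {dep : Fin n → Option ℕ}
    {par : Fin n → Fin n} {K : Fin n → Finset (Vec p)} {r : Fin n → Seed p} {v : Fin n}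
    (hv : (dep v).isSome)
    (h : φ (randomSum K (patch dep par (root dep par v)) r) ≠ 0) :
    Senses φ (shareKnown dep par K r v) := by
  classical
  refine ⟨_, ?_, h⟩
  rw [shareKnown, if_pos hv]
  exact Finset.mem_insert_self _ _

/-- The expected progress in a meta round, if every node is in a patch. -/
theorem expect_weight_le {G : SimpleGraph (Fin n)} (hG : G.Connected)
    {uid : Fin n → Fin p.U} {ldr : Fin n → Bool} {dep : Fin n → Option ℕ}
    {prt : Fin n → Option (Fin p.U)} {par : Fin n → Fin n}
    (hI : TreeInv G uid ldr dep prt p.D) (hF : Forest p.D G uid ldr dep prt par)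
    (hindep : ∀ x y, ldr x = true → ldr y = true → G.dist x y ≤ p.D → x = y)
    (hall : ∀ v, (dep v).isSome) (φ : Vec p →ₗ[ZMod 2] ZMod 2) (K : Fin n → Finset (Vec p))
    (hK : ∃ v, Senses φ (K v)) :
    𝔼 r : Fin n → Seed p, 𝔼 r' : Fin n → Seed p, weight p.minPatch
        (ignorant φ (shareKnown dep par (passKnown G dep par K r) r')).card
      ≤ 7 / 8 * weight p.minPatch (ignorant φ K).card := by
  classical
  set P := weight p.minPatch (ignorant φ K).card with hP
  have hP0 : 0 ≤ P := weight_nonneg _ _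
  have hself : ∀ v, v ∈ patch dep par (root dep par v) := fun v => by simp [patch, hall v]
  have hmono : ∀ r r' v, K v ⊆ shareKnown dep par (passKnown G dep par K r) r' v := fun r r' v =>
    (subset_passKnown G dep par K r v).trans (subset_shareKnown _ _ _ _ _)
  -- If every patch already contains a sensing node, the second share step alone suffices:
  -- conditionally on the first share, each ignorant node stays ignorant with probability at most
  -- 1/2.
  by_cases hC : ∀ v, ∃ u ∈ patch dep par (root dep par v), Senses φ (K u)
  · have hhalf : ∀ r, 𝔼 r' : Fin n → Seed p, weight p.minPatch
        (ignorant φ (shareKnown dep par (passKnown G dep par K r) r')).card ≤ 1 / 2 * P := by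
      intro r
      set K' := passKnown G dep par K r with hK'
      calc 𝔼 r' : Fin n → Seed p, weight p.minPatch (ignorant φ (shareKnown dep par K' r')).card
          ≤ 𝔼 r' : Fin n → Seed p, 2 ^ ((ignorant φ K).card / p.minPatch) *
              ∑ v ∈ ignorant φ K,
                if φ (randomSum K' (patch dep par (root dep par v)) r') = 0 then (1 : ℝ) else 0 := by
            refine Finset.expect_le_expect fun r' _ => ?_
            have hcard : ((ignorant φ (shareKnown dep par K' r')).card : ℝ) ≤ ∑ v ∈ ignorant φ K,
                if φ (randomSum K' (patch dep par (root dep par v)) r') = 0 then (1 : ℝ)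
                else 0 := by
              rw [Finset.card_eq_sum_ones, Nat.cast_sum, Nat.cast_one, ← Finset.sum_filter]
              refine Finset.sum_le_sum_of_subset_of_nonneg (fun v hv => ?_)
                fun _ _ _ => zero_le_one
              refine Finset.mem_filter.2 ⟨ignorant_anti (hmono r r') hv, ?_⟩
              by_contra hne
              exact mem_ignorant.1 hv (senses_shareKnown (hall v) hne)
            have hpow : (2 : ℝ) ^ ((ignorant φ (shareKnown dep par K' r')).card / p.minPatch)
                ≤ 2 ^ ((ignorant φ K).card / p.minPatch) :=
              pow_le_pow_right₀ (by norm_num) (Nat.div_le_div_right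
                (Finset.card_le_card (ignorant_anti (hmono r r'))))
            rw [weight, mul_comm]
            exact mul_le_mul hpow hcard (Nat.cast_nonneg _) (by positivity)
        _ = 1 / 2 * P := by
            rw [← Finset.mul_expect, Finset.expect_sum_comm]
            have : ∀ v ∈ ignorant φ K, 𝔼 r' : Fin n → Seed p,
                (if φ (randomSum K' (patch dep par (root dep par v)) r') = 0 then (1 : ℝ) else 0)
                = 1 / 2 := by
              intro v _
              obtain ⟨u, hu, hs⟩ := hC v
              obtain ⟨x, hx, hφ⟩ := hs.mono (subset_passKnown G dep par K r u)
              exact expect_randomSum_eq_zero φ K' _ hu hx hφ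
            rw [Finset.sum_congr rfl this, Finset.sum_const, nsmul_eq_mul, hP, weight]
            ring
    calc _ ≤ 𝔼 _r : Fin n → Seed p, 1 / 2 * P := Finset.expect_le_expect fun r _ => hhalf r
      _ = 1 / 2 * P := Fintype.expect_const _
      _ ≤ _ := by linarith
  -- Otherwise a walk from a sensing node to a patch without one crosses an edge a–z at which the
  -- property fails first. The patches of a and z are different, so there are two leaders and the
  -- size bound applies to the patch of z.
  · push Not at hC
    obtain ⟨z₀, hz₀⟩ := hC
    obtain ⟨a₀, ha₀⟩ := hK
    obtain ⟨q⟩ := hG.preconnected a₀ z₀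
    obtain ⟨d, -, hda, hdz⟩ := q.exists_boundary_dart
      {v | ∃ u ∈ patch dep par (root dep par v), Senses φ (K u)} ⟨a₀, hself a₀, ha₀⟩ (by
        rintro ⟨u, hu, hs⟩
        exact hz₀ u hu hs)
    obtain ⟨⟨a, z⟩, hadj⟩ := d
    simp only [Set.mem_ofPred_eq] at hda hdz
    have hzQ : ∀ u ∈ patch dep par (root dep par z), ¬ Senses φ (K u) :=
      fun u hu hs => hdz ⟨u, hu, hs⟩
    have hroot : ∀ v, ldr (root dep par v) = true := by
      intro v
      obtain ⟨δ, hδ⟩ := Option.isSome_iff_exists.1 (hall v)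
      exact (hF.zero_iff _).1 (hF.root_spec hG δ v hδ).1
    have hne : root dep par a ≠ root dep par z := by
      intro he
      obtain ⟨u, hu, hs⟩ := hda
      rw [he] at hu
      exact hzQ u hu hs
    have hsize := card_patch_ge hG hI hF hindep (hroot z) (hroot a) hne
    obtain ⟨u, hu, x, hx, hφ⟩ := hda
    -- If the first share gives a's patch a sum outside the kernel, the pass hands it to z, and the
    -- second share succeeds for the whole patch of z with probability 1/2, halving the weight: 1/2
    -- + 1/4 = 3/4. Averaging over the first share gives (3/4 + 1)/2 = 7/8.
    have hinner : ∀ r, 𝔼 r' : Fin n → Seed p, weight p.minPatch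
        (ignorant φ (shareKnown dep par (passKnown G dep par K r) r')).card
        ≤ 3 / 4 * P + 1 / 4 * P *
          if φ (randomSum K (patch dep par (root dep par a)) r) = 0 then (1 : ℝ) else 0 := by
      intro r
      set K' := passKnown G dep par K r with hK'
      split_ifs with h
      · have : 𝔼 r' : Fin n → Seed p, weight p.minPatch
            (ignorant φ (shareKnown dep par K' r')).card ≤ P :=
          Finset.expect_le Finset.univ_nonempty fun r' _ =>
            weight_mono _ (Finset.card_le_card (ignorant_anti (hmono r r')))
        linarith
      · have hz : ∃ x ∈ K' z, φ x ≠ 0 := by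
          refine ⟨_, ?_, h⟩
          rw [hK', passKnown]
          refine Finset.mem_union_right _ (Finset.mem_image.2 ⟨a, ?_, rfl⟩)
          simp [hadj.symm, hall a]
        obtain ⟨x', hx', hφ'⟩ := hz
        have hhalf := expect_randomSum_eq_zero φ K' _ (hself z) hx' hφ'
        calc 𝔼 r' : Fin n → Seed p, weight p.minPatch (ignorant φ (shareKnown dep par K' r')).card
            ≤ 𝔼 r' : Fin n → Seed p, (1 / 2 * P + 1 / 2 * P *
                if φ (randomSum K' (patch dep par (root dep par z)) r') = 0 then (1 : ℝ)
                else 0) := by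
              refine Finset.expect_le_expect fun r' _ => ?_
              split_ifs with h'
              · have : weight p.minPatch (ignorant φ (shareKnown dep par K' r')).card ≤ P :=
                  weight_mono _ (Finset.card_le_card (ignorant_anti (hmono r r')))
                linarith
              · have hdisj : Disjoint (ignorant φ (shareKnown dep par K' r'))
                    (patch dep par (root dep par z)) := by
                  rw [Finset.disjoint_left]
                  intro v hv hvQ
                  refine mem_ignorant.1 hv (senses_shareKnown (hall v) ?_)
                  simp only [patch, Finset.mem_filter] at hvQ
                  rwa [hvQ.2.2]
                have hunion : ignorant φ (shareKnown dep par K' r') ∪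
                    patch dep par (root dep par z) ⊆ ignorant φ K :=
                  Finset.union_subset (ignorant_anti (hmono r r'))
                    fun v hv => mem_ignorant.2 (hzQ v hv)
                have hcard := Finset.card_le_card hunion
                rw [Finset.card_union_of_disjoint hdisj] at hcard
                have := weight_le_half (d := p.minPatch) (Nat.succ_pos _)
                  (le_trans (Nat.add_le_add_left hsize _) hcard)
                linarith
          _ = 3 / 4 * P := by
              rw [Finset.expect_add_distrib, Fintype.expect_const, ← Finset.mul_expect, hhalf]
              ring
          _ = _ := by ring
    calc _ ≤ 𝔼 r : Fin n → Seed p, (3 / 4 * P + 1 / 4 * P *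
          if φ (randomSum K (patch dep par (root dep par a)) r) = 0 then (1 : ℝ) else 0) :=
        Finset.expect_le_expect fun r _ => hinner r
      _ = 7 / 8 * P := by
        rw [Finset.expect_add_distrib, Fintype.expect_const, ← Finset.mul_expect,
          expect_randomSum_eq_zero φ K _ hu hx hφ]
        ring

end PatchSharing

namespace PatchSharing

variable {p : Params} {n : ℕ}

/-! ### The progress in a meta round -/

/-- The bound θM needs every node in a patch. This fails with probability at most 1/2, by `hL` and
the n² bound on the initial conflicts, and then the trivial bound M applies. -/
theorem blockE_le_of_pos (hD : 0 < p.D) (hi : 0 < p.iters) (hn : 2 * n ^ 2 ≤ p.prioRange)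
    (hL : (3 / 4 : ℝ) ^ (p.iters - 1) * (n : ℝ) ^ 2 ≤ 1 / 2) {G : SimpleGraph (Fin n)}
    (hG : G.Connected) (σ : Fin n → State p) (huid : Function.Injective fun v => (σ v).uid)
    (f : (Fin n → Finset (Vec p)) → ℝ) {M θ : ℝ} (hM : 0 ≤ M) (hθ : θ ≤ 1)
    (hf : ∀ (dep : Fin n → Option ℕ) (par : Fin n → Fin n) (r r' : Fin n → Seed p),
      f (shareKnown dep par (passKnown G dep par (fun v => (σ v).known) r) r') ≤ M)
    (hf' : ∀ (uid : Fin n → Fin p.U) (ldr : Fin n → Bool) (dep : Fin n → Option ℕ)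
      (prt : Fin n → Option (Fin p.U)) (par : Fin n → Fin n), TreeInv G uid ldr dep prt p.D →
      Forest p.D G uid ldr dep prt par →
      (∀ x y, ldr x = true → ldr y = true → G.dist x y ≤ p.D → x = y) →
      (∀ v, (dep v).isSome) →
      𝔼 r : Fin n → Seed p, 𝔼 r' : Fin n → Seed p,
        f (shareKnown dep par (passKnown G dep par (fun v => (σ v).known) r) r') ≤ θ * M) :
    blockE G 0 p.T (fun σ => f fun v => (σ v).known) σ ≤ (θ + (1 - θ) / 2) * M := by
  set F : (Fin n → State p) → ℝ :=
    blockE G p.treeStart (p.T - p.treeStart) (fun σ => f fun v => (σ v).known) with hF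
  have hle : p.treeStart ≤ p.T := by
    refine le_trans ?_ (Params.idleStart_le hD)
    simp only [Params.idleStart, Params.down₂, Params.up₂, Params.passStart, Params.down₁,
      Params.up₁]
    omega
  have h1 : blockE G 0 p.T (fun σ => f fun v => (σ v).known) σ = blockE G 0 p.treeStart F σ := by
    have := blockE_add G 0 p.treeStart (p.T - p.treeStart) (fun σ => f fun v => (σ v).known) σ
    rwa [Nat.add_sub_cancel' hle, zero_add] at this
  obtain ⟨j, hj⟩ : ∃ j, p.iters = j + 1 := ⟨p.iters - 1, by omega⟩
  have h2 := blockE_eq_lubyE hD G F j 0 (by omega) σ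
  rw [mul_zero, ← hj] at h2
  have h3 := lubyE_le hG (F := F) hn hM hθ
    (fun σ' hσ' => by
      obtain ⟨dep, prt, par, -, -, h⟩ := blockE_of_treeStart hD hi hG hσ'
      rw [hF, h f]
      exact Finset.expect_le Finset.univ_nonempty fun r _ =>
        Finset.expect_le Finset.univ_nonempty fun r' _ => hf dep par r r')
    (fun σ' hσ' hact => by
      obtain ⟨dep, prt, par, hI, hFo, h⟩ := blockE_of_treeStart hD hi hG hσ'
      rw [hF, h f]
      refine hf' _ _ dep prt par hI hFo hσ'.indep fun v => ?_
      obtain ⟨x, hx, hd⟩ := hσ'.near v (hact v)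
      obtain ⟨δ, hδ, -⟩ := hI.cover v x hx hd
      simp [hδ])
    j _ (LubyInv.reset hD G σ huid)
  rw [h1, Params.treeStart, h2]
  simp only [if_true]
  rw [hj]
  refine h3.trans ?_
  have h4 : (3 / 4 : ℝ) ^ j * conflicts G (fun v => (σ v).reset) ≤ 1 / 2 := by
    refine le_trans ?_ hL
    rw [hj, Nat.add_sub_cancel]
    exact mul_le_mul_of_nonneg_left (conflicts_le _ _) (by positivity)
  have h5 : 0 ≤ (1 - θ) * M := mul_nonneg (by linarith) hM
  nlinarith [mul_le_mul_of_nonneg_left h4 h5]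

open Classical in
/-- The received vectors after a meta round in which the patches are single nodes. -/
noncomputable def singleKnown (G : SimpleGraph (Fin n)) (K : Fin n → Finset (Vec p))
    (r : Fin n → Seed p) (v : Fin n) : Finset (Vec p) :=
  K v ∪ (Finset.univ.filter fun u => G.Adj v u).image fun u => randomSum K {u} r

/-- For D = 0 the starts of all phases up to passing coincide at round 0. There `prepare` makes
every node a leader with its own random combination as the sum of its patch, and all T rounds are
spent passing it. -/
theorem blockE_of_D_eq_zero (hD : p.D = 0) (hT : 0 < p.T) (G : SimpleGraph (Fin n))
    (σ : Fin n → State p) (huid : Function.Injective fun v => (σ v).uid)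
    (f : (Fin n → Finset (Vec p)) → ℝ) :
    blockE G 0 p.T (fun σ => f fun v => (σ v).known) σ
      = 𝔼 r : Fin n → Seed p, f (singleKnown G (fun v => (σ v).known) r) := by
  classical
  have hts : p.treeStart = 0 := by simp [Params.treeStart, hD]
  have hE : p.E = 0 := by simp [Params.E, hD]
  have hS : p.S = p.T := by simp [Params.S, hD]
  have hup₁ : p.up₁ = 0 := by simp [Params.up₁, hts, hD]
  have hdown₁ : p.down₁ = 0 := by simp [Params.down₁, hup₁, hE]
  have hpass : p.passStart = 0 := by simp [Params.passStart, hdown₁, hE]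
  have hup₂ : p.up₂ = p.T := by simp [Params.up₂, hpass, hS]
  have hdown₂ : p.down₂ = p.T := by simp [Params.down₂, hup₂, hE]
  rw [blockE_stage G 0 p.T .pass hT]
  · refine Finset.expect_congr rfl fun r _ => ?_
    have hprep : prep 0 r σ = fun v => { σ v with
        active := true
        leader := true
        inbox := 0
        heard := ∅
        depth := some 0
        parent := none
        acc := combination (σ v).known (r v).2
        sum := combination (σ v).known (r v).2 } := by
      funext v
      simp [prep, prepare, hts, hup₁, hdown₁, hD, State.reset, State.plant, State.startUp,
        State.startDown]
    obtain ⟨inb, hd, h⟩ := commSeq_pass G (prep 0 r σ) (by rw [hprep]; exact huid)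
      (by rw [hS]; exact hT) (by rw [hprep]; intro v; rfl) (by rw [hprep]; intro v; rfl)
    rw [hS] at h
    rw [h, hprep]
    congr 1
    funext v
    simp [singleKnown, randomSum]
  · intro j hj
    rw [zero_add, phase, hts, hup₁, hdown₁, hpass, hup₂]
    simp [hj]
  · intro j h0 hj r st
    rw [zero_add, prepare_of_le h0 (by omega)]
    simp only
    rw [if_neg (by omega), if_neg (by omega), if_neg (by omega)]

/-- For d = 1 one newly sensing node halves the weight, and an edge between a sensing and an
ignorant node provides one with probability 1/2. -/
theorem expect_weight_singleKnown_le {G : SimpleGraph (Fin n)} (hG : G.Connected)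
    (φ : Vec p →ₗ[ZMod 2] ZMod 2) (K : Fin n → Finset (Vec p)) (hK : ∃ v, Senses φ (K v)) :
    𝔼 r : Fin n → Seed p, weight 1 (ignorant φ (singleKnown G K r)).card
      ≤ 3 / 4 * weight 1 (ignorant φ K).card := by
  classical
  set P := weight 1 (ignorant φ K).card with hP
  have hmono : ∀ r v, K v ⊆ singleKnown G K r v := fun r v => Finset.subset_union_left
  have hle : ∀ r, weight 1 (ignorant φ (singleKnown G K r)).card ≤ P := fun r =>
    weight_mono _ (Finset.card_le_card (ignorant_anti (hmono r)))
  by_cases hall : ∀ v, Senses φ (K v)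
  · have h0 : P = 0 := by
      have : ignorant φ K = ∅ := Finset.eq_empty_of_forall_notMem fun v hv =>
        mem_ignorant.1 hv (hall v)
      rw [hP, this]
      simp [weight]
    rw [h0, mul_zero, ← h0]
    exact Finset.expect_le Finset.univ_nonempty fun r _ => hle r
  · push Not at hall
    obtain ⟨z₀, hz₀⟩ := hall
    obtain ⟨a₀, ha₀⟩ := hK
    obtain ⟨q⟩ := hG.preconnected a₀ z₀
    obtain ⟨d, -, hda, hdz⟩ := q.exists_boundary_dart {v | Senses φ (K v)} ha₀ hz₀
    obtain ⟨⟨a, z⟩, hadj⟩ := d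
    obtain ⟨x, hx, hφ⟩ : Senses φ (K a) := hda
    have hz : ¬ Senses φ (K z) := hdz
    calc _ ≤ 𝔼 r : Fin n → Seed p, (1 / 2 * P + 1 / 2 * P *
          if φ (randomSum K {a} r) = 0 then (1 : ℝ) else 0) := by
          refine Finset.expect_le_expect fun r _ => ?_
          split_ifs with h
          · linarith [hle r]
          · have hz' : z ∉ ignorant φ (singleKnown G K r) := by
              rw [mem_ignorant, not_not]
              refine ⟨_, Finset.mem_union_right _ (Finset.mem_image.2 ⟨a, ?_, rfl⟩), h⟩
              simpa using hadj.symm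
            have hcard : (ignorant φ (singleKnown G K r)).card + 1 ≤ (ignorant φ K).card := by
              rw [← Finset.card_insert_of_notMem hz']
              exact Finset.card_le_card (Finset.insert_subset (mem_ignorant.2 hz)
                (ignorant_anti (hmono r)))
            linarith [weight_le_half one_pos hcard]
      _ = 3 / 4 * P := by
          rw [Finset.expect_add_distrib, Fintype.expect_const, ← Finset.mul_expect,
            expect_randomSum_eq_zero φ K _ (Finset.mem_singleton_self a) hx hφ]
          ring

/-- The conditions on the parameters under which the independent set computation succeeds with
probability at least one half. -/
structure Params.Adequate (p : Params) (n : ℕ) : Prop where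
  T_pos : 0 < p.T
  iters_pos : 0 < p.iters
  prioRange_ge : 2 * n ^ 2 ≤ p.prioRange
  iters_ge : (3 / 4 : ℝ) ^ (p.iters - 1) * (n : ℝ) ^ 2 ≤ 1 / 2

/-- For D > 0 the factor is 7/8 + (1 − 7/8)/2 = 15/16; for D = 0 it is the better 3/4. -/
theorem blockE_weight_le (hp : p.Adequate n) {G : SimpleGraph (Fin n)} (hG : G.Connected)
    (σ : Fin n → State p) (huid : Function.Injective fun v => (σ v).uid)
    (φ : Vec p →ₗ[ZMod 2] ZMod 2) (hσ : ∃ v, Senses φ (σ v).known) :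
    blockE G 0 p.T (fun σ => weight p.minPatch (ignorant φ fun v => (σ v).known).card) σ
      ≤ 15 / 16 * weight p.minPatch (ignorant φ fun v => (σ v).known).card := by
  have h0 := weight_nonneg p.minPatch (ignorant φ fun v => (σ v).known).card
  rcases Nat.eq_zero_or_pos p.D with hD | hD
  · rw [blockE_of_D_eq_zero hD hp.T_pos G σ huid
      fun K => weight p.minPatch (ignorant φ K).card]
    have hmin : p.minPatch = 1 := by rw [Params.minPatch, hD]
    rw [hmin] at h0 ⊢
    refine (expect_weight_singleKnown_le hG φ _ hσ).trans ?_
    linarith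
  · refine (blockE_le_of_pos hD hp.iters_pos hp.prioRange_ge hp.iters_ge hG σ huid
      (fun K => weight p.minPatch (ignorant φ K).card) h0 (θ := 7 / 8) (by norm_num) ?_ ?_).trans ?_
    · intro dep par r r'
      refine weight_mono _ (Finset.card_le_card (ignorant_anti fun v => ?_))
      exact (subset_passKnown G dep par (fun v => (σ v).known) r v).trans
        (subset_shareKnown _ _ _ _ _)
    · intro uid ldr dep prt par hI hF hindep hall
      exact expect_weight_le hG hI hF hindep hall φ _ hσ
    · norm_num

theorem combination_mem {W : Submodule (ZMod 2) (Vec p)} {K : Finset (Vec p)}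
    (hK : ∀ x ∈ K, x ∈ W) (r : Vec p → ZMod 2) : combination K r ∈ W :=
  Submodule.sum_mem _ fun x hx => W.smul_mem _ (hK x hx)

theorem randomSum_mem {W : Submodule (ZMod 2) (Vec p)} {K : Fin n → Finset (Vec p)}
    (hK : ∀ v, ∀ x ∈ K v, x ∈ W) (A : Finset (Fin n)) (r : Fin n → Seed p) :
    randomSum K A r ∈ W :=
  Submodule.sum_mem _ fun u _ => combination_mem (hK u) _

theorem shareKnown_mem {W : Submodule (ZMod 2) (Vec p)} {K : Fin n → Finset (Vec p)}
    (hK : ∀ v, ∀ x ∈ K v, x ∈ W) (dep : Fin n → Option ℕ) (par : Fin n → Fin n)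
    (r : Fin n → Seed p) (v : Fin n) (x : Vec p) (hx : x ∈ shareKnown dep par K r v) : x ∈ W := by
  classical
  rw [shareKnown] at hx
  split_ifs at hx
  · rcases Finset.mem_insert.1 hx with rfl | hx
    · exact randomSum_mem hK _ _
    · exact hK v x hx
  · exact hK v x hx

theorem passKnown_mem {W : Submodule (ZMod 2) (Vec p)} {K : Fin n → Finset (Vec p)}
    (hK : ∀ v, ∀ x ∈ K v, x ∈ W) (G : SimpleGraph (Fin n)) (dep : Fin n → Option ℕ)
    (par : Fin n → Fin n) (r : Fin n → Seed p) (v : Fin n) (x : Vec p)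
    (hx : x ∈ passKnown G dep par K r v) : x ∈ W := by
  classical
  rcases Finset.mem_union.1 hx with hx | hx
  · exact shareKnown_mem hK dep par r v x hx
  · obtain ⟨u, -, rfl⟩ := Finset.mem_image.1 hx
    exact randomSum_mem hK _ _

open Classical in
/-- The indicator function of the event that a node has received a vector outside `W`. -/
noncomputable def unsound (W : Submodule (ZMod 2) (Vec p)) (K : Fin n → Finset (Vec p)) : ℝ :=
  if ∀ v, ∀ x ∈ K v, x ∈ W then 0 else 1

theorem unsound_nonneg (W : Submodule (ZMod 2) (Vec p)) (K : Fin n → Finset (Vec p)) :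
    0 ≤ unsound W K := by
  rw [unsound]; split_ifs <;> norm_num

theorem unsound_le_one (W : Submodule (ZMod 2) (Vec p)) (K : Fin n → Finset (Vec p)) :
    unsound W K ≤ 1 := by
  rw [unsound]; split_ifs <;> norm_num

theorem unsound_mono (W : Submodule (ZMod 2) (Vec p)) {K K' : Fin n → Finset (Vec p)}
    (h : ∀ v, K v ⊆ K' v) : unsound W K ≤ unsound W K' := by
  by_cases h' : ∀ v, ∀ x ∈ K' v, x ∈ W
  · rw [unsound, unsound, if_pos h', if_pos fun v x hx => h' v x (h v hx)]
  · rw [unsound.eq_def W K', if_neg h']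
    exact unsound_le_one W K

/-- Sums of vectors of W stay in W, whether or not the patches were formed properly. Hence the meta
round bound is applied with M = 0. -/
theorem blockE_unsound_le (hp : p.Adequate n) {G : SimpleGraph (Fin n)} (hG : G.Connected)
    (σ : Fin n → State p) (huid : Function.Injective fun v => (σ v).uid)
    (W : Submodule (ZMod 2) (Vec p)) (hσ : ∀ v, ∀ x ∈ (σ v).known, x ∈ W) :
    blockE G 0 p.T (fun σ => unsound W fun v => (σ v).known) σ ≤ 0 := by
  classical
  rcases Nat.eq_zero_or_pos p.D with hD | hD
  · rw [blockE_of_D_eq_zero hD hp.T_pos G σ huid (unsound W)]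
    refine Finset.expect_le Finset.univ_nonempty fun r _ => ?_
    rw [unsound, if_pos]
    intro v x hx
    rcases Finset.mem_union.1 hx with hx | hx
    · exact hσ v x hx
    · obtain ⟨u, -, rfl⟩ := Finset.mem_image.1 hx
      exact randomSum_mem hσ _ _
  · have key : ∀ (dep : Fin n → Option ℕ) (par : Fin n → Fin n) (r r' : Fin n → Seed p),
        unsound W (shareKnown dep par (passKnown G dep par (fun v => (σ v).known) r) r') = 0 := by
      intro dep par r r'
      rw [unsound, if_pos]
      exact fun v x hx => shareKnown_mem (passKnown_mem hσ G dep par r) dep par r' v x hx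
    refine (blockE_le_of_pos hD hp.iters_pos hp.prioRange_ge hp.iters_ge hG σ huid
      (unsound W) le_rfl (θ := 1) le_rfl ?_ ?_).trans (by simp)
    · exact fun dep par r r' => (key dep par r r').le
    · intro uid ldr dep prt par _ _ _ _
      simp [key]

end PatchSharing

/-! ### Contraction over many blocks of rounds -/

namespace Protocol

variable {Uid Inp Out : Type} (P : Protocol Uid Inp Out) {n : ℕ}

/-- Comparison is required only at histories of the relevant length, since contraction is known only
at the boundaries of meta rounds. -/
theorem iterate_stepE_mono_of_length {F G : P.History n → ℝ} (R : ℕ) (x : P.History n)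
    (h : ∀ y : P.History n, y.length = x.length + R → F y ≤ G y) :
    P.stepE^[R] F x ≤ P.stepE^[R] G x := by
  induction R generalizing x with
  | zero => exact h x rfl
  | succ R ih =>
    rw [Function.iterate_succ_apply', Function.iterate_succ_apply']
    refine Finset.expect_le_expect fun s _ => ih (s :: x) fun y hy => h y ?_
    rw [hy, List.length_cons]
    ring

/-- A function whose expectation shrinks by a factor in each block of `T` rounds. -/
theorem iterate_stepE_mul_le {F : P.History n → ℝ} {T : ℕ} {a : ℝ} (ha : 0 ≤ a)
    (h : ∀ x : P.History n, T ∣ x.length → P.stepE^[T] F x ≤ a * F x) (M : ℕ) :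
    P.stepE^[M * T] F [] ≤ a ^ M * F [] := by
  induction M with
  | zero => simp
  | succ M ih =>
    rw [Nat.succ_mul, Function.iterate_add_apply]
    calc _ ≤ P.stepE^[M * T] (fun y => a * F y) [] := by
          refine P.iterate_stepE_mono_of_length _ _ fun y hy => h y ?_
          rw [hy]
          simp
      _ = a * P.stepE^[M * T] F [] := P.iterate_stepE_mul_left a F _ _
      _ ≤ a * (a ^ M * F []) := mul_le_mul_of_nonneg_left ih ha
      _ = _ := by rw [pow_succ]; ring

end Protocol

namespace PatchSharing

variable {p : Params} {n : ℕ}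

/-! ### Invariants of all rounds -/

theorem prepare_uid (s : ℕ) (r : Seed p) (st : State p) : (prepare p s r st).uid = st.uid := by
  have h : ∀ (c : Prop) [Decidable c] (a b : State p), a.uid = st.uid → b.uid = st.uid →
      (if c then a else b).uid = st.uid := fun c _ a b ha hb => by split_ifs <;> assumption
  have hd : ∀ st' : State p, st'.decideLeader.uid = st'.uid := fun st' => by
    rw [State.decideLeader]; split_ifs <;> rfl
  unfold prepare
  refine h _ _ _ (Eq.trans rfl ?_) ?_ <;>
  refine h _ _ _ (Eq.trans rfl ?_) ?_ <;>
  refine h _ _ _ (Eq.trans rfl ?_) ?_ <;>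
  refine h _ _ _ ((hd _).trans ?_) ?_ <;>
  refine h _ _ _ (Eq.trans rfl ?_) ?_ <;>
  exact h _ _ _ rfl rfl

theorem prepare_known (s : ℕ) (r : Seed p) (st : State p) :
    (prepare p s r st).known = st.known := by
  have h : ∀ (c : Prop) [Decidable c] (a b : State p), a.known = st.known → b.known = st.known →
      (if c then a else b).known = st.known := fun c _ a b ha hb => by split_ifs <;> assumption
  have hd : ∀ st' : State p, st'.decideLeader.known = st'.known := fun st' => by
    rw [State.decideLeader]; split_ifs <;> rfl
  unfold prepare
  refine h _ _ _ (Eq.trans rfl ?_) ?_ <;>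
  refine h _ _ _ (Eq.trans rfl ?_) ?_ <;>
  refine h _ _ _ (Eq.trans rfl ?_) ?_ <;>
  refine h _ _ _ ((hd _).trans ?_) ?_ <;>
  refine h _ _ _ (Eq.trans rfl ?_) ?_ <;>
  exact h _ _ _ rfl rfl

theorem update_uid (st : State p) (ms : Multiset (Msg p)) (ph : Phase) :
    (update st ms ph).uid = st.uid := by
  cases ph <;> simp only [update] <;> split <;> rfl

theorem subset_update_known (st : State p) (ms : Multiset (Msg p)) (ph : Phase) :
    st.known ⊆ (update st ms ph).known := by
  classical
  cases ph with
  | prio => exact subset_rfl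
  | deactivate => simp only [update]; split <;> exact subset_rfl
  | tree j => simp only [update]; split <;> exact subset_rfl
  | up j => simp only [update]; split <;> exact subset_rfl
  | down j =>
    simp only [update]
    split_ifs
    · exact Finset.subset_insert _ _
    · exact subset_rfl
  | pass j =>
    simp only [update]
    split_ifs
    · exact Finset.subset_union_left
    · exact subset_rfl
  | idle => exact subset_rfl

section States

variable (uid : Fin n → Fin p.U) (inp : Fin n → TokenTable p.k p.k)
  (adv : (patchSharing p).Adversary n)

theorem states_uid (h : (patchSharing p).History n) (v : Fin n) :
    (states uid inp adv h v).uid = uid v := by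
  induction h with
  | nil => rfl
  | cons s h ih =>
    rw [states_cons]
    exact (update_uid _ _ _).trans ((prepare_uid _ _ _).trans ih)

theorem subset_states_cons_known (s : Fin n → (patchSharing p).Seed)
    (h : (patchSharing p).History n) (v : Fin n) :
    (states uid inp adv h v).known ⊆ (states uid inp adv (s :: h) v).known := by
  rw [states_cons, ← prepare_known (h.length % p.T) (s v) (states uid inp adv h v)]
  exact subset_update_known _ _ _

theorem init_known_subset (h : (patchSharing p).History n) (v : Fin n) :
    (init p (uid v) (inp v)).known ⊆ (states uid inp adv h v).known := by
  induction h with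
  | nil => exact subset_rfl
  | cons s h ih => exact ih.trans (subset_states_cons_known uid inp adv s h v)

variable {uid inp adv}

theorem iterate_stepE_weight_le (hp : p.Adequate n) (huid : Function.Injective uid)
    (hc : adv.AlwaysConnected) (hs : adv.Stable p.T) (φ : Vec p →ₗ[ZMod 2] ZMod 2)
    (hφ : ∃ v, Senses φ (init p (uid v) (inp v)).known) (R : ℕ) :
    (patchSharing p).stepE^[R] (fun h => weight p.minPatch
        (ignorant φ fun v => (states uid inp adv h v).known).card) []
      ≤ (15 / 16) ^ (R / p.T) * weight p.minPatch n := by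
  set F : (Fin n → State p) → ℝ :=
    fun σ => weight p.minPatch (ignorant φ fun v => (σ v).known).card with hF
  have hblock : ∀ x : (patchSharing p).History n, p.T ∣ x.length →
      (patchSharing p).stepE^[p.T] (fun h => F (states uid inp adv h)) x
        ≤ 15 / 16 * F (states uid inp adv x) := by
    intro x hx
    have hmod : x.length % p.T = 0 := Nat.mod_eq_zero_of_dvd hx
    rw [iterate_stepE_eq_blockE hp.T_pos uid inp adv hs F p.T x (by omega), hmod]
    refine blockE_weight_le hp (hc x) _ ?_ φ ?_
    · simpa only [states_uid] using huid
    · obtain ⟨v, hv⟩ := hφ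
      exact ⟨v, hv.mono (init_known_subset uid inp adv x v)⟩
  -- The rounds of an unfinished meta round cannot increase the weight, so only the complete ones
  -- are counted.
  have h1 : R = R / p.T * p.T + R % p.T := by rw [mul_comm]; exact (Nat.div_add_mod R p.T).symm
  calc (patchSharing p).stepE^[R] (fun h => F (states uid inp adv h)) []
      = (patchSharing p).stepE^[R / p.T * p.T] ((patchSharing p).stepE^[R % p.T]
          (fun h => F (states uid inp adv h))) [] := by
        rw [← Function.iterate_add_apply, ← h1]
    _ ≤ (patchSharing p).stepE^[R / p.T * p.T] (fun h => F (states uid inp adv h)) [] := by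
        refine (patchSharing p).iterate_stepE_mono (fun x => ?_) _ _
        refine (patchSharing p).iterate_stepE_le_self
          (F := fun h => F (states uid inp adv h)) (fun s y => ?_) _ _
        exact weight_mono _ (Finset.card_le_card (ignorant_anti
          (subset_states_cons_known uid inp adv s y)))
    _ ≤ (15 / 16) ^ (R / p.T) * F (states uid inp adv []) :=
        (patchSharing p).iterate_stepE_mul_le (by norm_num) hblock _
    _ ≤ _ := by
        refine mul_le_mul_of_nonneg_left (weight_mono _ ?_) (by positivity)
        exact (Finset.card_le_univ _).trans (Fintype.card_fin n).le

/-- Soundness is treated as an expectation, like the weight, so that it can be read off from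
complete meta rounds without an invariant for partially transmitted vectors. -/
theorem iterate_stepE_unsound_le (hp : p.Adequate n) (huid : Function.Injective uid)
    (hc : adv.AlwaysConnected) (hs : adv.Stable p.T) (W : Submodule (ZMod 2) (Vec p))
    (hW : ∀ v, ∀ x ∈ (init p (uid v) (inp v)).known, x ∈ W) (R : ℕ) :
    (patchSharing p).stepE^[R]
      (fun h => unsound W fun v => (states uid inp adv h v).known) [] ≤ 0 := by
  classical
  set F : (Fin n → State p) → ℝ := fun σ => unsound W fun v => (σ v).known with hF
  have hblock : ∀ x : (patchSharing p).History n, p.T ∣ x.length →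
      (patchSharing p).stepE^[p.T] (fun h => F (states uid inp adv h)) x
        ≤ 1 * F (states uid inp adv x) := by
    intro x hx
    have hmod : x.length % p.T = 0 := Nat.mod_eq_zero_of_dvd hx
    rw [one_mul]
    by_cases hsound : ∀ v, ∀ y ∈ (states uid inp adv x v).known, y ∈ W
    · rw [iterate_stepE_eq_blockE hp.T_pos uid inp adv hs F p.T x (by omega), hmod]
      refine (blockE_unsound_le hp (hc x) _ ?_ W hsound).trans (unsound_nonneg _ _)
      simpa only [states_uid] using huid
    · have h1 : F (states uid inp adv x) = 1 := if_neg hsound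
      rw [h1, ← (patchSharing p).iterate_stepE_const (n := n) 1 p.T x]
      exact (patchSharing p).iterate_stepE_mono (fun y => unsound_le_one _ _) _ _
  -- Unsoundness persists, so it may be examined at the later time R·T, which is a boundary of meta
  -- rounds.
  obtain ⟨d, hd⟩ : ∃ d, R * p.T = R + d :=
    ⟨R * p.T - R, (Nat.add_sub_cancel' (Nat.le_mul_of_pos_right R hp.T_pos)).symm⟩
  calc (patchSharing p).stepE^[R] (fun h => F (states uid inp adv h)) []
      ≤ (patchSharing p).stepE^[R] ((patchSharing p).stepE^[d]
          (fun h => F (states uid inp adv h))) [] := by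
        refine (patchSharing p).iterate_stepE_mono (fun x => ?_) _ _
        refine (patchSharing p).le_iterate_stepE_self
          (F := fun h => F (states uid inp adv h)) (fun s y => ?_) _ _
        exact unsound_mono _ (subset_states_cons_known uid inp adv s y)
    _ = (patchSharing p).stepE^[R * p.T] (fun h => F (states uid inp adv h)) [] := by
        rw [← Function.iterate_add_apply, hd]
    _ ≤ 1 ^ R * F (states uid inp adv []) :=
        (patchSharing p).iterate_stepE_mul_le zero_le_one hblock _
    _ = 0 := by
        have : F (states uid inp adv []) = 0 := if_pos hW
        rw [this, mul_zero]

end States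

/-! ### Decoding -/

/-- The coefficient vector of a coded vector. -/
def coeff : Vec p →ₗ[ZMod 2] (Fin p.k → ZMod 2) where
  toFun x i := x (Fin.castAdd p.k i)
  map_add' _ _ := rfl
  map_smul' _ _ := rfl

/-- The functional that pairs the coefficient vector with `μ`. -/
def pairing (μ : Fin p.k → ZMod 2) : Vec p →ₗ[ZMod 2] ZMod 2 where
  toFun x := ∑ i, coeff x i * μ i
  map_add' x y := by simp [add_mul, Finset.sum_add_distrib]
  map_smul' a x := by simp [mul_assoc, Finset.mul_sum]

/-- The coded vectors whose payload is the combination of the tokens given by the coefficients. -/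
def codeSpace (tok : Fin p.k → Token p.k) : Submodule (ZMod 2) (Vec p) where
  carrier := {x | ∀ j, x (Fin.natAdd p.k j) = ∑ i, coeff x i * tok i j}
  add_mem' {x y} hx hy j := by
    rw [Pi.add_apply, hx j, hy j]
    simp [add_mul, Finset.sum_add_distrib]
  zero_mem' j := by simp
  smul_mem' a x hx j := by
    rw [Pi.smul_apply, hx j]
    simp [mul_assoc, Finset.mul_sum]

theorem coeff_codeword (i : Fin p.k) (y : Token p.k) : coeff (codeword i y) = Pi.single i 1 := by
  funext j
  exact Fin.append_left _ _ j

theorem codeword_mem_codeSpace_iff (tok : Fin p.k → Token p.k) (i : Fin p.k) (y : Token p.k) :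
    codeword i y ∈ codeSpace tok ↔ y = tok i := by
  have h : codeword i y ∈ codeSpace tok ↔
      ∀ j, codeword i y (Fin.natAdd p.k j) = ∑ l, coeff (codeword i y) l * tok l j := Iff.rfl
  have h1 : ∀ j, codeword i y (Fin.natAdd p.k j) = y j := fun j => Fin.append_right _ _ j
  have h2 : ∀ j, ∑ l, coeff (codeword i y) l * tok l j = tok i j := by
    intro j
    rw [coeff_codeword, Finset.sum_eq_single i]
    · simp
    · intro l _ hl
      simp [hl]
    · simp
  simp only [h, h1, h2]
  exact funext_iff.symm

theorem mem_init_known {tok : Fin p.k → Token p.k} {H : Finset (Fin p.k)} {u : Fin p.U}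
    {x : Vec p} : x ∈ (init p u (initialTable tok H)).known ↔ ∃ i ∈ H, x = codeword i (tok i) := by
  simp only [init, Finset.mem_biUnion, Finset.mem_univ, true_and, Option.mem_toFinset,
    Option.mem_def, Option.map_eq_some_iff, initialTable]
  constructor
  · rintro ⟨i, y, h1, rfl⟩
    split_ifs at h1 with h
    exact ⟨i, h, by rw [Option.some.inj h1]⟩
  · rintro ⟨i, h, rfl⟩
    exact ⟨i, tok i, by simp [h], rfl⟩

/-- If the coefficient vectors of the span were a proper subspace, a nonzero functional, necessarily
a pairing with some μ ≠ 0, would vanish on them, and μ would not be sensed. So e_i occurs as a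
coefficient vector. Whichever payload the decoder picks is right, because `codeSpace` contains only
one codeword with these coefficients. -/
theorem decode_eq {tok : Fin p.k → Token p.k} {st : State p}
    (hW : ∀ x ∈ st.known, x ∈ codeSpace tok) (hs : ∀ μ, μ ≠ 0 → Senses (pairing μ) st.known)
    (i : Fin p.k) : decode st i = some (tok i) := by
  have hspan : Submodule.span (ZMod 2) (st.known : Set (Vec p)) ≤ codeSpace tok :=
    Submodule.span_le.2 hW
  have htop : (Submodule.span (ZMod 2) (st.known : Set (Vec p))).map coeff = ⊤ := by
    by_contra hne
    obtain ⟨f, hf, hle⟩ := Submodule.exists_le_ker_of_lt_top _ (lt_top_iff_ne_top.2 hne)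
    have hfeq : ∀ x : Vec p, f (coeff x) = pairing (fun i => f fun j => if i = j then 1 else 0) x := by
      intro x
      rw [f.pi_apply_eq_sum_univ (coeff x)]
      rfl
    have hμ : (fun i => f fun j => if i = j then 1 else 0) ≠ 0 := by
      intro h0
      apply hf
      refine LinearMap.ext fun y => ?_
      rw [f.pi_apply_eq_sum_univ y]
      refine Finset.sum_eq_zero fun i _ => ?_
      rw [show (f fun j => if i = j then 1 else 0) = 0 from congrFun h0 i, smul_zero]
    obtain ⟨x, hx, hne⟩ := hs _ hμ
    rw [← hfeq] at hne
    exact hne (hle (Submodule.mem_map_of_mem (Submodule.subset_span hx)))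
  have hex : ∃ y : Token p.k,
      codeword i y ∈ Submodule.span (ZMod 2) (st.known : Set (Vec p)) := by
    have : Pi.single i 1 ∈ (Submodule.span (ZMod 2) (st.known : Set (Vec p))).map coeff := by
      rw [htop]; trivial
    obtain ⟨x, hx, hcx⟩ := this
    refine ⟨fun j => x (Fin.natAdd p.k j), ?_⟩
    have : codeword i (fun j => x (Fin.natAdd p.k j)) = x := by
      rw [codeword, ← hcx]
      exact Fin.append_castAdd_natAdd
    rwa [this]
  rw [decode, dif_pos hex]
  exact congrArg some ((codeword_mem_codeSpace_iff tok i _).1 (hspan hex.choose_spec))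

theorem solvesIndexedBroadcast (hp : p.Adequate n) (R : ℕ) :
    SolvesIndexedBroadcast (patchSharing p) n p.T R
      (1 - 2 ^ p.k * ((15 / 16) ^ (R / p.T) * weight p.minPatch n)) := by
  classical
  intro uid huid tok H hH adv hc hs
  rw [Protocol.outputProb_eq]
  set inp : Fin n → TokenTable p.k p.k := fun v => initialTable tok (H v) with hinp
  set U : (patchSharing p).History n → ℝ :=
    fun h => unsound (codeSpace tok) fun v => (states uid inp adv h v).known with hU
  set X : (Fin p.k → ZMod 2) → (patchSharing p).History n → ℝ := fun μ h => weight p.minPatch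
    (ignorant (pairing μ) fun v => (states uid inp adv h v).known).card with hX
  set N : Finset (Fin p.k → ZMod 2) := Finset.univ.erase 0 with hN
  -- Union bound and Markov's inequality at once: any failure makes the indicator of unsoundness 1
  -- or the weight of some μ at least 1.
  have hpoint : ∀ h : (patchSharing p).History n, 1 + (-1) * (U h + ∑ μ ∈ N, X μ h) ≤
      if ∀ v i, (patchSharing p).out ((patchSharing p).run uid inp adv h v) i = some (tok i)
        then (1 : ℝ) else 0 := by
    intro h
    have hU0 : 0 ≤ U h := unsound_nonneg _ _
    have hX0 : ∀ μ ∈ N, 0 ≤ X μ h := fun μ _ => weight_nonneg _ _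
    have hX0' := Finset.sum_nonneg hX0
    by_cases hgood : (∀ v, ∀ x ∈ (states uid inp adv h v).known, x ∈ codeSpace tok) ∧
        ∀ μ, μ ≠ 0 → ∀ v, Senses (pairing μ) (states uid inp adv h v).known
    · rw [if_pos]
      · linarith
      · intro v i
        exact decode_eq (hgood.1 v) (fun μ hμ => hgood.2 μ hμ v) i
    · refine le_trans ?_ (show (0 : ℝ) ≤ _ by split_ifs <;> norm_num)
      by_cases h1 : ∀ v, ∀ x ∈ (states uid inp adv h v).known, x ∈ codeSpace tok
      · have h2 : ¬ ∀ μ, μ ≠ 0 → ∀ v, Senses (pairing μ) (states uid inp adv h v).known :=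
          fun h' => hgood ⟨h1, h'⟩
        push Not at h2
        obtain ⟨μ, hμ, v, hv⟩ := h2
        have h3 : 1 ≤ X μ h := one_le_weight _ (Finset.card_pos.2 ⟨v, mem_ignorant.2 hv⟩)
        have h4 := Finset.single_le_sum hX0 (Finset.mem_erase.2 ⟨hμ, Finset.mem_univ μ⟩)
        linarith
      · have h2 : U h = 1 := if_neg h1
        linarith
  refine le_trans ?_ ((patchSharing p).iterate_stepE_mono
    (fun h => (hpoint h).trans (le_of_eq (by congr))) R [])
  rw [(patchSharing p).iterate_stepE_add, (patchSharing p).iterate_stepE_const,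
    (patchSharing p).iterate_stepE_mul_left, (patchSharing p).iterate_stepE_add,
    (patchSharing p).iterate_stepE_sum]
  have hUle : (patchSharing p).stepE^[R] U [] ≤ 0 := by
    refine iterate_stepE_unsound_le hp huid hc hs _ (fun v x hx => ?_) R
    obtain ⟨i, -, rfl⟩ := mem_init_known.1 hx
    exact (codeword_mem_codeSpace_iff tok i _).2 rfl
  have hXle : ∀ μ ∈ N, (patchSharing p).stepE^[R] (X μ) []
      ≤ (15 / 16) ^ (R / p.T) * weight p.minPatch n := by
    intro μ hμ
    refine iterate_stepE_weight_le hp huid hc hs _ ?_ R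
    -- The initial holder of a token i with μ i ≠ 0 senses μ from the start.
    obtain ⟨i, hi⟩ := Function.ne_iff.1 (Finset.ne_of_mem_erase hμ)
    obtain ⟨v, hv⟩ := hH i
    refine ⟨v, codeword i (tok i), mem_init_known.2 ⟨i, hv, rfl⟩, ?_⟩
    have : pairing μ (codeword i (tok i)) = μ i := by
      change ∑ j, coeff (codeword i (tok i)) j * μ j = μ i
      rw [coeff_codeword, Finset.sum_eq_single i]
      · simp
      · intro l _ hl
        simp [hl]
      · simp
    rw [this]
    exact hi
  have hsum := Finset.sum_le_sum hXle
  rw [Finset.sum_const, nsmul_eq_mul] at hsum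
  have hcard : (N.card : ℝ) ≤ 2 ^ p.k := by
    have : N.card ≤ 2 ^ p.k := (Finset.card_le_univ _).trans (by simp [ZMod.card])
    exact_mod_cast this
  have h0 : 0 ≤ (15 / 16 : ℝ) ^ (R / p.T) * weight p.minPatch n :=
    mul_nonneg (by positivity) (weight_nonneg _ _)
  have := mul_le_mul_of_nonneg_right hcard h0
  linarith

end PatchSharing

namespace PatchSharing

/-! ### Choice of the parameters -/

theorem lt_two_pow_ell {p : Params} {n : ℕ} (h : n ≤ 2 * p.N) : n < 2 ^ p.ell := by
  have h1 : p.N < 2 ^ (Nat.log 2 p.N + 1) := Nat.lt_pow_succ_log_self (by norm_num) p.N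
  rw [Params.ell, pow_succ]
  omega

theorem adequate {n N b T U : ℕ} (hN : n ≤ 2 * N) (hT : 1 ≤ T) :
    Params.Adequate ⟨20, N, b, T, U⟩ n := by
  set p : Params := ⟨20, N, b, T, U⟩ with hp
  have hn : n < 2 ^ p.ell := lt_two_pow_ell hN
  have hell : 2 ≤ p.ell := Nat.le_add_left _ _
  have hit : p.iters = 20 * p.ell := rfl
  have hsq : n ^ 2 ≤ 2 ^ (2 * p.ell) := by
    rw [mul_comm, pow_mul]
    exact Nat.pow_le_pow_left hn.le 2
  refine ⟨hT, by omega, ?_, ?_⟩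
  · have h2 : 2 ≤ 2 ^ (2 * p.ell) := by
      calc 2 = 2 ^ 1 := by norm_num
        _ ≤ _ := Nat.pow_le_pow_right (by norm_num) (by omega)
    calc 2 * n ^ 2 ≤ 2 ^ (2 * p.ell) * 2 ^ (2 * p.ell) := Nat.mul_le_mul h2 hsq
      _ = p.prioRange := by rw [Params.prioRange, ← pow_add]; congr 1; ring
  -- This is where κ = 20 is used: (3/4)^10 ≤ 1/16 beats n² ≤ 4^ℓ with room for the factor 1/2, and
  -- 20ℓ − 1 ≥ 10ℓ absorbs the last iteration.
  · have h1 : (3 / 4 : ℝ) ^ (p.iters - 1) ≤ (1 / 16) ^ p.ell := by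
      calc (3 / 4 : ℝ) ^ (p.iters - 1) ≤ (3 / 4) ^ (10 * p.ell) :=
            pow_le_pow_of_le_one (by norm_num) (by norm_num) (by omega)
        _ = ((3 / 4) ^ 10) ^ p.ell := pow_mul _ _ _
        _ ≤ (1 / 16) ^ p.ell := pow_le_pow_left₀ (by positivity) (by norm_num) _
    have h2 : (n : ℝ) ^ 2 ≤ 4 ^ p.ell := by
      have : (n : ℝ) ^ 2 ≤ 2 ^ (2 * p.ell) := by exact_mod_cast hsq
      rw [pow_mul] at this
      norm_num at this
      exact this
    calc (3 / 4 : ℝ) ^ (p.iters - 1) * (n : ℝ) ^ 2 ≤ (1 / 16) ^ p.ell * 4 ^ p.ell :=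
          mul_le_mul h1 h2 (by positivity) (by positivity)
      _ = (1 / 4) ^ p.ell := by rw [← mul_pow]; norm_num
      _ ≤ (1 / 4) ^ 1 := pow_le_pow_of_le_one (by norm_num) (by norm_num) (by omega)
      _ ≤ 1 / 2 := by norm_num

theorem half_le_log {n : ℕ} (hn : 2 ≤ n) : (1 / 2 : ℝ) ≤ Real.log n := by
  have h1 : Real.log 2 ≤ Real.log n :=
    Real.log_le_log (by norm_num) (by exact_mod_cast hn)
  linarith [Real.log_two_gt_d9]

theorem natLog_add_one_le {n : ℕ} (hn : 2 ≤ n) : ((Nat.log 2 n + 1 : ℕ) : ℝ) ≤ 4 * Real.log n := by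
  have h0 := half_le_log hn
  have h1 : ((2 ^ Nat.log 2 n : ℕ) : ℝ) ≤ n := by
    exact_mod_cast Nat.pow_log_le_self 2 (by omega)
  have h2 := Real.log_le_log (by positivity) h1
  rw [Nat.cast_pow, Real.log_pow] at h2
  have h3 : (0 : ℝ) ≤ (Nat.log 2 n : ℝ) := Nat.cast_nonneg _
  push_cast at h2 ⊢
  nlinarith [Real.log_two_gt_d9]

/-- Three factors have to be killed: 2^k from the union bound, 2^⌊n/d⌋ from the initial exponent,
and n·n^c ≤ 2^((c+1)L). As (15/16)^16 ≤ 1/2, sixteen meta rounds pay for each factor 2. -/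
theorem failure_le {n N b T U c R : ℕ} (hn : 2 ≤ n) (hN' : N ≤ 2 * n)
    (hb : 1 ≤ b) (hT : 1 ≤ T)
    (hR : ((16 * (1330 + 4 * c) : ℕ) : ℝ) * ((n + b * T ^ 2) * Real.log n) ≤ R) :
    (2 : ℝ) ^ (Params.k ⟨20, N, b, T, U⟩) *
      ((15 / 16) ^ (R / T) * weight (Params.minPatch ⟨20, N, b, T, U⟩) n) ≤ 1 / (n : ℝ) ^ c := by
  set p : Params := ⟨20, N, b, T, U⟩ with hp
  set L := Nat.log 2 n + 1 with hL
  set d := p.minPatch with hd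
  have hd0 : 0 < d := Nat.succ_pos _
  have hlog := half_le_log hn
  have hLle : (L : ℝ) ≤ 4 * Real.log n := natLog_add_one_le hn
  have hnL : n < 2 ^ L := Nat.lt_pow_succ_log_self (by norm_num) n
  have hell : p.ell ≤ L + 2 := by
    have h1 : Nat.log 2 N ≤ Nat.log 2 (n * 2) := Nat.log_mono_right (by omega)
    rw [Nat.log_mul_base (by norm_num) (by omega)] at h1
    have : p.ell = Nat.log 2 N + 2 := rfl
    omega
  have hTd : T ≤ 2 * (2 * (2 * (20 * p.ell) + 5)) * d := by
    have hD : p.D = T / (2 * (2 * (20 * p.ell) + 5)) := rfl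
    have h1 : T < 2 * (2 * (20 * p.ell) + 5) * (p.D + 1) := by
      rw [hD]
      exact Nat.lt_mul_div_succ T (by positivity)
    have h2 : p.D + 1 ≤ 2 * d := by
      rw [hd, Params.minPatch]
      omega
    calc T ≤ 2 * (2 * (20 * p.ell) + 5) * (p.D + 1) := h1.le
      _ ≤ 2 * (2 * (20 * p.ell) + 5) * (2 * d) := Nat.mul_le_mul_left _ h2
      _ = _ := by ring
  have hnT : n / d * T ≤ 2 * (2 * (2 * (20 * p.ell) + 5)) * n := by
    calc n / d * T ≤ n / d * (2 * (2 * (2 * (20 * p.ell) + 5)) * d) := Nat.mul_le_mul_left _ hTd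
      _ = 2 * (2 * (2 * (20 * p.ell) + 5)) * (n / d * d) := by ring
      _ ≤ _ := Nat.mul_le_mul_left _ (Nat.div_mul_le_self n d)
  have hnT' : ((n / d : ℕ) : ℝ) * T ≤ 1320 * (n * Real.log n) := by
    have h1 : ((n / d : ℕ) : ℝ) * T ≤ 2 * (2 * (2 * (20 * (p.ell : ℝ)) + 5)) * n := by
      exact_mod_cast hnT
    have h2 : (p.ell : ℝ) ≤ L + 2 := by exact_mod_cast hell
    -- The left side is 160ℓ + 20, with ℓ ≤ 4 log n + 2 and 1 ≤ 2 log n: 640 + 680 = 1320.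
    have h3 : 2 * (2 * (2 * (20 * (p.ell : ℝ)) + 5)) ≤ 1320 * Real.log n := by linarith
    calc _ ≤ _ := h1
      _ ≤ 1320 * Real.log n * n := mul_le_mul_of_nonneg_right h3 (Nat.cast_nonneg n)
      _ = _ := by ring
  have hk : p.k = b * T := rfl
  -- Times T, the three terms are at most 2Q log n, 1320 n log n and 4(c+1)Q log n with Q = bT²,
  -- together at most (1330 + 4c)(n + Q) log n.
  have hM : 16 * (p.k + n / d + (c + 1) * L) ≤ R / T := by
    rw [Nat.le_div_iff_mul_le hT]
    have hb' : (1 : ℝ) ≤ b := by exact_mod_cast hb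
    have hT' : (1 : ℝ) ≤ T := by exact_mod_cast hT
    set Q : ℝ := b * T ^ 2 with hQ
    have hTQ : (T : ℝ) ≤ Q := by
      rw [hQ]
      nlinarith [mul_le_mul hb' hT' zero_le_one (by linarith)]
    have hQ0 : 0 ≤ Q := by positivity
    have h1 : ((p.k : ℕ) : ℝ) * T ≤ 2 * (Q * Real.log n) := by
      rw [hk, hQ]
      push_cast
      have : (b : ℝ) * T * T = b * T ^ 2 := by ring
      rw [this]
      nlinarith
    have h2 : (L : ℝ) * T ≤ 4 * (Q * Real.log n) := by
      calc (L : ℝ) * T ≤ (4 * Real.log n) * Q :=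
            mul_le_mul hLle hTQ (by positivity) (by positivity)
        _ = _ := by ring
    have h3 : (c + 1 : ℝ) * (L * T) ≤ (c + 1) * (4 * (Q * Real.log n)) :=
      mul_le_mul_of_nonneg_left h2 (by positivity)
    have h4 : 0 ≤ Q * Real.log n := by positivity
    have h5 : 0 ≤ (n : ℝ) * Real.log n := by positivity
    have h6 : 0 ≤ (c : ℝ) * (n * Real.log n) := by positivity
    have h7 : (16 * (p.k + (n / d : ℕ) + (c + 1) * L) * T : ℝ) ≤ R := by
      refine le_trans ?_ hR
      push_cast
      nlinarith
    exact_mod_cast h7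
  have h16 : (15 / 16 : ℝ) ^ (R / T) ≤ (1 / 2) ^ (p.k + n / d + (c + 1) * L) := by
    calc (15 / 16 : ℝ) ^ (R / T) ≤ (15 / 16) ^ (16 * (p.k + n / d + (c + 1) * L)) :=
          pow_le_pow_of_le_one (by norm_num) (by norm_num) hM
      _ = ((15 / 16) ^ 16) ^ (p.k + n / d + (c + 1) * L) := pow_mul _ _ _
      _ ≤ _ := pow_le_pow_left₀ (by positivity) (by norm_num) _
  have hnc : (n : ℝ) * n ^ c ≤ 2 ^ ((c + 1) * L) := by
    have h1 : (n : ℝ) ≤ 2 ^ L := by exact_mod_cast hnL.le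
    calc (n : ℝ) * n ^ c = n ^ (c + 1) := by ring
      _ ≤ (2 ^ L) ^ (c + 1) := pow_le_pow_left₀ (Nat.cast_nonneg n) h1 _
      _ = _ := by rw [← pow_mul, mul_comm]
  have hn0 : (0 : ℝ) < (n : ℝ) ^ c := by positivity
  rw [le_div_iff₀ hn0, weight]
  calc (2 : ℝ) ^ p.k * ((15 / 16) ^ (R / T) * (n * 2 ^ (n / d))) * n ^ c
      = (15 / 16) ^ (R / T) * (2 ^ p.k * 2 ^ (n / d) * (n * n ^ c)) := by ring
    _ ≤ (1 / 2) ^ (p.k + n / d + (c + 1) * L) *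
          (2 ^ p.k * 2 ^ (n / d) * 2 ^ ((c + 1) * L)) := by
        gcongr
    _ = 1 := by
        rw [← pow_add, ← pow_add, ← mul_pow]
        norm_num

/-! ### The size of messages -/

/-- Messages as elements of a sum of product types. -/
def Msg.toSum {p : Params} : Msg p →
    Option (Option (Option (Fin p.prioRange × Fin p.U) ⊕ (Fin p.U ⊕ Fin p.U × Piece p)))
  | .silent => none
  | .deactivate => some none
  | .prio x => some (some (.inl (WithBot.recBotCoe none (fun y => some (ofLex y)) x)))
  | .tree u => some (some (.inr (.inl u)))
  | .vec u c => some (some (.inr (.inr (u, c))))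

theorem Msg.toSum_injective {p : Params} : Function.Injective (Msg.toSum (p := p)) := by
  intro x y h
  cases x <;> cases y <;> simp only [Msg.toSum, Option.some.injEq, reduceCtorEq, Sum.inl.injEq,
    Sum.inr.injEq, Prod.mk.injEq] at h
  · rfl
  · rename_i x y
    induction x using WithBot.recBotCoe <;> induction y using WithBot.recBotCoe <;>
      simp_all
  · rfl
  · rw [h]
  · rw [h.1, h.2]

/-- The rounding in S = ⌊T/10⌋ costs at most a factor 2 because S ≥ 1, so T ≤ 20S and 2bT/S ≤ 40b.
-/
theorem Params.w_le {p : Params} (hb : 1 ≤ p.b) (hT : 1 ≤ p.T) : p.w ≤ 41 * p.b := by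
  have hS : 0 < p.S ∧ p.T ≤ 20 * p.S := by
    rcases Nat.eq_zero_or_pos p.D with hD | hD
    · rw [Params.S, if_pos hD]; omega
    · have h1 := Params.S_pos hD
      refine ⟨h1, ?_⟩
      rw [Params.S, if_neg hD.ne'] at h1 ⊢
      omega
  have h1 : 2 * p.k / p.S ≤ 40 * p.b := by
    refine Nat.div_le_of_le_mul ?_
    calc 2 * p.k = 2 * p.b * p.T := by rw [Params.k]; ring
      _ ≤ 2 * p.b * (20 * p.S) := Nat.mul_le_mul_left _ hS.2
      _ = _ := by ring
  rw [Params.w]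
  omega

/-- From n ≤ e^b ≤ 4^b an identifier takes at most 2Ab bits and a random priority at most 8b + 12 ≤
20b. The piece, of at most 41b bits, dominates, and the alternatives among the message types cost 3
≤ 3b more bits. -/
theorem messageBits {A n N b T U : ℕ} (hn : 2 ≤ n) (hN' : N ≤ 2 * n) (hb : Real.log n ≤ b)
    (hb1 : 1 ≤ b) (hT : 1 ≤ T) (hU : U ≤ n ^ A) :
    (patchSharing ⟨20, N, b, T, U⟩).MessageBits ((2 * A + 44) * b) := by
  set p : Params := ⟨20, N, b, T, U⟩ with hp
  have hfin : Finite (Msg p) := Finite.of_injective _ Msg.toSum_injective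
  refine ⟨hfin, ?_⟩
  have hn4 : n ≤ 2 ^ (2 * b) := by
    have h1 : (n : ℝ) ≤ Real.exp b := by
      rw [← Real.exp_log (show (0 : ℝ) < n by positivity)]
      exact Real.exp_le_exp.2 hb
    have h2 : Real.exp b ≤ 4 ^ b := by
      rw [← Real.exp_one_pow b]
      exact pow_le_pow_left₀ (Real.exp_pos 1).le (by linarith [Real.exp_one_lt_d9]) b
    have h3 : (n : ℝ) ≤ ((2 ^ (2 * b) : ℕ) : ℝ) := by
      rw [pow_mul]
      push_cast
      exact h1.trans h2
    exact_mod_cast h3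
  have hU2 : p.U ≤ 2 ^ (2 * A * b) := by
    calc U ≤ n ^ A := hU
      _ ≤ (2 ^ (2 * b)) ^ A := Nat.pow_le_pow_left hn4 A
      _ = _ := by rw [← pow_mul]; congr 1; ring
  have hprio : p.prioRange ≤ 2 ^ (20 * b) := by
    have h1 : Nat.log 2 N ≤ 2 * b + 1 := by
      rw [← Nat.lt_succ_iff]
      refine Nat.log_lt_of_lt_pow' (by omega) ?_
      rw [pow_succ, pow_succ]
      have : 0 < 2 ^ (2 * b) := by positivity
      omega
    refine Nat.pow_le_pow_right (by norm_num) ?_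
    have : p.ell = Nat.log 2 N + 2 := rfl
    omega
  have hw : 2 ^ p.w ≤ 2 ^ (41 * b) :=
    Nat.pow_le_pow_right (by norm_num) (Params.w_le (p := p) hb1 hT)
  have hcard : Nat.card (Msg p) ≤ p.prioRange * p.U + 1 + (p.U + p.U * 2 ^ p.w) + 1 + 1 := by
    refine (Nat.card_le_card_of_injective _ Msg.toSum_injective).trans (le_of_eq ?_)
    rw [Nat.card_eq_fintype_card]
    simp [ZMod.card]
  refine hcard.trans ?_
  set E := 2 ^ ((2 * A + 41) * b) with hE
  have h1 : p.prioRange * p.U ≤ E := by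
    calc _ ≤ 2 ^ (20 * b) * 2 ^ (2 * A * b) := Nat.mul_le_mul hprio hU2
      _ = 2 ^ (20 * b + 2 * A * b) := (pow_add _ _ _).symm
      _ ≤ _ := Nat.pow_le_pow_right (by norm_num) (by nlinarith)
  have h2 : p.U * 2 ^ p.w ≤ E := by
    calc _ ≤ 2 ^ (2 * A * b) * 2 ^ (41 * b) := Nat.mul_le_mul hU2 hw
      _ = 2 ^ (2 * A * b + 41 * b) := (pow_add _ _ _).symm
      _ = _ := by rw [hE]; congr 1; ring
  have h3 : p.U ≤ E := hU2.trans (Nat.pow_le_pow_right (by norm_num) (by nlinarith))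
  have h4 : 1 ≤ E := Nat.one_le_two_pow
  calc _ ≤ E * 2 ^ 3 := by omega
    _ = 2 ^ ((2 * A + 41) * b + 3) := (pow_add _ _ _).symm
    _ ≤ _ := Nat.pow_le_pow_right (by norm_num) (by nlinarith)

end PatchSharing

/-! ### The main theorem -/

theorem lemma11 :
    ∃ κ : ℕ, ∀ A : ℕ, ∃ B : ℕ, ∀ c : ℕ, ∃ C : ℕ, ∀ n N b T U : ℕ,
      2 ≤ n → n ≤ 2 * N → N ≤ 2 * n → Real.log n ≤ b → 1 ≤ T → U ≤ n ^ A →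
      (patchSharing ⟨κ, N, b, T, U⟩).MessageBits (B * b) ∧
      ∀ R : ℕ, (C : ℝ) * ((n + b * T ^ 2) * Real.log n) ≤ R →
        SolvesIndexedBroadcast (patchSharing ⟨κ, N, b, T, U⟩) n T R (1 - 1 / (n : ℝ) ^ c) := by
  refine ⟨20, fun A => ⟨2 * A + 44, fun c => ⟨16 * (1330 + 4 * c), ?_⟩⟩⟩
  intro n N b T U hn hN hN' hb hT hU
  have hb1 : 1 ≤ b := by
    have h1 := (PatchSharing.half_le_log hn).trans hb
    by_contra h0
    have h2 : b = 0 := by omega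
    rw [h2] at h1
    norm_num at h1
  refine ⟨PatchSharing.messageBits hn hN' hb hb1 hT hU, fun R hR => ?_⟩
  intro uid huid tok H hH adv hc hs
  refine le_trans ?_ (PatchSharing.solvesIndexedBroadcast (PatchSharing.adequate hN hT) R
    uid huid tok H hH adv hc hs)
  exact sub_le_sub_left (PatchSharing.failure_le hn hN' hb1 hT hR) 1
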